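/- For $0<\alpha\le 1$ and $r,k\in\mathbb N$ write $x=\sqrt{rk\log(1/\alpha)}$, and read $\tilde O(x)$ as $C\,x\,\log^{c}(x+2)$ (natural logarithm). An $r$-of-$k$ query over $\{0,1\}^d$ is given by a set $S\subseteq[d]$ with $|S|\le k$; its answer on a database $D\in(\{0,1\}^d)^n$ is the fraction of the $n$ rows in which at least $r$ of the attributes in $S$ equal $1$. Theorem. For every $\beta>0$ there are constants $C>0$ and $c\in\mathbb N$, depending only on $\beta$, such that for all $r,k,d,n\in\mathbb N$ with $r\le k\le d$ and $d\ge 2$, all $\alpha\in(0,1]$ and all $\varepsilon>0$ there are a randomized sanitizer, which maps a database $D\in(\{0,1\}^d)^n$ to a summary, and a deterministic evaluator, which computes a number from a summary and a query $S$, such that: (1) Privacy. The sanitizer $\mathcal A$ is $\varepsilon$-differentially private: $\Pr[\mathcal A(D)\in U]\le e^{\varepsilon}\Pr[\mathcal A(D')\in U]$ for all $D,D'\in(\{0,1\}^d)^n$ that differ in at most one row, and all sets $U$ of summaries. (2) Running time. Both are programs of a unit-cost random access machine with integer cells, addition, subtraction, comparison, indirect addressing and fair coin flips. The number of steps of the sanitizer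 (for every database and every outcome of the coins), plus the number of steps of the evaluator (for every query and every possible summary), plus the lengths of the two programs, is at most $C\,n\,d^{\tilde O(x)}$. (3) Accuracy. If $n\ge d^{\tilde O(x)}/\varepsilon$ (in case $\alpha\ge d^{-(x+1)}$), respectively $n\ge d^{\tilde O(x)}/(\alpha\varepsilon)$ (in case $\alpha<d^{-(x+1)}$), then for every database $D\in(\{0,1\}^d)^n$, with probability at least $1-\beta$ over the coins of the sanitizer, the evaluator answers all $r$-of-$k$ queries on $D$ simultaneously up to an additive error of at most $\alpha$. -/

import Mathlib

namespace RofK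

/-! ## Counting queries, differential privacy, accuracy -/

/-- A database with `n` rows of `d` binary attributes. -/
abbrev Database (n d : ℕ) : Type := Fin n → Fin d → Bool

/-- Two databases are adjacent if they differ in at most one row. -/
def Adjacent {X : Type} {n : ℕ} (D D' : Fin n → X) : Prop :=
  ∃ i, ∀ j, j ≠ i → D j = D' j

/-- A randomized map on databases is `ε`-differentially private. -/
def IsDP {X R : Type} {n : ℕ} (ε : ℝ) (A : (Fin n → X) → PMF R) : Prop :=
  ∀ D D' : Fin n → X, Adjacent D D' → ∀ S : Set R,
    (A D).toOuterMeasure S ≤ ENNReal.ofReal (Real.exp ε) * (A D').toOuterMeasure S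

open Classical in
/-- The answer of the counting query `q` on `D`: the fraction of rows satisfying `q`. -/
noncomputable def answer {X : Type} {n : ℕ} (q : X → Prop) (D : Fin n → X) : ℝ :=
  (∑ i, if q (D i) then (1 : ℝ) else 0) / n

/-- `(α, β)`-accuracy: for each database, with probability at least `1 - β` over the summary `z`,
the evaluator `ev` answers all queries simultaneously from `z`, up to additive error `α`. -/
def IsAccurate {X R Q : Type} {n : ℕ} (α β : ℝ) (A : (Fin n → X) → PMF R)
    (ev : R → Q → ℝ) (q : Q → X → Prop) : Prop :=
  ∀ D : Fin n → X,
    ENNReal.ofReal (1 - β) ≤ (A D).toOuterMeasure {z | ∀ y, |ev z y - answer (q y) D| ≤ α}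

/-- Index set of the `r`-of-`k` queries over `d` attributes: sets of at most `k` attributes. -/
abbrev QueryIndex (k d : ℕ) : Type := {S : Finset (Fin d) // S.card ≤ k}

/-- The `r`-of-`k` predicate given by `S`: at least `r` of the attributes in `S` are set to `1`. -/
def rOfK (r : ℕ) {k d : ℕ} (S : QueryIndex k d) (x : Fin d → Bool) : Prop :=
  r ≤ (S.1.filter fun j => x j = true).card

/-! ## A random access machine with fair coins

The memory cells hold integers and are `0` at the start. The arithmetic instructions are addition
and subtraction only (no multiplication, and `1` is the only literal that can be loaded), so that
charging one time unit per instruction is a reasonable cost measure. The input is a read-only array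
with random access, the output is a write-only list, and the machine halts when the program counter
leaves the program. -/

inductive Instr : Type
  /-- `mem[i] := 1` -/
  | one (i : ℕ)
  /-- `mem[i] := mem[j] + mem[k]` -/
  | add (i j k : ℕ)
  /-- `mem[i] := mem[j] - mem[k]` -/
  | sub (i j k : ℕ)
  /-- `mem[i] := mem[mem[j]]` -/
  | load (i j : ℕ)
  /-- `mem[mem[i]] := mem[j]` -/
  | store (i j : ℕ)
  /-- `mem[i] := input[mem[j]]` (which is `0` past the end of the input) -/
  | read (i j : ℕ)
  /-- `mem[i] :=` a fresh fair coin, `0` or `1` -/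
  | flip (i : ℕ)
  /-- append `mem[i]` to the output -/
  | write (i : ℕ)
  /-- go to instruction `l` -/
  | jump (l : ℕ)
  /-- go to instruction `l` if `mem[i] > 0` -/
  | jumpPos (i l : ℕ)

abbrev Program : Type := List Instr

structure Config : Type where
  /-- program counter -/
  pc : ℕ
  /-- number of coins used so far -/
  used : ℕ
  mem : ℕ → ℤ
  out : List ℤ

def Config.start : Config := ⟨0, 0, fun _ => 0, []⟩

/-- Store `v` in cell `i` and go on to the next instruction. -/
def Config.put (c : Config) (i : ℕ) (v : ℤ) : Config :=
  { c with pc := c.pc + 1, mem := Function.update c.mem i v }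

/-- Effect of one instruction, on the given input and sequence of coins. -/
def Instr.run (inp : List ℤ) (coin : ℕ → Bool) (c : Config) : Instr → Config
  | .one i => c.put i 1
  | .add i j k => c.put i (c.mem j + c.mem k)
  | .sub i j k => c.put i (c.mem j - c.mem k)
  | .load i j => c.put i (c.mem (c.mem j).toNat)
  | .store i j => c.put (c.mem i).toNat (c.mem j)
  | .read i j => c.put i (inp.getD (c.mem j).toNat 0)
  | .flip i => { c.put i (if coin c.used then 1 else 0) with used := c.used + 1 }
  | .write i => { c with pc := c.pc + 1, out := c.out ++ [c.mem i] }
  | .jump l => { c with pc := l }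
  | .jumpPos i l => { c with pc := if 0 < c.mem i then l else c.pc + 1 }

/-- One step; a halted machine does not change. -/
def Program.step (p : Program) (inp : List ℤ) (coin : ℕ → Bool) (c : Config) : Config :=
  match p[c.pc]? with
  | none => c
  | some I => I.run inp coin c

/-- The configuration after `T` steps. -/
def Program.exec (p : Program) (inp : List ℤ) (coin : ℕ → Bool) (T : ℕ) : Config :=
  (p.step inp coin)^[T] Config.start

/-- The machine halts within `T` steps on this input, for these coins. -/
def Program.HaltsWithin (p : Program) (inp : List ℤ) (coin : ℕ → Bool) (T : ℕ) : Prop :=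
  p.length ≤ (p.exec inp coin T).pc

/-- A block of `T` coins, padded by zeros (a run of `T` steps uses at most `T` coins). -/
def coins {T : ℕ} (ω : Fin T → Bool) : ℕ → Bool :=
  fun m => if h : m < T then ω ⟨m, h⟩ else false

/-- The law of the output after `T` steps, for independent fair coins. -/
noncomputable def Program.outputLaw (p : Program) (inp : List ℤ) (T : ℕ) : PMF (List ℤ) :=
  (PMF.uniformOfFintype (Fin T → Bool)).map fun ω => (p.exec inp (coins ω) T).out

/-! ## Input and output formats -/

/-- The database as an input array: row `i`, attribute `j` is at position `i * d + j`. -/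
def encodeDatabase {n d : ℕ} (D : Database n d) : List ℤ :=
  List.ofFn fun a : Fin (n * d) =>
    if D (finProdFinEquiv.symm a).1 (finProdFinEquiv.symm a).2 then 1 else 0

/-- The input of the evaluator: the indicator vector of `S`, followed by the summary `z`. -/
def encodeQuery {k d : ℕ} (S : QueryIndex k d) (z : List ℤ) : List ℤ :=
  (List.ofFn fun j : Fin d => if j ∈ S.1 then (1 : ℤ) else 0) ++ z

/-- An answer is written as a numerator followed by a denominator. -/
noncomputable def decodeAnswer : List ℤ → ℝ
  | [a, b] => (a : ℝ) / (b : ℝ)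
  | _ => 0

/-- The random summary that `san`, run for `T` steps, releases for the database `D`. -/
noncomputable def summary (san : Program) (n d T : ℕ) (D : Database n d) : PMF (List ℤ) :=
  san.outputLaw (encodeDatabase D) T

/-- The answer that the program `ev` computes in `T` steps from the summary `z`. The evaluator is
deterministic: all its coins are `0`. -/
noncomputable def evaluate (ev : Program) {k d : ℕ} (T : ℕ) (z : List ℤ)
    (S : QueryIndex k d) : ℝ :=
  decodeAnswer (ev.exec (encodeQuery S z) (fun _ => false) T).out

/-- `san` and `ev` run in total time at most `B`: `san` halts within `T₁` steps for all databases
and all coins, `ev` halts within `T₂` steps for all queries and all summaries that can occur, and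
`T₁ + T₂` plus the lengths of the two programs is at most `B`. (The programs may depend on the
parameters, so their lengths are charged, and no table comes for free.) -/
def RunsInTime (san ev : Program) (n d k T₁ T₂ : ℕ) (B : ℝ) : Prop :=
  (∀ (D : Database n d) (coin : ℕ → Bool), san.HaltsWithin (encodeDatabase D) coin T₁) ∧
  (∀ (D : Database n d), ∀ z ∈ (summary san n d T₁ D).support, ∀ S : QueryIndex k d,
    ev.HaltsWithin (encodeQuery S z) (fun _ => false) T₂) ∧
  ((T₁ + T₂ + san.length + ev.length : ℕ) : ℝ) ≤ B

/-! ## The bounds -/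

/-- `√(r k log (1/α))` -/
noncomputable def baseExp (r k : ℕ) (α : ℝ) : ℝ := √(r * k * Real.log (1 / α))

/-- An upper bound of the form `Õ(x)`: `C · x · log(x + 2) ^ c`. -/
noncomputable def softO (C : ℝ) (c : ℕ) (x : ℝ) : ℝ := C * x * Real.log (x + 2) ^ c

/-- `d ^ Õ(√(r k log (1/α)))` -/
noncomputable def growth (C : ℝ) (c r k d : ℕ) (α : ℝ) : ℝ :=
  (d : ℝ) ^ softO C c (baseExp r k α)

/-- The required database size: `d ^ Õ(√(r k log (1/α))) / ε`, with an additional factor `1 / α`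
when `α` is so small that `1 / α > d ^ (√(r k log (1/α)) + 1)`. -/
noncomputable def minSize (C : ℝ) (c r k d : ℕ) (α ε : ℝ) : ℝ :=
  if 1 / α ≤ (d : ℝ) ^ (baseExp r k α + 1) then growth C c r k d α / ε
  else growth C c r k d α / (α * ε)

end RofK

namespace RofK

/-! Let j be the number of ones that a row has in `S`. A polynomial in the binomial basis, ∑ a_m (j
choose m) with m ≤ t, counts the sets B ⊆ S of at most t attributes that are all 1 in the row, with
weight a_|B|. Summed over the rows it is a linear combination of marginals, the numbers of rows in
which all attributes of B are 1 (`sum_marginal`). So the sanitizer releases a noisy marginal for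
each set of at most t attributes, d^O(t) numbers in all, and the evaluator forms the linear
combination. This needs a polynomial of degree Õ(x) that is close to the threshold function [r ≤ j]
on {0, …, k} and has bounded coefficients, and noise that is purely differentially private and
exactly samplable with a bounded number of fair coins.

Polynomial. `exists_indicator_polynomial` interpolates on {0, …, l} and multiplies each Lagrange
basis polynomial by a Chebyshev polynomial of degree s that is bounded on the rest of {0, …, k} and
huge at the nodes below r. With l of order r log(1/α) and s of order √(kl) log k the error is at
most α/4, and the degree l + s is O(x log(x + 2)). Where this is not below k, or α is extremely
small, k itself is O(x log(x + 2)) and exact interpolation serves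
(`exists_isThresholdApprox_of_degree_le`). The coefficients are forward differences at 0, hence at
most exponential in the degree, and are rounded to multiples of 1/N
(`exists_isThresholdApprox_of_polynomial`).

Noise. A run of j ones among fair coins selects a scale, and the difference of two uniform (L +
j)-bit numbers is added. The law is a mixture of tents of widths 2^(L+j) with geometrically decaying
weights. Moving the centre by 1 changes the count of a tent by at most 1, and only on its support,
where the next wider tent is at least 2^L; so the law changes by a factor of at most 1 + 8/2^L
(`levelCount_sub_le`, `noiseCount_le_of_abs_sub_le_one`). The coins are finite in number, so there
is a widest tent; it forgets the value and hence needs no successor. This gives privacy without an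
additive loss. Large noise needs a long run of ones, so a union bound gives accuracy
(`card_forall_exists_false`).

Machine. Both programs are straight-line: they read the input, flip coins and write values of
arithmetic expressions (`out_exprProgram`). The running time is then the program length, which is
bounded by counting instructions.

Parameters. All quantities are compared with powers of H = d^(x log(x + 2)). As H² ≥ 2 and d ≤ H²,
constants and powers of d are absorbed into the exponent, and `growth` with c = 1 is exactly H^C
(`growth_natCast`, `exists_programs_of_minSize_le`). -/

/-! ## Straight-line programs -/

/-- An instruction that passes control to the next one. -/
def Instr.IsStraight : Instr → Prop
  | .jump _ => False
  | .jumpPos _ _ => False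
  | _ => True

/-- The effect of a list of instructions, executed one after the other. -/
def runList (inp : List ℤ) (coin : ℕ → Bool) (p : Program) (c : Config) : Config :=
  p.foldl (fun c I => I.run inp coin c) c

section
variable (inp : List ℤ) (coin : ℕ → Bool)

@[simp] theorem runList_nil (c : Config) : runList inp coin [] c = c := rfl

@[simp] theorem runList_cons (I : Instr) (p : Program) (c : Config) :
    runList inp coin (I :: p) c = runList inp coin p (I.run inp coin c) := rfl

@[simp] theorem runList_append (p q : Program) (c : Config) :
    runList inp coin (p ++ q) c = runList inp coin q (runList inp coin p c) := by
  simp [runList]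

variable {inp coin}

theorem Instr.IsStraight.pc_run {I : Instr} (h : I.IsStraight) (c : Config) :
    (I.run inp coin c).pc = c.pc + 1 := by
  cases I <;> first | rfl | exact h.elim

theorem pc_runList {p : Program} (h : ∀ I ∈ p, I.IsStraight) (c : Config) :
    (runList inp coin p c).pc = c.pc + p.length := by
  induction p generalizing c with
  | nil => rfl
  | cons I p ih =>
    rw [runList_cons, ih (fun J hJ => h J (List.mem_cons_of_mem _ hJ)),
      (h I List.mem_cons_self).pc_run, List.length_cons]
    omega

/-- The induction moves each executed instruction from `p` to the prefix `q`. The whole program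
stays the same, and the program counter stays equal to the length of the prefix. -/
theorem iterate_step_eq_runList (q p : Program) (h : ∀ I ∈ p, I.IsStraight) (c : Config)
    (hc : c.pc = q.length) :
    (Program.step (q ++ p) inp coin)^[p.length] c = runList inp coin p c := by
  induction p generalizing q c with
  | nil => rfl
  | cons I p ih =>
    have hI : Program.step (q ++ I :: p) inp coin c = I.run inp coin c := by
      simp [Program.step, hc]
    have hpc := (h I List.mem_cons_self).pc_run (inp := inp) (coin := coin) c
    rw [List.length_cons, Function.iterate_succ_apply, hI, runList_cons]
    have := ih (q ++ [I]) (fun J hJ => h J (List.mem_cons_of_mem _ hJ)) (I.run inp coin c)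
      (by simp [hpc, hc])
    simpa using this

theorem exec_eq_runList {p : Program} (h : ∀ I ∈ p, I.IsStraight) :
    p.exec inp coin p.length = runList inp coin p Config.start := by
  exact iterate_step_eq_runList (inp := inp) (coin := coin) [] p h Config.start rfl

/-- Straight-line code cannot loop, whatever the input and the coins are. Every bound on running
time thereby becomes a bound on program length. -/
theorem haltsWithin_length {p : Program} (h : ∀ I ∈ p, I.IsStraight) :
    p.HaltsWithin inp coin p.length := by
  rw [Program.HaltsWithin, exec_eq_runList h, pc_runList h]
  omega

end

/-! ## Compiling arithmetic expressions -/

/-- Arithmetic expressions over memory cells. The conditional `guard e₁ e₂` is `e₂` if `e₁ = 1`,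
and is meant for conditions with value at most `1`. -/
inductive Expr : Type
  | one
  | cell (i : ℕ)
  | add (e₁ e₂ : Expr)
  | sub (e₁ e₂ : Expr)
  | dbl (e : Expr)
  | guard (e₁ e₂ : Expr)

namespace Expr

def eval (m : ℕ → ℤ) : Expr → ℤ
  | one => 1
  | cell i => m i
  | add e₁ e₂ => e₁.eval m + e₂.eval m
  | sub e₁ e₂ => e₁.eval m - e₂.eval m
  | dbl e => 2 * e.eval m
  | guard e₁ e₂ => if e₁.eval m = 1 then e₂.eval m else 0

/-- All cells in the expression are below `b` and differ from the scratch cell `1`, and all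
conditions have value at most `1`. -/
def Ok (m : ℕ → ℤ) (b : ℕ) : Expr → Prop
  | one => True
  | cell i => i ≠ 1 ∧ i < b
  | add e₁ e₂ => e₁.Ok m b ∧ e₂.Ok m b
  | sub e₁ e₂ => e₁.Ok m b ∧ e₂.Ok m b
  | dbl e => e.Ok m b
  | guard e₁ e₂ => (e₁.Ok m b ∧ e₁.eval m ≤ 1) ∧ e₂.Ok m b

/-- Code that stores the value of the expression in cell `b`, with the cells above `b` as working
space. -/
def compile : Expr → ℕ → Program
  | one, b => [.one b]
  | cell i, b => [.add b i 0]
  | add e₁ e₂, b => e₁.compile b ++ e₂.compile (b + 1) ++ [.add b b (b + 1)]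
  | sub e₁ e₂, b => e₁.compile b ++ e₂.compile (b + 1) ++ [.sub b b (b + 1)]
  | dbl e, b => e.compile b ++ [.add b b b]
  -- Branching by indirect addressing: the condition is used as an address. Cell `1` holds the value
  -- of `e₂` and cell `0` holds 0; a negative condition is truncated to address 0.
  | guard e₁ e₂, b => e₁.compile b ++ e₂.compile (b + 1) ++ [.add 1 (b + 1) 0, .load b b]

def size : Expr → ℕ
  | one => 1
  | cell _ => 1
  | add e₁ e₂ => e₁.size + e₂.size + 1
  | sub e₁ e₂ => e₁.size + e₂.size + 1
  | dbl e => e.size + 1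
  | guard e₁ e₂ => e₁.size + e₂.size + 2

theorem length_compile (e : Expr) (b : ℕ) : (e.compile b).length = e.size := by
  induction e generalizing b <;> simp_all [compile, size, add_assoc]

theorem isStraight_compile (e : Expr) (b : ℕ) : ∀ I ∈ e.compile b, I.IsStraight := by
  induction e generalizing b with
  | one => simp [compile, Instr.IsStraight]
  | cell i => simp [compile, Instr.IsStraight]
  | add e₁ e₂ h₁ h₂ | sub e₁ e₂ h₁ h₂ | guard e₁ e₂ h₁ h₂ =>
    intro I hI
    simp only [compile, List.mem_append] at hI
    rcases hI with (hI | hI) | hI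
    · exact h₁ _ I hI
    · exact h₂ _ I hI
    · revert I; simp [Instr.IsStraight]
  | dbl e h =>
    intro I hI
    simp only [compile, List.mem_append] at hI
    rcases hI with hI | hI
    · exact h _ I hI
    · revert I; simp [Instr.IsStraight]

theorem Ok.mono {m : ℕ → ℤ} {b b' : ℕ} (hb : b ≤ b') {e : Expr} (h : e.Ok m b) : e.Ok m b' := by
  induction e with
  | one => trivial
  | cell i => exact ⟨h.1, h.2.trans_le hb⟩
  | add e₁ e₂ h₁ h₂ => exact ⟨h₁ h.1, h₂ h.2⟩
  | sub e₁ e₂ h₁ h₂ => exact ⟨h₁ h.1, h₂ h.2⟩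
  | dbl e he => exact he h
  | guard e₁ e₂ h₁ h₂ => exact ⟨⟨h₁ h.1.1, h.1.2⟩, h₂ h.2⟩

theorem eval_congr {m m' : ℕ → ℤ} {b : ℕ} (hm : ∀ i, i ≠ 1 → i < b → m' i = m i) {e : Expr}
    (h : e.Ok m b) : e.eval m' = e.eval m := by
  induction e with
  | one => rfl
  | cell i => exact hm i h.1 h.2
  | add e₁ e₂ h₁ h₂ => simp [eval, h₁ h.1, h₂ h.2]
  | sub e₁ e₂ h₁ h₂ => simp [eval, h₁ h.1, h₂ h.2]
  | dbl e he => simp [eval, he h]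
  | guard e₁ e₂ h₁ h₂ => simp [eval, h₁ h.1.1, h₂ h.2]

theorem Ok.congr {m m' : ℕ → ℤ} {b : ℕ} (hm : ∀ i, i ≠ 1 → i < b → m' i = m i) {e : Expr}
    (h : e.Ok m b) : e.Ok m' b := by
  induction e with
  | one => trivial
  | cell i => exact h
  | add e₁ e₂ h₁ h₂ => exact ⟨h₁ h.1, h₂ h.2⟩
  | sub e₁ e₂ h₁ h₂ => exact ⟨h₁ h.1, h₂ h.2⟩
  | dbl e he => exact he h
  | guard e₁ e₂ h₁ h₂ =>
    exact ⟨⟨h₁ h.1.1, (eval_congr hm h.1.1).trans_le h.1.2⟩, h₂ h.2⟩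

/-- The second operand is compiled at `b + 1`, so the preservation of lower cells protects the first
operand in cell `b`. Cell `1` is exempt because `guard` overwrites it; cell `0` must be 0 because it
serves as the constant in copies and as the false branch of `guard`. -/
theorem runList_compile {inp : List ℤ} {coin : ℕ → Bool} (e : Expr) (b : ℕ) (hb : 2 ≤ b)
    (c : Config) (h : e.Ok c.mem b) (h0 : c.mem 0 = 0) :
    let c' := runList inp coin (e.compile b) c
    c'.mem b = e.eval c.mem ∧ (∀ i, i ≠ 1 → i < b → c'.mem i = c.mem i) ∧ c'.out = c.out := by
  induction e generalizing b c with
  | one =>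
    refine ⟨by simp [compile, Instr.run, Config.put, eval], fun i _ hi => ?_, rfl⟩
    simp [compile, Instr.run, Config.put, hi.ne]
  | cell j =>
    refine ⟨by simp [compile, Instr.run, Config.put, eval, h0], fun i _ hi => ?_, rfl⟩
    simp [compile, Instr.run, Config.put, hi.ne]
  | dbl e he =>
    obtain ⟨h1, h2, h3⟩ := he b hb c h h0
    refine ⟨?_, fun i hi hib => ?_, ?_⟩
    · simp [compile, Instr.run, Config.put, h1, eval, two_mul]
    · simp [compile, Instr.run, Config.put, h2 i hi hib, hib.ne]
    · simpa [compile, Instr.run, Config.put] using h3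
  | add e₁ e₂ he₁ he₂ =>
    obtain ⟨h1, h2, h3⟩ := he₁ b hb c h.1 h0
    have hok : e₂.Ok (runList inp coin (e₁.compile b) c).mem b := h.2.congr h2
    obtain ⟨k1, k2, k3⟩ := he₂ (b + 1) (by omega) _ (hok.mono (Nat.le_succ b))
      (by rw [h2 0 (by omega) (by omega), h0])
    rw [eval_congr h2 h.2] at k1
    refine ⟨?_, fun i hi hib => ?_, ?_⟩
    · simp [compile, Instr.run, Config.put, k1, k2 b (by omega) (by omega), h1, eval]
    · simp [compile, Instr.run, Config.put, k2 i hi (by omega), h2 i hi hib, hib.ne]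
    · simp [compile, Instr.run, Config.put, k3, h3]
  | sub e₁ e₂ he₁ he₂ =>
    obtain ⟨h1, h2, h3⟩ := he₁ b hb c h.1 h0
    have hok : e₂.Ok (runList inp coin (e₁.compile b) c).mem b := h.2.congr h2
    obtain ⟨k1, k2, k3⟩ := he₂ (b + 1) (by omega) _ (hok.mono (Nat.le_succ b))
      (by rw [h2 0 (by omega) (by omega), h0])
    rw [eval_congr h2 h.2] at k1
    refine ⟨?_, fun i hi hib => ?_, ?_⟩
    · simp [compile, Instr.run, Config.put, k1, k2 b (by omega) (by omega), h1, eval]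
    · simp [compile, Instr.run, Config.put, k2 i hi (by omega), h2 i hi hib, hib.ne]
    · simp [compile, Instr.run, Config.put, k3, h3]
  | guard e₁ e₂ he₁ he₂ =>
    obtain ⟨h1, h2, h3⟩ := he₁ b hb c h.1.1 h0
    have hok : e₂.Ok (runList inp coin (e₁.compile b) c).mem b := h.2.congr h2
    obtain ⟨k1, k2, k3⟩ := he₂ (b + 1) (by omega) _ (hok.mono (Nat.le_succ b))
      (by rw [h2 0 (by omega) (by omega), h0])
    rw [eval_congr h2 h.2] at k1
    have hb1 : b ≠ 1 := by omega
    have z0 := k2 0 (by omega) (by omega)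
    rw [h2 0 (by omega) (by omega), h0] at z0
    have kb := k2 b (by omega) (by omega)
    rw [h1] at kb
    refine ⟨?_, fun i hi hib => ?_, ?_⟩
    · rcases eq_or_ne (e₁.eval c.mem) 1 with h' | h'
      · simp [compile, Instr.run, Config.put, k1, kb, h', eval, z0, hb1]
      · have : (e₁.eval c.mem).toNat = 0 := by have := h.1.2; omega
        simp [compile, Instr.run, Config.put, kb, h', eval, z0, hb1, this]
    · simp [compile, Instr.run, Config.put, k2 i hi (by omega), h2 i hi hib, hib.ne, hi]
    · simp [compile, Instr.run, Config.put, k3, h3]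

end Expr

/-! ## Programs that evaluate expressions in the input and the coins -/

/-- Copy the first `N` entries of the input to the cells `2, 3, …`. -/
def readInput : ℕ → Program
  | 0 => []
  -- Cell `1` is the running index. Cell `3 + N` holds the increment only briefly: it is the target
  -- of the next read.
  | N + 1 => readInput N ++ [.read (2 + N) 1, .one (3 + N), .add 1 1 (3 + N)]

/-- Flip `B` coins and store them in the cells `a, a + 1, …`. -/
def flipCoins (a : ℕ) : ℕ → Program
  | 0 => []
  | B + 1 => flipCoins a B ++ [.flip (a + B)]

/-- Write the values of a list of expressions, with the cells from `b` on as working space. -/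
def writeExprs (b : ℕ) : List Expr → Program
  | [] => []
  | e :: es => e.compile b ++ .write b :: writeExprs b es

/-- The program that reads `N` entries of the input, flips `B` coins and writes the values of the
expressions `es`. -/
def exprProgram (N B : ℕ) (es : List Expr) : Program :=
  readInput N ++ flipCoins (2 + N) B ++ writeExprs (2 + N + B) es

/-- The memory seen by the expressions of `exprProgram`. -/
def exprMem (N : ℕ) (inp : List ℤ) (coin : ℕ → Bool) : ℕ → ℤ := fun i =>
  if i < 2 then 0 else if i < 2 + N then inp.getD (i - 2) 0
  else if coin (i - (2 + N)) then 1 else 0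

section
variable {inp : List ℤ} {coin : ℕ → Bool}

theorem runList_readInput (N : ℕ) :
    let c := runList inp coin (readInput N) Config.start
    c.mem 0 = 0 ∧ c.mem 1 = N ∧ (∀ i < N, c.mem (2 + i) = inp.getD i 0) ∧ c.used = 0 ∧
      c.out = [] := by
  induction N with
  | zero => simp [readInput, Config.start]
  | succ N ih =>
    obtain ⟨h0, h1, h2, h3, h4⟩ := ih
    have e1 : 3 + N ≠ 1 := by omega
    have e2 : 2 + N ≠ 1 := by omega
    have e3 : 2 + N ≠ 3 + N := by omega
    refine ⟨?_, ?_, fun i hi => ?_, ?_, ?_⟩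
    · have f1 : 0 ≠ 2 + N := by omega
      have f2 : 0 ≠ 3 + N := by omega
      simp [readInput, Instr.run, Config.put, h0, f1, f2]
    · simp [readInput, Instr.run, Config.put, h1, e1.symm, e2.symm]
    · have f1 : 2 + i ≠ 1 := by omega
      have f2 : 2 + i ≠ 3 + N := by omega
      rcases (Nat.lt_succ_iff_lt_or_eq.1 hi) with h | rfl
      · simp [readInput, Instr.run, Config.put, h2 i h, f1, f2, h.ne]
      · simp [readInput, Instr.run, Config.put, h1, f1]
    · simp [readInput, Instr.run, Config.put, h3]
    · simp [readInput, Instr.run, Config.put, h4]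

theorem runList_flipCoins (a B : ℕ) (c : Config) (hc : c.used = 0) :
    let c' := runList inp coin (flipCoins a B) c
    (∀ i < a, c'.mem i = c.mem i) ∧ (∀ i < B, c'.mem (a + i) = if coin i then 1 else 0) ∧
      c'.used = B ∧ c'.out = c.out := by
  induction B with
  | zero => simp [flipCoins, hc]
  | succ B ih =>
    obtain ⟨h1, h2, h3, h4⟩ := ih
    refine ⟨fun i hi => ?_, fun i hi => ?_, ?_, ?_⟩
    · have : i ≠ a + B := by omega
      simp [flipCoins, Instr.run, Config.put, this, h1 i hi]
    · rcases (Nat.lt_succ_iff_lt_or_eq.1 hi) with h | rfl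
      · simp [flipCoins, Instr.run, Config.put, h2 i h, h.ne]
      · simp [flipCoins, Instr.run, Config.put, h3]
    · simp [flipCoins, Instr.run, Config.put, h3]
    · simp [flipCoins, Instr.run, Config.put, h4]

theorem runList_writeExprs (b : ℕ) (hb : 2 ≤ b) (es : List Expr) (m : ℕ → ℤ) (hm0 : m 0 = 0)
    (hes : ∀ e ∈ es, e.Ok m b) (c : Config) (hc : ∀ i, i ≠ 1 → i < b → c.mem i = m i) :
    (runList inp coin (writeExprs b es) c).out = c.out ++ es.map (Expr.eval m) := by
  induction es generalizing c with
  | nil => simp [writeExprs]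
  | cons e es ih =>
    have he := hes e List.mem_cons_self
    have h0 := hc 0 (by omega) (by omega)
    obtain ⟨h1, h2, h3⟩ := Expr.runList_compile (inp := inp) (coin := coin) e b hb c
      (he.congr hc) (by rw [h0, hm0])
    rw [writeExprs, runList_append, runList_cons,
      ih (fun e he => hes e (List.mem_cons_of_mem _ he)) _ fun i hi hib => ?_]
    · simp [Instr.run, h1, h3, Expr.eval_congr hc he]
    · simp [Instr.run, h2 i hi hib, hc i hi hib]

theorem isStraight_exprProgram (N B : ℕ) (es : List Expr) :
    ∀ I ∈ exprProgram N B es, I.IsStraight := by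
  have h1 : ∀ I ∈ readInput N, I.IsStraight := by
    induction N with
    | zero => simp [readInput]
    | succ N ih => simp_all [readInput, Instr.IsStraight, or_imp]
  have h2 : ∀ a, ∀ I ∈ flipCoins a B, I.IsStraight := by
    intro a
    induction B with
    | zero => simp [flipCoins]
    | succ N ih => simp_all [flipCoins, Instr.IsStraight, or_imp]
  have h3 : ∀ b, ∀ I ∈ writeExprs b es, I.IsStraight := by
    intro b
    induction es with
    | nil => simp [writeExprs]
    | cons e es ih =>
      have := e.isStraight_compile b
      simp_all [writeExprs, Instr.IsStraight, or_imp]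
  intro I hI
  simp only [exprProgram, List.mem_append] at hI
  rcases hI with (h | h) | h
  exacts [h1 I h, h2 _ I h, h3 _ I h]

theorem length_exprProgram (N B : ℕ) (es : List Expr) :
    (exprProgram N B es).length = 3 * N + B + (es.map fun e => e.size + 1).sum := by
  have h1 : (readInput N).length = 3 * N := by
    induction N with
    | zero => simp [readInput]
    | succ N ih => simp [readInput, ih]; ring
  have h2 : ∀ a, (flipCoins a B).length = B := by
    intro a
    induction B with
    | zero => simp [flipCoins]
    | succ N ih => simp [flipCoins, ih]
  have h3 : ∀ b, (writeExprs b es).length = (es.map fun e => e.size + 1).sum := by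
    intro b
    induction es with
    | nil => simp [writeExprs]
    | cons e es ih => simp [writeExprs, ih, Expr.length_compile]; ring
  rw [exprProgram, List.length_append, List.length_append, h1, h2, h3]

theorem out_exprProgram (N B : ℕ) (es : List Expr)
    (hes : ∀ e ∈ es, e.Ok (exprMem N inp coin) (2 + N + B)) :
    ((exprProgram N B es).exec inp coin (exprProgram N B es).length).out =
      es.map (Expr.eval (exprMem N inp coin)) := by
  rw [exec_eq_runList (isStraight_exprProgram N B es), exprProgram, runList_append, runList_append]
  obtain ⟨h0, -, h2, h3, h4⟩ := runList_readInput (inp := inp) (coin := coin) N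
  obtain ⟨k1, k2, -, k4⟩ := runList_flipCoins (inp := inp) (coin := coin) (2 + N) B _ h3
  rw [runList_writeExprs (2 + N + B) (by omega) es _ (by simp [exprMem]) hes, k4, h4,
    List.nil_append]
  -- Cell `1` still holds the counter of `readInput`, whereas `exprMem` has 0 there; this is
  -- harmless because `Expr.Ok` keeps expressions away from that cell.
  intro i hi hib
  rcases Nat.lt_or_ge i (2 + N) with h | h
  · rw [k1 i h]
    rcases Nat.lt_or_ge i 2 with h' | h'
    · obtain rfl : i = 0 := by omega
      simp [h0, exprMem]
    · obtain ⟨a, rfl⟩ := Nat.exists_eq_add_of_le h'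
      have f : ¬ 2 + a < 2 := by omega
      simp [h2 a (by omega), exprMem, f, h]
  · obtain ⟨a, rfl⟩ := Nat.exists_eq_add_of_le h
    have f : ¬ 2 + N + a < 2 := by omega
    simp [k2 a (by omega), exprMem, f]

end

/-! ## Derived expressions -/

namespace Expr

def zero : Expr := cell 0

/-- `a` times `e` -/
def mulNat (a : ℕ) (e : Expr) : Expr :=
  if h : a = 0 then zero
  else if a % 2 = 1 then add e (dbl (mulNat (a / 2) e)) else dbl (mulNat (a / 2) e)
termination_by a
decreasing_by all_goals omega

def mulInt (a : ℤ) (e : Expr) : Expr :=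
  if 0 ≤ a then mulNat a.natAbs e else sub zero (mulNat a.natAbs e)

def sum (es : List Expr) : Expr := es.foldr add zero

/-- The value of `e` if the cells in `is` all have value `1`. -/
def guards (is : List ℕ) (e : Expr) : Expr := is.foldr (fun i e => guard (cell i) e) e

section
variable {m : ℕ → ℤ}

theorem eval_mulNat (hm : m 0 = 0) (a : ℕ) (e : Expr) : (mulNat a e).eval m = a * e.eval m := by
  induction a using Nat.strong_induction_on with
  | _ a ih =>
    rw [mulNat]
    split_ifs with h h'
    · simp [h, zero, eval, hm]
    · have : (a : ℤ) = 2 * (a / 2 : ℕ) + 1 := by omega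
      simp only [eval, ih (a / 2) (by omega)]
      rw [this]
      ring
    · have : (a : ℤ) = 2 * (a / 2 : ℕ) := by omega
      simp only [eval, ih (a / 2) (by omega)]
      rw [this]
      ring

theorem Ok.mulNat {b : ℕ} (hb : 0 < b) (a : ℕ) {e : Expr} (he : e.Ok m b) :
    (mulNat a e).Ok m b := by
  induction a using Nat.strong_induction_on with
  | _ a ih =>
    rw [Expr.mulNat]
    split_ifs with h h'
    · exact ⟨by omega, hb⟩
    · exact ⟨he, ih (a / 2) (by omega)⟩
    · exact ih (a / 2) (by omega)

/-- Double-and-add: each binary digit of `a` costs at most one copy of `e` and two further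
instructions, which makes up for the missing multiplication. -/
theorem size_mulNat_le (a l : ℕ) (h : a < 2 ^ l) (e : Expr) :
    (mulNat a e).size ≤ 1 + l * (e.size + 2) := by
  induction l generalizing a with
  | zero =>
    rw [mulNat, dif_pos (by simpa using h)]
    simp [zero, size]
  | succ l ih =>
    have := ih (a / 2) (by rw [pow_succ] at h; omega)
    rw [mulNat]
    split_ifs
    · simp [zero, size]
    · simp only [size]; linarith
    · simp only [size]; linarith

theorem eval_mulInt (hm : m 0 = 0) (a : ℤ) (e : Expr) : (mulInt a e).eval m = a * e.eval m := by
  rw [mulInt]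
  split_ifs with h
  · rw [eval_mulNat hm, Int.natAbs_of_nonneg h]
  · simp only [eval, eval_mulNat hm, zero, hm, Int.ofNat_natAbs_of_nonpos (not_le.1 h).le]
    ring

theorem Ok.mulInt {b : ℕ} (hb : 0 < b) (a : ℤ) {e : Expr} (he : e.Ok m b) :
    (mulInt a e).Ok m b := by
  rw [Expr.mulInt]
  split_ifs with h
  · exact he.mulNat hb _
  · exact ⟨⟨by omega, hb⟩, he.mulNat hb _⟩

theorem size_mulInt_le (a : ℤ) (l : ℕ) (h : a.natAbs < 2 ^ l) (e : Expr) :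
    (mulInt a e).size ≤ 3 + l * (e.size + 2) := by
  have := size_mulNat_le a.natAbs l h e
  rw [mulInt]
  split_ifs
  · omega
  · simp only [size, zero]; omega

theorem eval_sum (hm : m 0 = 0) (es : List Expr) : (sum es).eval m = (es.map (eval m)).sum := by
  induction es with
  | nil => simpa [sum, zero, eval] using hm
  | cons e es ih => simpa [sum, eval] using ih

theorem Ok.sum {b : ℕ} (hb : 0 < b) {es : List Expr} (h : ∀ e ∈ es, e.Ok m b) :
    (sum es).Ok m b := by
  induction es with
  | nil => exact ⟨by omega, hb⟩
  | cons e es ih =>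
    exact ⟨h e List.mem_cons_self, ih fun e he => h e (List.mem_cons_of_mem _ he)⟩

theorem size_sum_le (s : ℕ) {es : List Expr} (h : ∀ e ∈ es, e.size ≤ s) :
    (sum es).size ≤ 1 + es.length * (s + 1) := by
  induction es with
  | nil => simp [sum, zero, size]
  | cons e es ih =>
    have h1 := h e List.mem_cons_self
    have h2 := ih fun e he => h e (List.mem_cons_of_mem _ he)
    rw [List.length_cons]
    change e.size + (sum es).size + 1 ≤ _
    linarith

theorem guards_cons (i : ℕ) (is : List ℕ) (e : Expr) :
    guards (i :: is) e = guard (cell i) (guards is e) := rfl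

open Classical in
theorem eval_guards (is : List ℕ) (e : Expr) :
    (guards is e).eval m = if ∀ i ∈ is, m i = 1 then e.eval m else 0 := by
  induction is with
  | nil => simp [guards]
  | cons i is ih =>
    rw [guards_cons, eval, ih]
    simp only [eval, List.forall_mem_cons]
    split_ifs <;> simp_all

theorem Ok.guards {b : ℕ} {is : List ℕ} {e : Expr} (h : ∀ i ∈ is, i ≠ 1 ∧ i < b ∧ m i ≤ 1)
    (he : e.Ok m b) : (guards is e).Ok m b := by
  induction is with
  | nil => exact he
  | cons i is ih =>
    have hi := h i List.mem_cons_self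
    exact ⟨⟨⟨hi.1, hi.2.1⟩, hi.2.2⟩, ih fun i hi => h i (List.mem_cons_of_mem _ hi)⟩

theorem size_guards (is : List ℕ) (e : Expr) : (guards is e).size = e.size + 3 * is.length := by
  induction is with
  | nil => rfl
  | cons i is ih =>
    rw [guards_cons, size, ih, List.length_cons, size]
    ring

end

end Expr

/-! ## Counting coin sequences -/

/-- Coordinates outside the range of `ι` are free. The equality of probabilities is cross-multiplied
so that it stays in `ℕ`. -/
theorem card_comp_embedding {I J : Type} [Finite I] [Finite J] (ι : I → J)
    (hι : Function.Injective ι) (P : (I → Bool) → Prop) :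
    Nat.card {ω : J → Bool // P (ω ∘ ι)} * 2 ^ Nat.card I =
      Nat.card {σ : I → Bool // P σ} * 2 ^ Nat.card J := by
  classical
  let e : I ⊕ ↥(Set.range ι)ᶜ ≃ J :=
    ((Equiv.ofInjective ι hι).sumCongr (Equiv.refl _)).trans (Equiv.Set.sumCompl (Set.range ι))
  have he : ∀ i, e (Sum.inl i) = ι i := fun i => by simp [e]
  let E : (J → Bool) ≃ (I → Bool) × (↥(Set.range ι)ᶜ → Bool) :=
    (e.arrowCongr (Equiv.refl Bool)).symm.trans (Equiv.sumArrowEquivProdArrow _ _ _)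
  have hE : ∀ ω, (E ω).1 = ω ∘ ι := fun ω => by
    funext i
    simp [E, Equiv.sumArrowEquivProdArrow, Equiv.arrowCongr, he]
  have h1 : Nat.card {ω : J → Bool // P (ω ∘ ι)} =
      Nat.card {σ : I → Bool // P σ} * Nat.card (↥(Set.range ι)ᶜ → Bool) := by
    rw [← Nat.card_prod]
    exact Nat.card_congr ((E.subtypeEquiv (q := fun p => P p.1) fun ω => by rw [hE]).trans
      Equiv.prodSubtypeFstEquivSubtypeProd)
  have h2 : Nat.card J = Nat.card I + Nat.card ↥(Set.range ι)ᶜ := by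
    rw [← Nat.card_sum]
    exact (Nat.card_congr e).symm
  rw [h1, h2, Nat.card_fun, Nat.card_eq_fintype_card (α := Bool), Fintype.card_bool]
  ring

theorem card_pi_subtype {I : Type} [Fintype I] {X : I → Type} [∀ i, Finite (X i)]
    (P : ∀ i, X i → Prop) :
    Nat.card {g : ∀ i, X i // ∀ i, P i (g i)} = ∏ i, Nat.card {x : X i // P i x} := by
  rw [← Nat.card_pi]
  exact Nat.card_congr Equiv.subtypePiEquivPi

theorem card_subtype_eq_sum {X Y : Type} [Fintype X] [Finite Y] (P : X → Y → Prop) :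
    Nat.card {p : X × Y // P p.1 p.2} = ∑ x, Nat.card {y : Y // P x y} := by
  rw [← Nat.card_sigma]
  exact Nat.card_congr
    { toFun := fun p => ⟨p.1.1, p.1.2, p.2⟩
      invFun := fun p => ⟨(p.1, p.2.1), p.2.2⟩
      left_inv := fun _ => rfl
      right_inv := fun _ => rfl }

/-! ## The noise -/

/-- The number with binary digits `u 0, …, u (m - 1)`, the least significant first. -/
def binVal (m : ℕ) (u : ℕ → Bool) : ℤ :=
  ∑ i ∈ Finset.range m, if u i then 2 ^ i else 0

/-- The length of the initial run of ones among `f 0, …, f (J - 1)`. -/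
def lead : ℕ → (ℕ → Bool) → ℕ
  | 0, _ => 0
  | J + 1, f => if f 0 then lead J (fun i => f (i + 1)) + 1 else 0

/-- The value `y` plus the difference of two numbers with `L + j` random digits, where `j` is the
length of the initial run of ones among the first `J` coins; `y` is suppressed if `j = J`. -/
def noisy (L J : ℕ) (ω : ℕ → Bool) (y : ℤ) : ℤ :=
  (if lead J ω = J then 0 else y) + binVal (L + lead J ω) (fun i => ω (J + i)) -
    binVal (L + lead J ω) (fun i => ω (J + (L + J) + i))

theorem binVal_zero (u : ℕ → Bool) : binVal 0 u = 0 := rfl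

theorem binVal_succ (m : ℕ) (u : ℕ → Bool) :
    binVal (m + 1) u = (if u 0 then 1 else 0) + 2 * binVal m (fun i => u (i + 1)) := by
  rw [binVal, Finset.sum_range_succ', add_comm, binVal, Finset.mul_sum]
  congr 1
  refine Finset.sum_congr rfl fun i _ => ?_
  split_ifs <;> ring

theorem binVal_congr {m : ℕ} {u v : ℕ → Bool} (h : ∀ i < m, u i = v i) :
    binVal m u = binVal m v :=
  Finset.sum_congr rfl fun i hi => by rw [h i (Finset.mem_range.1 hi)]

theorem binVal_nonneg (m : ℕ) (u : ℕ → Bool) : 0 ≤ binVal m u :=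
  Finset.sum_nonneg fun i _ => by split_ifs <;> positivity

theorem binVal_lt (m : ℕ) (u : ℕ → Bool) : binVal m u < 2 ^ m := by
  induction m generalizing u with
  | zero => simp [binVal_zero]
  | succ m ih =>
    have := ih fun i => u (i + 1)
    rw [binVal_succ, pow_succ]
    split_ifs <;> omega

theorem lead_le (J : ℕ) (f : ℕ → Bool) : lead J f ≤ J := by
  induction J generalizing f with
  | zero => simp [lead]
  | succ J ih =>
    have := ih fun i => f (i + 1)
    rw [lead]
    split_ifs <;> omega

theorem lead_congr {J : ℕ} {f g : ℕ → Bool} (h : ∀ i < J, f i = g i) : lead J f = lead J g := by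
  induction J generalizing f g with
  | zero => rfl
  | succ J ih =>
    rw [lead, lead, h 0 (by omega), ih fun i hi => h (i + 1) (by omega)]

theorem lead_le_of_eq_false {J : ℕ} {f : ℕ → Bool} {i : ℕ} (h : f i = false) :
    lead J f ≤ i := by
  induction J generalizing f i with
  | zero => simp [lead]
  | succ J ih =>
    rw [lead]
    split_ifs with h0
    · obtain _ | i := i
      · simp [h0] at h
      · exact Nat.succ_le_succ (ih (f := fun i => f (i + 1)) h)
    · omega

theorem lead_eq_iff {J : ℕ} {f : ℕ → Bool} : lead J f = J ↔ ∀ i < J, f i = true := by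
  induction J generalizing f with
  | zero => simp [lead]
  | succ J ih =>
    rw [lead]
    constructor
    · intro h
      split_ifs at h with h0
      have := ih.1 (Nat.succ.inj h)
      intro i hi
      obtain _ | i := i
      · exact h0
      · exact this i (by omega)
    · intro h
      rw [if_pos (h 0 (by omega)), ih.2 fun i hi => h (i + 1) (by omega)]

theorem noisy_congr {L J : ℕ} {ω ω' : ℕ → Bool}
    (h : ∀ i < J + (L + J) + (L + J), ω i = ω' i) (y : ℤ) : noisy L J ω y = noisy L J ω' y := by
  have hl : lead J ω = lead J ω' := lead_congr fun i hi => h i (by omega)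
  have := lead_le J ω'
  rw [noisy, noisy, hl, binVal_congr fun i hi => h (J + i) (by omega),
    binVal_congr fun i hi => h (J + (L + J) + i) (by omega)]

theorem abs_noisy_sub_le {L J i : ℕ} {ω : ℕ → Bool} (hi : i < J) (h : ω i = false) (y : ℤ) :
    |noisy L J ω y - y| ≤ 2 ^ (L + i) := by
  have h1 : lead J ω ≤ i := lead_le_of_eq_false h
  have h2 : (2 : ℤ) ^ (L + lead J ω) ≤ 2 ^ (L + i) := by gcongr; norm_num
  rw [noisy, if_neg (by omega), abs_le]
  have a1 := binVal_nonneg (L + lead J ω) fun i => ω (J + i)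
  have a2 := binVal_nonneg (L + lead J ω) fun i => ω (J + (L + J) + i)
  have b1 := binVal_lt (L + lead J ω) fun i => ω (J + i)
  have b2 := binVal_lt (L + lead J ω) fun i => ω (J + (L + J) + i)
  constructor <;> linarith

/-! ## The law of the noise -/

theorem coins_cons_zero {T : ℕ} (b : Bool) (u : Fin T → Bool) :
    coins (Fin.cons b u : Fin (T + 1) → Bool) 0 = b := by
  rw [coins, dif_pos (Nat.succ_pos T)]
  rfl

theorem coins_cons_succ {T : ℕ} (b : Bool) (u : Fin T → Bool) (i : ℕ) :
    coins (Fin.cons b u : Fin (T + 1) → Bool) (i + 1) = coins u i := by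
  by_cases h : i < T
  · rw [coins, coins, dif_pos h, dif_pos (Nat.succ_lt_succ h)]
    rfl
  · rw [coins, coins, dif_neg h, dif_neg (by omega)]

/-- The lowest digit is forced by the parity of `a` and the others represent `a / 2`; the `m - m'`
digits that are not used are free. -/
theorem card_binVal_eq (m : ℕ) {m' : ℕ} (h : m' ≤ m) (a : ℤ) :
    Nat.card {u : Fin m → Bool // binVal m' (coins u) = a} =
      if 0 ≤ a ∧ a < 2 ^ m' then 2 ^ (m - m') else 0 := by
  induction m' generalizing m a with
  | zero =>
    by_cases ha : a = 0
    · subst ha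
      simp [binVal_zero]
    · have : ¬ (0 ≤ a ∧ a < 2 ^ 0) := by rw [pow_zero]; omega
      rw [if_neg this]
      simp [binVal_zero, Ne.symm ha]
  | succ m' ih =>
    obtain ⟨m, rfl⟩ : ∃ k, m = k + 1 := ⟨m - 1, by omega⟩
    have key : Nat.card {u : Fin (m + 1) → Bool // binVal (m' + 1) (coins u) = a} =
        Nat.card {u : Fin m → Bool // binVal m' (coins u) = a / 2} := by
      refine (Nat.card_congr (((Fin.consEquiv fun _ => Bool).symm).subtypeEquiv
        (q := fun p : Bool × (Fin m → Bool) => (if p.1 then 1 else 0) +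
          2 * binVal m' (coins p.2) = a) fun u => ?_)).trans
        (Nat.card_eq_of_bijective (fun p => (⟨p.1.2, ?_⟩ : {u : Fin m → Bool //
          binVal m' (coins u) = a / 2})) ⟨?_, ?_⟩)
      · obtain ⟨⟨b, v⟩, rfl⟩ := (Fin.consEquiv fun _ => Bool).surjective u
        rw [Equiv.symm_apply_apply]
        change binVal (m' + 1) (coins (Fin.cons b v : Fin (m + 1) → Bool)) = a ↔ _
        simp only [binVal_succ, coins_cons_zero, coins_cons_succ]
      · have := p.2
        split_ifs at this <;> omega
      · rintro ⟨⟨b, u⟩, h1⟩ ⟨⟨b', u'⟩, h2⟩ h3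
        obtain rfl : u = u' := congrArg Subtype.val h3
        have : b = b' := by
          cases b <;> cases b' <;> simp at h1 h2 ⊢ <;> omega
        rw [Subtype.mk.injEq, this]
      · rintro ⟨u, hu⟩
        refine ⟨⟨(decide (a % 2 = 1), u), ?_⟩, rfl⟩
        simp only [decide_eq_true_eq, hu]
        split_ifs <;> omega
    rw [key, ih m (by omega)]
    have e1 : m + 1 - (m' + 1) = m - m' := by omega
    have e2 : (0 ≤ a / 2 ∧ a / 2 < 2 ^ m') ↔ (0 ≤ a ∧ a < 2 ^ (m' + 1)) := by
      rw [pow_succ]; omega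
    simp only [e1, e2]

/-- The number of pairs of elements of `{0, …, 2 ^ m - 1}` with difference `y`. -/
def tent (m : ℕ) (y : ℤ) : ℤ := max 0 (2 ^ m - |y|)

theorem card_diff_eq (m : ℕ) (y : ℤ) :
    (((Finset.Ico (0 : ℤ) (2 ^ m)).filter fun b => 0 ≤ y + b ∧ y + b < 2 ^ m).card : ℤ) =
      tent m y := by
  have : (Finset.Ico (0 : ℤ) (2 ^ m)).filter (fun b => 0 ≤ y + b ∧ y + b < 2 ^ m) =
      Finset.Ico (max 0 (-y)) (min (2 ^ m) (2 ^ m - y)) := by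
    ext b
    simp only [Finset.mem_filter, Finset.mem_Ico, max_le_iff, lt_min_iff]
    omega
  rw [this, Int.card_Ico, tent, Int.toNat_eq_max]
  rcases le_total 0 y with h | h
  · rw [abs_of_nonneg h]; omega
  · rw [abs_of_nonpos h]; omega

/-- For each value `b` of the subtrahend the minuend must be `y + b`, and `tent` counts the
admissible `b`. Unused digits of both numbers contribute `2 ^ (m - m')` each. -/
theorem card_binVal_sub_eq {m m' : ℕ} (h : m' ≤ m) (y : ℤ) :
    (Nat.card {p : (Fin m → Bool) × (Fin m → Bool) //
      binVal m' (coins p.2) - binVal m' (coins p.1) = y} : ℤ) = 4 ^ (m - m') * tent m' y := by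
  classical
  rw [card_subtype_eq_sum fun w u : Fin m → Bool => binVal m' (coins u) - binVal m' (coins w) = y]
  have h1 : ∀ w : Fin m → Bool,
      Nat.card {u : Fin m → Bool // binVal m' (coins u) - binVal m' (coins w) = y} =
      if 0 ≤ y + binVal m' (coins w) ∧ y + binVal m' (coins w) < 2 ^ m' then 2 ^ (m - m')
      else 0 := fun w => by
    rw [← card_binVal_eq m h]
    exact Nat.card_congr (Equiv.subtypeEquivRight fun u => sub_eq_iff_eq_add)
  simp_rw [h1]
  rw [← Finset.sum_fiberwise_of_maps_to (s := Finset.univ) (t := Finset.Ico (0 : ℤ) (2 ^ m'))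
    (g := fun w : Fin m → Bool => binVal m' (coins w))
    (fun w _ => Finset.mem_Ico.2 ⟨binVal_nonneg _ _, binVal_lt _ _⟩)]
  have h2 : ∀ b ∈ Finset.Ico (0 : ℤ) (2 ^ m'),
      (∑ w : Fin m → Bool with binVal m' (coins w) = b,
        if 0 ≤ y + binVal m' (coins w) ∧ y + binVal m' (coins w) < 2 ^ m' then 2 ^ (m - m')
        else 0) = if 0 ≤ y + b ∧ y + b < 2 ^ m' then 4 ^ (m - m') else 0 := fun b hb => by
    have hc := card_binVal_eq m h b
    rw [if_pos (Finset.mem_Ico.1 hb), Nat.card_eq_fintype_card, Fintype.card_subtype] at hc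
    rw [Finset.sum_congr rfl (g := fun _ => if 0 ≤ y + b ∧ y + b < 2 ^ m' then 2 ^ (m - m') else 0)
      fun w hw => by rw [(Finset.mem_filter.1 hw).2], Finset.sum_const, hc, smul_eq_mul]
    split_ifs
    · rw [← mul_pow]
      norm_num
    · rfl
  rw [Finset.sum_congr rfl h2, ← Finset.sum_filter, Finset.sum_const, smul_eq_mul, Nat.cast_mul,
    card_diff_eq, Nat.cast_pow, mul_comm]
  rfl

/-- A run of exactly `j < J` ones is ended by a zero and leaves `J - 1 - j` coins free; the value
`J` occurs for a single sequence. -/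
theorem sum_lead (J : ℕ) (φ : ℕ → ℤ) :
    ∑ f : Fin J → Bool, φ (lead J (coins f)) =
      (∑ j ∈ Finset.range J, 2 ^ (J - 1 - j) * φ j) + φ J := by
  induction J generalizing φ with
  | zero => simp [lead]
  | succ J ih =>
    rw [← (Fin.consEquiv fun _ => Bool).sum_comp, Fintype.sum_prod_type, Fintype.sum_bool]
    change ∑ y, φ (lead (J + 1) (coins (Fin.cons true y : Fin (J + 1) → Bool))) +
      ∑ y, φ (lead (J + 1) (coins (Fin.cons false y : Fin (J + 1) → Bool))) = _
    simp only [lead, coins_cons_zero, coins_cons_succ, if_true, Bool.false_eq_true, if_false]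
    rw [ih fun j => φ (j + 1), Finset.sum_const, Finset.sum_range_succ']
    simp only [Finset.card_univ, Fintype.card_fun, Fintype.card_bool, Fintype.card_fin, nsmul_eq_mul]
    have : ∀ j, J + 1 - 1 - (j + 1) = J - 1 - j := by omega
    simp only [this]
    push_cast
    simp only [Nat.sub_zero]
    ring

/-- The term of `noiseCount` for level `j`. -/
def levelCount (L J : ℕ) (y z : ℤ) (j : ℕ) : ℤ :=
  -- The powers count the free coins after the run and the unused digits of the two numbers. The top
  -- level has neither, and its tent is centred at 0 instead of `y`.
  if j < J then 2 ^ (J - 1 - j) * (4 ^ (J - j) * tent (L + j) (z - y)) else tent (L + J) z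

/-- The number of coin sequences for which the noisy value of `y` is `z`. -/
def noiseCount (L J : ℕ) (y z : ℤ) : ℤ := ∑ j ∈ Finset.range (J + 1), levelCount L J y z j

theorem card_noisy_eq (L J : ℕ) (y z : ℤ) :
    (Nat.card {b : Fin (J + (L + J) + (L + J)) → Bool // noisy L J (coins b) y = z} : ℤ) =
      noiseCount L J y z := by
  classical
  let E : (Fin (J + (L + J) + (L + J)) → Bool) ≃
      (Fin J → Bool) × (Fin (L + J) → Bool) × (Fin (L + J) → Bool) :=
    ((Fin.appendEquiv (J + (L + J)) (L + J)).symm.trans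
      ((Fin.appendEquiv J (L + J)).symm.prodCongr (Equiv.refl _))).trans
      ((Equiv.prodAssoc _ _ _).trans ((Equiv.refl _).prodCongr (Equiv.prodComm _ _)))
  have hE : ∀ f u w, E.symm (f, w, u) = Fin.append (Fin.append f u) w := fun _ _ _ => rfl
  have c1 : ∀ f u w, ∀ i < J, coins (E.symm (f, w, u)) i = coins f i := fun f u w i hi => by
    have h1 : i < J + (L + J) + (L + J) := by omega
    have h2 : (⟨i, h1⟩ : Fin (J + (L + J) + (L + J))) =
      Fin.castAdd (L + J) (Fin.castAdd (L + J) ⟨i, hi⟩) := rfl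
    rw [coins, coins, dif_pos h1, dif_pos hi, hE, h2, Fin.append_left, Fin.append_left]
  have c2 : ∀ f u w, ∀ i < L + J, coins (E.symm (f, w, u)) (J + i) = coins u i :=
    fun f u w i hi => by
    have h1 : J + i < J + (L + J) + (L + J) := by omega
    have h2 : (⟨J + i, h1⟩ : Fin (J + (L + J) + (L + J))) =
      Fin.castAdd (L + J) (Fin.natAdd J ⟨i, hi⟩) := rfl
    rw [coins, coins, dif_pos h1, dif_pos hi, hE, h2, Fin.append_left, Fin.append_right]
  have c3 : ∀ f u w, ∀ i < L + J, coins (E.symm (f, w, u)) (J + (L + J) + i) = coins w i :=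
    fun f u w i hi => by
    have h1 : J + (L + J) + i < J + (L + J) + (L + J) := by omega
    have h2 : (⟨J + (L + J) + i, h1⟩ : Fin (J + (L + J) + (L + J))) =
      Fin.natAdd (J + (L + J)) ⟨i, hi⟩ := rfl
    rw [coins, coins, dif_pos h1, dif_pos hi, hE, h2, Fin.append_right]
  have hn : ∀ f u w, noisy L J (coins (E.symm (f, w, u))) y = z ↔
      binVal (L + lead J (coins f)) (coins u) - binVal (L + lead J (coins f)) (coins w) =
        z - if lead J (coins f) = J then 0 else y := fun f u w => by
    have := lead_le J (coins f)
    rw [noisy, lead_congr (c1 f u w), binVal_congr fun i hi => c2 f u w i (by omega),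
      binVal_congr fun i hi => c3 f u w i (by omega)]
    constructor <;> intro h <;> linarith
  rw [Nat.card_congr (E.symm.subtypeEquiv
    (p := fun p => binVal (L + lead J (coins p.1)) (coins p.2.2) -
      binVal (L + lead J (coins p.1)) (coins p.2.1) =
        z - if lead J (coins p.1) = J then 0 else y) fun p => (hn p.1 p.2.2 p.2.1).symm).symm,
    card_subtype_eq_sum fun (f : Fin J → Bool) (p : (Fin (L + J) → Bool) × (Fin (L + J) → Bool)) =>
      binVal (L + lead J (coins f)) (coins p.2) - binVal (L + lead J (coins f)) (coins p.1) =
        z - if lead J (coins f) = J then 0 else y, Nat.cast_sum]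
  simp_rw [fun f : Fin J → Bool => card_binVal_sub_eq
    (Nat.add_le_add_left (lead_le J (coins f)) L) (z - if lead J (coins f) = J then 0 else y)]
  rw [sum_lead J fun j => 4 ^ (L + J - (L + j)) * tent (L + j) (z - if j = J then 0 else y),
    noiseCount, Finset.sum_range_succ]
  congr 1
  · refine Finset.sum_congr rfl fun j hj => ?_
    have hj := Finset.mem_range.1 hj
    rw [levelCount, if_pos hj, if_neg hj.ne, Nat.add_sub_add_left]
  · simp [levelCount]

theorem tent_nonneg (m : ℕ) (y : ℤ) : 0 ≤ tent m y := le_max_left _ _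

theorem levelCount_nonneg (L J : ℕ) (y z : ℤ) (j : ℕ) : 0 ≤ levelCount L J y z j := by
  have := tent_nonneg (L + j) (z - y)
  rw [levelCount]
  split_ifs
  · positivity
  · exact tent_nonneg _ _

/-- The heart of privacy. `tent` is 1-Lipschitz, so level `j` can gain only where `z` lies in its
support around `y`; there the next level, twice as wide, is still at least `2 ^ L` high around `y'`.
The factor 8 is the ratio of the weights of consecutive levels; at the top it is only 4. -/
theorem levelCount_sub_le {L J : ℕ} (hJ : 2 ≤ J) {y y' z : ℤ} (hy : |y - y'| ≤ 1) (hy0 : 0 ≤ y)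
    (hyJ : y ≤ 2 ^ (L + (J - 2))) {j : ℕ} (hj : j < J) :
    2 ^ L * (levelCount L J y z j - levelCount L J y' z j) ≤ 8 * levelCount L J y' z (j + 1) := by
  have hlip : tent (L + j) (z - y) - tent (L + j) (z - y') ≤
      if |z - y| < 2 ^ (L + j) then 1 else 0 := by
    have h1 : |z - y'| ≤ |z - y| + 1 := by
      have := abs_add_le (z - y) (y - y')
      rw [sub_add_sub_cancel] at this
      linarith
    rw [tent, tent]
    split_ifs <;> omega
  rcases Nat.lt_or_ge |z - y|.toNat (2 ^ (L + j)) with h | h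
  · have h : |z - y| < 2 ^ (L + j) := by
      rw [Int.toNat_lt (abs_nonneg _)] at h
      exact_mod_cast h
    rw [if_pos h] at hlip
    have hp : (2 : ℤ) ^ L ≤ 2 ^ (L + j) := by gcongr <;> omega
    rcases Nat.lt_or_ge (j + 1) J with hj1 | hj1
    · have ht : (2 : ℤ) ^ L ≤ tent (L + (j + 1)) (z - y') := by
        have h1 : |z - y'| ≤ |z - y| + 1 := by
          have := abs_add_le (z - y) (y - y')
          rw [sub_add_sub_cancel] at this
          linarith
        rw [tent, ← add_assoc, pow_succ]
        omega
      obtain ⟨i, rfl⟩ : ∃ i, J = j + 2 + i := ⟨J - (j + 2), by omega⟩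
      have e1 : j + 2 + i - 1 - j = i + 1 := by omega
      have e2 : j + 2 + i - j = i + 2 := by omega
      have e3 : j + 2 + i - 1 - (j + 1) = i := by omega
      have e4 : j + 2 + i - (j + 1) = i + 1 := by omega
      rw [levelCount, levelCount, levelCount, if_pos hj, if_pos hj, if_pos hj1, e1, e2, e3, e4]
      calc (2 : ℤ) ^ L * (2 ^ (i + 1) * (4 ^ (i + 2) * tent (L + j) (z - y)) -
            2 ^ (i + 1) * (4 ^ (i + 2) * tent (L + j) (z - y')))
          = 2 ^ (i + 1) * 4 ^ (i + 2) * (2 ^ L *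
            (tent (L + j) (z - y) - tent (L + j) (z - y'))) := by ring
        _ ≤ 2 ^ (i + 1) * 4 ^ (i + 2) * (2 ^ L * 1) := by gcongr
        _ ≤ 2 ^ (i + 1) * 4 ^ (i + 2) * tent (L + (j + 1)) (z - y') := by
          rw [mul_one]; gcongr
        _ = 8 * (2 ^ i * (4 ^ (i + 1) * tent (L + (j + 1)) (z - y'))) := by ring
    -- The next level is the one centred at 0. Since `y` is at most a quarter of its half-width and
    -- `|z - y|` less than a half, a quarter remains as height at `z`.
    · obtain rfl : J = j + 1 := by omega
      have ht : (2 : ℤ) ^ L ≤ tent (L + (j + 1)) z := by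
        obtain ⟨i, rfl⟩ : ∃ i, j = i + 1 := ⟨j - 1, by omega⟩
        have h1 : |z| ≤ |z - y| + y := by
          have := abs_add_le (z - y) y
          rwa [sub_add_cancel, abs_of_nonneg hy0] at this
        have e : i + 1 + 1 - 2 = i := by omega
        rw [e] at hyJ
        have hp : (2 : ℤ) ^ L ≤ 2 ^ (L + i) := by gcongr <;> omega
        rw [← add_assoc, pow_succ] at h
        rw [tent, ← add_assoc, ← add_assoc, pow_succ, pow_succ]
        omega
      have e1 : j + 1 - 1 - j = 0 := by omega
      have e2 : j + 1 - j = 1 := by omega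
      rw [levelCount, levelCount, levelCount, if_pos hj, if_pos hj, if_neg (by omega), e1, e2]
      have := mul_le_mul_of_nonneg_left hlip (pow_nonneg (zero_le_two (α := ℤ)) L)
      linarith [tent_nonneg (L + (j + 1)) z]
  · have h : ¬ |z - y| < 2 ^ (L + j) := by
      rw [not_lt]
      have : ((2 ^ (L + j) : ℕ) : ℤ) ≤ (|z - y|.toNat : ℤ) := by exact_mod_cast h
      rw [Int.toNat_of_nonneg (abs_nonneg _)] at this
      exact_mod_cast this
    rw [if_neg h] at hlip
    have h0 := levelCount_nonneg L J y' z (j + 1)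
    have : levelCount L J y z j ≤ levelCount L J y' z j := by
      rw [levelCount, levelCount, if_pos hj, if_pos hj]
      gcongr
      linarith
    have h2 : (0 : ℤ) ≤ 2 ^ L := by positivity
    nlinarith

/-- The gain at each level is charged to the next one. The top level has no gain, as it does not
depend on the value, so the charges sum to at most 8 times the count for `y'`. -/
theorem noiseCount_le_of_abs_sub_le_one {L J : ℕ} (hJ : 2 ≤ J) {y y' z : ℤ} (hy : |y - y'| ≤ 1)
    (hy0 : 0 ≤ y) (hyJ : y ≤ 2 ^ (L + (J - 2))) :
    2 ^ L * noiseCount L J y z ≤ (2 ^ L + 8) * noiseCount L J y' z := by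
  have h1 : ∑ j ∈ Finset.range J, 2 ^ L * (levelCount L J y z j - levelCount L J y' z j) ≤
      ∑ j ∈ Finset.range J, 8 * levelCount L J y' z (j + 1) :=
    Finset.sum_le_sum fun j hj => levelCount_sub_le hJ hy hy0 hyJ (Finset.mem_range.1 hj)
  have h2 : noiseCount L J y z - noiseCount L J y' z =
      ∑ j ∈ Finset.range J, (levelCount L J y z j - levelCount L J y' z j) := by
    rw [noiseCount, noiseCount, ← Finset.sum_sub_distrib, Finset.sum_range_succ]
    simp [levelCount]
  have h3 : ∑ j ∈ Finset.range J, levelCount L J y' z (j + 1) ≤ noiseCount L J y' z := by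
    rw [noiseCount, Finset.sum_range_succ']
    linarith [levelCount_nonneg L J y' z 0]
  rw [← Finset.mul_sum, ← Finset.mul_sum, ← h2] at h1
  linarith

theorem noiseCount_nonneg (L J : ℕ) (y z : ℤ) : 0 ≤ noiseCount L J y z :=
  Finset.sum_nonneg fun _ _ => levelCount_nonneg _ _ _ _ _

/-- A walk from `y` to `y'` in unit steps stays in the admissible interval, and each step costs a
factor `1 + 8 / 2 ^ L ≤ exp (8 / 2 ^ L)`. -/
theorem noiseCount_le {L J : ℕ} (hJ : 2 ≤ J) {y y' z : ℤ} (hy0 : 0 ≤ y)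
    (hyJ : y ≤ 2 ^ (L + (J - 2))) (hy0' : 0 ≤ y') (hyJ' : y' ≤ 2 ^ (L + (J - 2))) (K : ℕ)
    (hK : |y - y'| ≤ K) :
    (noiseCount L J y z : ℝ) ≤ Real.exp (8 / 2 ^ L * K) * noiseCount L J y' z := by
  induction K generalizing y with
  | zero =>
    obtain rfl : y = y' := by
      have : |y - y'| ≤ 0 := by exact_mod_cast hK
      rwa [abs_nonpos_iff, sub_eq_zero] at this
    simp
  | succ K ih =>
    obtain ⟨x, hx0, hxJ, hyx, hxK⟩ : ∃ x : ℤ, 0 ≤ x ∧ x ≤ 2 ^ (L + (J - 2)) ∧ |y - x| ≤ 1 ∧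
        |x - y'| ≤ K := by
      push_cast at hK
      rw [abs_le] at hK
      rcases lt_trichotomy y y' with h | h | h
      · refine ⟨y + 1, by omega, by omega, ?_, ?_⟩ <;> rw [abs_le] <;> omega
      · refine ⟨y, hy0, hyJ, ?_, ?_⟩ <;> rw [abs_le] <;> omega
      · refine ⟨y - 1, by omega, by omega, ?_, ?_⟩ <;> rw [abs_le] <;> omega
    have h1 := noiseCount_le_of_abs_sub_le_one (z := z) hJ hyx hy0 hyJ
    have h1' : (2 : ℝ) ^ L * noiseCount L J y z ≤ (2 ^ L + 8) * noiseCount L J x z := by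
      exact_mod_cast h1
    have h2 : (noiseCount L J y z : ℝ) ≤ (8 / 2 ^ L + 1) * noiseCount L J x z := by
      have hp : (0 : ℝ) < 2 ^ L := by positivity
      rw [← sub_nonneg] at h1' ⊢
      have : (8 / 2 ^ L + 1) * (noiseCount L J x z : ℝ) - noiseCount L J y z =
        ((2 ^ L + 8) * noiseCount L J x z - 2 ^ L * noiseCount L J y z) / 2 ^ L := by
        field_simp
        ring
      rw [this]
      positivity
    have hx : (0 : ℝ) ≤ noiseCount L J x z := by exact_mod_cast noiseCount_nonneg L J x z
    calc (noiseCount L J y z : ℝ) ≤ (8 / 2 ^ L + 1) * noiseCount L J x z := h2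
      _ ≤ Real.exp (8 / 2 ^ L) * noiseCount L J x z := by
        gcongr
        exact Real.add_one_le_exp _
      _ ≤ Real.exp (8 / 2 ^ L) * (Real.exp (8 / 2 ^ L * K) * noiseCount L J y' z) := by
        gcongr
        exact ih hx0 hxJ hxK
      _ = Real.exp (8 / 2 ^ L * (K + 1 : ℕ)) * noiseCount L J y' z := by
        rw [← mul_assoc, ← Real.exp_add]
        push_cast
        ring_nf

/-! ## Independent noise for several values -/

/-- The number of coins used for one noisy value. -/
def blockLength (L J : ℕ) : ℕ := J + (L + J) + (L + J)

/-- The coins used for the `i`-th noisy value. -/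
def block (L J : ℕ) (coin : ℕ → Bool) (i : ℕ) : ℕ → Bool := fun m => coin (i * blockLength L J + m)

theorem block_position_lt {L J M T : ℕ} (hT : M * blockLength L J ≤ T) (p : Fin M × Fin (blockLength L J)) :
    p.1 * blockLength L J + p.2 < T := by
  have h1 := p.1.2
  have h2 := p.2.2
  have : (p.1 + 1) * blockLength L J ≤ M * blockLength L J := Nat.mul_le_mul_right _ h1
  linarith

/-- The positions of the blocks among all coins. -/
def blockPosition {L J M T : ℕ} (hT : M * blockLength L J ≤ T) (p : Fin M × Fin (blockLength L J)) :
    Fin T :=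
  ⟨p.1 * blockLength L J + p.2, block_position_lt hT p⟩

theorem blockPosition_injective {L J M T : ℕ} (hT : M * blockLength L J ≤ T) :
    Function.Injective (blockPosition hT) := by
  intro p q h
  have h' : (p.1 : ℕ) * blockLength L J + p.2 = q.1 * blockLength L J + q.2 :=
    congrArg Fin.val h
  apply (finProdFinEquiv (m := M) (n := blockLength L J)).injective
  ext
  simp only [finProdFinEquiv_apply_val]
  linarith

theorem coins_block {L J M T : ℕ} (hT : M * blockLength L J ≤ T) (ω : Fin T → Bool) (i : Fin M)
    {m : ℕ} (hm : m < blockLength L J) :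
    block L J (coins ω) i m = coins (fun m => (ω ∘ blockPosition hT) (i, m)) m := by
  have h := block_position_lt hT (i, ⟨m, hm⟩)
  simp only [block, coins, hm, dif_pos]
  rw [dif_pos h]
  rfl

/-- The blocks are disjoint, so the noisy values are independent and the count is a product; the
powers of 2 account for coins outside the blocks. -/
theorem card_noisy_family {L J M T : ℕ} (hT : M * blockLength L J ≤ T) (y z : Fin M → ℤ) :
    (Nat.card {ω : Fin T → Bool // ∀ i : Fin M, noisy L J (block L J (coins ω) i) (y i) = z i} : ℤ) *
        2 ^ (M * blockLength L J) = (∏ i, noiseCount L J (y i) (z i)) * 2 ^ T := by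
  have h1 := card_comp_embedding (blockPosition hT) (blockPosition_injective hT)
    fun σ => ∀ i, noisy L J (coins fun m => σ (i, m)) (y i) = z i
  have h2 : Nat.card {σ : Fin M × Fin (blockLength L J) → Bool //
      ∀ i, noisy L J (coins fun m => σ (i, m)) (y i) = z i} =
      ∏ i, Nat.card {b : Fin (blockLength L J) → Bool // noisy L J (coins b) (y i) = z i} := by
    rw [← card_pi_subtype]
    exact Nat.card_congr ((Equiv.curry _ _ _).subtypeEquiv fun σ => Iff.rfl)
  have h3 : ∀ ω : Fin T → Bool, (∀ i : Fin M, noisy L J (block L J (coins ω) i) (y i) = z i) ↔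
      ∀ i, noisy L J (coins fun m => (ω ∘ blockPosition hT) (i, m)) (y i) = z i := fun ω =>
    forall_congr' fun i => by
      rw [noisy_congr fun m hm => coins_block hT ω i hm]
  rw [h2, Nat.card_prod, Nat.card_fin, Nat.card_fin, Nat.card_fin] at h1
  rw [Nat.card_congr (Equiv.subtypeEquivRight h3), Finset.prod_congr rfl fun i _ =>
    (card_noisy_eq L J (y i) (z i)).symm]
  exact_mod_cast h1

theorem card_noisy_family_le {L J M T K : ℕ} (hT : M * blockLength L J ≤ T) (hJ : 2 ≤ J)
    {ε : ℝ} (hL : 8 * (K * M) ≤ ε * 2 ^ L) {y y' : Fin M → ℤ}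
    (hy0 : ∀ i, 0 ≤ y i) (hyJ : ∀ i, y i ≤ 2 ^ (L + (J - 2)))
    (hy0' : ∀ i, 0 ≤ y' i) (hyJ' : ∀ i, y' i ≤ 2 ^ (L + (J - 2)))
    (hK : ∀ i, |y i - y' i| ≤ K) (z : Fin M → ℤ) :
    (Nat.card {ω : Fin T → Bool // ∀ i : Fin M, noisy L J (block L J (coins ω) i) (y i) = z i} : ℝ) ≤
      Real.exp ε *
        Nat.card {ω : Fin T → Bool // ∀ i : Fin M, noisy L J (block L J (coins ω) i) (y' i) = z i} := by
  have h1 : (Nat.card {ω : Fin T → Bool //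
      ∀ i : Fin M, noisy L J (block L J (coins ω) i) (y i) = z i} : ℝ) * 2 ^ (M * blockLength L J) =
      (∏ i, (noiseCount L J (y i) (z i) : ℝ)) * 2 ^ T := by
    exact_mod_cast card_noisy_family hT y z
  have h2 : (Nat.card {ω : Fin T → Bool //
      ∀ i : Fin M, noisy L J (block L J (coins ω) i) (y' i) = z i} : ℝ) * 2 ^ (M * blockLength L J) =
      (∏ i, (noiseCount L J (y' i) (z i) : ℝ)) * 2 ^ T := by
    exact_mod_cast card_noisy_family hT y' z
  have hnn : ∀ y z, (0 : ℝ) ≤ noiseCount L J y z := fun y z => by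
    exact_mod_cast noiseCount_nonneg L J y z
  have h3 : (∏ i, (noiseCount L J (y i) (z i) : ℝ)) ≤
      Real.exp ε * ∏ i, (noiseCount L J (y' i) (z i) : ℝ) := by
    calc (∏ i, (noiseCount L J (y i) (z i) : ℝ))
        ≤ ∏ i, (Real.exp (8 / 2 ^ L * K) * noiseCount L J (y' i) (z i)) :=
          Finset.prod_le_prod (fun i _ => hnn _ _) fun i _ =>
            noiseCount_le hJ (hy0 i) (hyJ i) (hy0' i) (hyJ' i) K (hK i)
      _ = Real.exp (M * (8 / 2 ^ L * K)) * ∏ i, (noiseCount L J (y' i) (z i) : ℝ) := by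
          rw [Finset.prod_mul_distrib, Finset.prod_const, Finset.card_univ, Fintype.card_fin,
            ← Real.exp_nat_mul]
      _ ≤ Real.exp ε * ∏ i, (noiseCount L J (y' i) (z i) : ℝ) := by
          have : (M : ℝ) * (8 / 2 ^ L * K) ≤ ε := by
            rw [show (M : ℝ) * (8 / 2 ^ L * K) = 8 * (K * M) / 2 ^ L by ring,
              div_le_iff₀ (by positivity)]
            exact hL
          exact mul_le_mul_of_nonneg_right (Real.exp_le_exp.2 this)
            (Finset.prod_nonneg fun i _ => hnn _ _)
  have hp : (0 : ℝ) < 2 ^ (M * blockLength L J) := by positivity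
  refine le_of_mul_le_mul_right ?_ hp
  rw [h1, mul_assoc, h2, ← mul_assoc]
  gcongr

/-- With high probability, no block starts with many ones. -/
theorem card_forall_exists_false {L J M T j₀ : ℕ} (hT : M * blockLength L J ≤ T) (hj : j₀ ≤ J) :
    (2 : ℝ) ^ T - M * 2 ^ T / 2 ^ j₀ ≤
      Nat.card {ω : Fin T → Bool // ∀ i < M, ∃ m < j₀, block L J (coins ω) i m = false} := by
  classical
  have hbad : ∀ i < M, (Nat.card {ω : Fin T → Bool //
      ∀ m < j₀, block L J (coins ω) i m = true} : ℝ) = 2 ^ T / 2 ^ j₀ := by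
    intro i hi
    have hlt : ∀ m : Fin j₀, i * blockLength L J + m < T := fun m =>
      block_position_lt hT (⟨i, hi⟩, ⟨m, by have := m.2; rw [blockLength]; omega⟩)
    have h := card_comp_embedding (fun m : Fin j₀ => (⟨i * blockLength L J + m, hlt m⟩ : Fin T))
      (fun a b h => by simpa [Fin.ext_iff] using h) fun σ => ∀ m, σ m = true
    have h1 : Nat.card {σ : Fin j₀ → Bool // ∀ m, σ m = true} = 1 := by
      rw [card_pi_subtype fun (_ : Fin j₀) b => b = true]
      simp
    have h2 : Nat.card {ω : Fin T → Bool // ∀ m < j₀, block L J (coins ω) i m = true} =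
        Nat.card {ω : Fin T → Bool // ∀ m, (ω ∘ fun m : Fin j₀ =>
          (⟨i * blockLength L J + m, hlt m⟩ : Fin T)) m = true} := by
      refine Nat.card_congr (Equiv.subtypeEquivRight fun ω => ⟨fun h m => ?_, fun h m hm => ?_⟩)
      · have := h m m.2
        rwa [block, coins, dif_pos (hlt m)] at this
      · rw [block, coins, dif_pos (hlt ⟨m, hm⟩)]
        exact h ⟨m, hm⟩
    rw [h1, Nat.card_fin, Nat.card_fin, one_mul] at h
    rw [h2, eq_div_iff (by positivity)]
    exact_mod_cast h
  have hcard : ∀ (P : (Fin T → Bool) → Prop) [DecidablePred P], Nat.card {ω // P ω} =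
      (Finset.univ.filter fun ω => P ω).card := fun P _ => by
    rw [Nat.card_eq_fintype_card, Fintype.card_subtype]
  have hunion : (Finset.univ : Finset (Fin T → Bool)) ⊆
      (Finset.univ.filter fun ω => ∀ i < M, ∃ m < j₀, block L J (coins ω) i m = false) ∪
      (Finset.range M).biUnion fun i =>
        Finset.univ.filter fun ω => ∀ m < j₀, block L J (coins ω) i m = true := by
    intro ω _
    simp only [Finset.mem_union, Finset.mem_filter, Finset.mem_univ, true_and, Finset.mem_biUnion,
      Finset.mem_range]
    by_contra! h
    obtain ⟨⟨i, hi, h1⟩, h2⟩ := h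
    obtain ⟨m, hm, h3⟩ := h2 i hi
    exact h1 m hm (by simpa using h3)
  have hle := (Finset.card_le_card hunion).trans (Finset.card_union_le _ _)
  have hle2 := Finset.card_biUnion_le (s := Finset.range M) (t := fun i =>
        Finset.univ.filter fun ω : Fin T → Bool => ∀ m < j₀, block L J (coins ω) i m = true)
  have hsum : ((∑ i ∈ Finset.range M, (Finset.univ.filter fun ω : Fin T → Bool =>
      ∀ m < j₀, block L J (coins ω) i m = true).card : ℕ) : ℝ) = M * 2 ^ T / 2 ^ j₀ := by
    push_cast
    rw [Finset.sum_congr rfl (g := fun _ => (2 : ℝ) ^ T / 2 ^ j₀) fun i hi => by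
      rw [← hcard, hbad i (Finset.mem_range.1 hi)], Finset.sum_const, Finset.card_range,
      nsmul_eq_mul, mul_div_assoc]
  rw [Finset.card_univ, Fintype.card_fun, Fintype.card_bool, Fintype.card_fin, ← hcard] at hle
  rw [← hsum]
  rw [sub_le_iff_le_add]
  exact_mod_cast hle.trans (Nat.add_le_add_left hle2 _)

/-! ## Approximating the threshold function by polynomials -/

open Polynomial in
theorem abs_eval_chebyshev_le_one (s : ℕ) {u : ℝ} (h1 : -1 ≤ u) (h2 : u ≤ 1) :
    |(Chebyshev.T ℝ s).eval u| ≤ 1 := by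
  rw [← Real.cos_arccos h1 h2, Chebyshev.T_real_cos]
  exact Real.abs_cos_le_one _

open Polynomial in
-- For u = cosh θ the value is cosh(sθ) ≥ exp(sθ)/2. Here θ ≥ √δ: otherwise u ≤ exp(θ²/2) < exp(δ/2)
-- ≤ 1 + δ.
theorem exp_le_eval_chebyshev (s : ℕ) {u δ : ℝ} (h0 : 0 ≤ δ) (h1 : δ ≤ 1) (hu : 1 + δ ≤ u) :
    Real.exp (s * √δ) / 2 ≤ (Chebyshev.T ℝ s).eval u := by
  have hu1 : 1 ≤ u := by linarith
  have hθ0 := Real.arcosh_nonneg hu1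
  have hθ : √δ ≤ Real.arcosh u := by
    by_contra! h
    have h2 : Real.arcosh u ^ 2 < δ := by
      calc Real.arcosh u ^ 2 < √δ ^ 2 := by gcongr
        _ = δ := Real.sq_sqrt h0
    have h3 : u ≤ Real.exp (Real.arcosh u ^ 2 / 2) := by
      conv_lhs => rw [← Real.cosh_arcosh hu1]
      exact Real.cosh_le_exp_half_sq _
    have h4 : Real.exp (Real.arcosh u ^ 2 / 2) < Real.exp (δ / 2) := by gcongr
    have h5 : 1 - δ / 2 ≤ Real.exp (-(δ / 2)) := by
      linarith [Real.add_one_le_exp (-(δ / 2))]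
    have h6 : Real.exp (δ / 2) * Real.exp (-(δ / 2)) = 1 := by
      rw [← Real.exp_add, add_neg_cancel, Real.exp_zero]
    have h7 := Real.exp_pos (δ / 2)
    nlinarith
  rw [← Real.cosh_arcosh hu1, Chebyshev.T_real_cosh, Real.cosh_eq]
  have h2 : Real.exp (s * √δ) ≤ Real.exp (((s : ℤ) : ℝ) * Real.arcosh u) := by
    rw [Int.cast_natCast]
    gcongr
  have := Real.exp_pos (-(((s : ℤ) : ℝ) * Real.arcosh u))
  linarith

open Polynomial in
/-- A polynomial that agrees with the indicator function of `{0, …, r - 1}` on `{0, …, l}`, and is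
small on `{l + 1, …, k}`: Lagrange interpolation, damped by Chebyshev polynomials. -/
theorem exists_indicator_polynomial {r l k : ℕ} (s : ℕ) (hr : 2 * r ≤ l) (hl : l ≤ k) (hk : 1 ≤ k) :
    ∃ P : ℝ[X], P.natDegree ≤ l + s ∧ (∀ j ≤ l, P.eval (j : ℝ) = if j < r then 1 else 0) ∧
      ∀ j, l < j → j ≤ k →
        |P.eval (j : ℝ)| ≤ r * (k ^ l * (2 * Real.exp (-(s * √(l / (2 * k)))))) := by
  have hk0 : (0 : ℝ) < k := by exact_mod_cast hk
  have hlk : (l : ℝ) ≤ k := by exact_mod_cast hl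
  set v : ℕ → ℝ := fun i => i
  have hv : Set.InjOn v (Finset.range (l + 1)) := fun a _ b _ h => Nat.cast_injective h
  -- This affine change of variable sends `l` to 1 and the points from `l` to `k` into [-1, 1],
  -- where Chebyshev polynomials are bounded by 1. Nodes `i < r` have `2 * i ≤ l`, so they land
  -- beyond `1 + l / (2 * k)`.
  let u : ℕ → ℝ := fun j => 1 + (l - j) / k
  let q : ℝ[X] := C (1 + l / k : ℝ) - C (1 / k : ℝ) * X
  have hq : ∀ j : ℕ, q.eval (j : ℝ) = u j := fun j => by
    simp only [q, u, eval_sub, eval_mul, eval_C, eval_X]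
    ring
  let T := Chebyshev.T ℝ (s : ℤ)
  have hTu : ∀ i < r, Real.exp (s * √(l / (2 * k))) / 2 ≤ T.eval (u i) := fun i hi => by
    refine exp_le_eval_chebyshev s (by positivity) ?_ ?_
    · rw [div_le_one (by positivity)]
      linarith
    · have h1 : (2 * i : ℝ) ≤ l := by exact_mod_cast (by omega : 2 * i ≤ l)
      have h2 : (l : ℝ) / (2 * k) ≤ (l - i) / k := by
        rw [div_le_div_iff₀ (by positivity) hk0]
        nlinarith
      exact add_le_add_right h2 1
  have hTpos : ∀ i < r, 0 < T.eval (u i) := fun i hi =>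
    (by positivity : (0 : ℝ) < Real.exp (s * √(l / (2 * k))) / 2).trans_le (hTu i hi)
  -- The damping factor is 1 at its own node `i`, so the interpolation conditions survive; beyond
  -- `l` it is exponentially small.
  let e : ℕ → ℝ[X] := fun i => Lagrange.basis (Finset.range (l + 1)) v i *
    (C (1 / T.eval (u i)) * T.comp q)
  have he : ∀ i j : ℕ, (e i).eval (j : ℝ) =
      (Lagrange.basis (Finset.range (l + 1)) v i).eval (v j) * (T.eval (u j) / T.eval (u i)) :=
    fun i j => by
      simp only [e, eval_mul, eval_C, eval_comp, hq, v]
      ring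
  refine ⟨∑ i ∈ Finset.range r, e i, ?_, fun j hj => ?_, fun j hj hjk => ?_⟩
  · refine natDegree_sum_le_of_forall_le _ _ fun i hi => ?_
    have hi' : i ∈ Finset.range (l + 1) := by
      have := Finset.mem_range.1 hi
      exact Finset.mem_range.2 (by omega)
    have h1 := Lagrange.natDegree_basis hv hi'
    have h2 : (T.comp q).natDegree ≤ s := by
      refine natDegree_comp_le.trans ?_
      have h3 : T.natDegree = s := by simp [T]
      have h4 : q.natDegree ≤ 1 := by
        refine (natDegree_sub_le _ _).trans (max_le (by simp) ?_)
        exact (natDegree_C_mul_le _ _).trans natDegree_X_le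
      rw [h3]
      calc s * q.natDegree ≤ s * 1 := Nat.mul_le_mul_left _ h4
        _ = s := mul_one s
    calc (e i).natDegree ≤ _ := natDegree_mul_le
      _ ≤ l + s := by
        rw [h1, Finset.card_range, Nat.add_sub_cancel]
        exact Nat.add_le_add_left ((natDegree_C_mul_le _ _).trans h2) _
  · rw [eval_finsetSum]
    have hj' : j ∈ Finset.range (l + 1) := Finset.mem_range.2 (by omega)
    split_ifs with h
    · rw [Finset.sum_eq_single_of_mem j (Finset.mem_range.2 h) fun i _ hij => by
        rw [he, Lagrange.eval_basis_of_ne hij hj', zero_mul], he, Lagrange.eval_basis_self hv hj',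
        div_self (hTpos j h).ne', one_mul]
    · refine Finset.sum_eq_zero fun i hi => ?_
      have hij : i ≠ j := by
        rintro rfl
        exact h (Finset.mem_range.1 hi)
      rw [he, Lagrange.eval_basis_of_ne hij hj', zero_mul]
  · rw [eval_finsetSum]
    refine (Finset.abs_sum_le_sum_abs _ _).trans ((Finset.sum_le_card_nsmul _ _ _ fun i hi => ?_).trans
      (by rw [Finset.card_range, nsmul_eq_mul]))
    have hir := Finset.mem_range.1 hi
    have hi' : i ∈ Finset.range (l + 1) := Finset.mem_range.2 (by omega)
    rw [he, abs_mul]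
    refine mul_le_mul ?_ ?_ (abs_nonneg _) (by positivity)
    · rw [Lagrange.basis, eval_prod, Finset.abs_prod]
      have hcard : ((Finset.range (l + 1)).erase i).card = l := by
        rw [Finset.card_erase_of_mem hi', Finset.card_range, Nat.add_sub_cancel]
      have hprod : (k : ℝ) ^ l = ∏ _m ∈ (Finset.range (l + 1)).erase i, (k : ℝ) := by
        rw [Finset.prod_const, hcard]
      rw [hprod]
      refine Finset.prod_le_prod (fun _ _ => abs_nonneg _) fun m hm => ?_
      · have hm1 := Finset.ne_of_mem_erase hm
        have hm2 := Finset.mem_range.1 (Finset.mem_of_mem_erase hm)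
        simp only [Lagrange.basisDivisor, eval_mul, eval_C, eval_sub, eval_X, v, abs_mul, abs_inv]
        -- Distinct nodes are at distance at least 1, so each of the `l` factors of the basis
        -- polynomial is at most `k`.
        have h1 : (1 : ℝ) ≤ |(i : ℝ) - m| := by
          have : (1 : ℤ) ≤ |(i : ℤ) - m| := Int.one_le_abs (by omega)
          exact_mod_cast this
        have h2 : |(j : ℝ) - m| ≤ k := by
          have h3 : (j : ℝ) ≤ k := by exact_mod_cast hjk
          have h4 : (m : ℝ) ≤ j := by exact_mod_cast (by omega : m ≤ j)
          rw [abs_of_nonneg (by linarith)]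
          linarith [Nat.cast_nonneg (α := ℝ) m]
        calc |(i : ℝ) - m|⁻¹ * |(j : ℝ) - m| ≤ 1 * k := by
              gcongr
              exact inv_le_one_of_one_le₀ h1
          _ = k := one_mul _
    · have h1 : |T.eval (u j)| ≤ 1 := by
        have hj1 : (l : ℝ) ≤ j := by exact_mod_cast hj.le
        have hj2 : (j : ℝ) ≤ k := by exact_mod_cast hjk
        have h2 : -1 ≤ ((l : ℝ) - j) / k := by
          rw [le_div_iff₀ hk0]
          linarith [Nat.cast_nonneg (α := ℝ) l]
        have h3 : ((l : ℝ) - j) / k ≤ 0 := div_nonpos_of_nonpos_of_nonneg (by linarith) hk0.le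
        exact abs_eval_chebyshev_le_one s (by simp only [u]; linarith) (by simp only [u]; linarith)
      rw [abs_div, abs_of_pos (hTpos i hir), div_le_iff₀ (hTpos i hir), Real.exp_neg]
      have h2 := hTu i hir
      have h3 := Real.exp_pos (s * √(l / (2 * k)))
      calc |T.eval (u j)| ≤ 1 := h1
        _ = 2 * (Real.exp (s * √(l / (2 * k))))⁻¹ * (Real.exp (s * √(l / (2 * k))) / 2) := by
          field_simp
        _ ≤ _ := by gcongr

/-! ### Threshold approximations with integer coefficients in the binomial basis -/

/-- The numbers `a m / N`, for `m ≤ t`, are the coefficients in the binomial basis of a polynomial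
that approximates the threshold function `[r ≤ j]` on `{0, …, k}` up to `α / 2`. -/
structure IsThresholdApprox (r k t N : ℕ) (a : ℕ → ℤ) (α : ℝ) : Prop where
  abs_le : ∀ m ≤ t, |a m| ≤ N * 2 ^ (t + 2)
  abs_sub_le : ∀ j ≤ k, |(∑ m ∈ Finset.range (t + 1), (a m : ℝ) * j.choose m) -
    N * (if r ≤ j then 1 else 0)| ≤ N * (α / 2)

/-- Newton's forward difference formula. The terms beyond `t` vanish through the binomial
coefficient in the first case and through the difference in the second. -/
theorem sum_range_choose_eq {R : Type*} [CommRing R] (g : ℕ → R) (t j : ℕ)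
    (h : j ≤ t ∨ ∀ m, t < m → (fwdDiff 1)^[m] g 0 = 0) :
    g j = ∑ m ∈ Finset.range (t + 1), (fwdDiff 1)^[m] g 0 * j.choose m := by
  have h1 := shift_eq_sum_fwdDiff_iter 1 g j 0
  rw [zero_add, smul_eq_mul, mul_one] at h1
  simp_rw [nsmul_eq_mul, mul_comm (Nat.cast (Nat.choose j _))] at h1
  rw [h1]
  rcases le_total j t with hjt | hjt
  · refine Finset.sum_subset (Finset.range_subset_range.2 (by omega)) fun m _ hm => ?_
    rw [Finset.mem_range] at hm
    rw [Nat.choose_eq_zero_of_lt (by omega), Nat.cast_zero, mul_zero]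
  · refine (Finset.sum_subset (Finset.range_subset_range.2 (by omega)) fun m hm1 hm => ?_).symm
    rw [Finset.mem_range] at hm hm1
    rcases h with h | h
    · omega
    · rw [h m (by omega), zero_mul]

theorem abs_fwdDiff_iter_le {R : Type*} [CommRing R] [LinearOrder R] [IsStrictOrderedRing R]
    (g : ℕ → R) (m : ℕ) {B : R} (h : ∀ j ≤ m, |g j| ≤ B) :
    |(fwdDiff 1)^[m] g 0| ≤ 2 ^ m * B := by
  rw [fwdDiff_iter_eq_sum_shift]
  refine (Finset.abs_sum_le_sum_abs _ _).trans ?_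
  calc ∑ i ∈ Finset.range (m + 1), |((-1 : ℤ) ^ (m - i) * (m.choose i : ℤ)) • g (0 + i • 1)|
      ≤ ∑ i ∈ Finset.range (m + 1), (m.choose i : R) * B := by
        refine Finset.sum_le_sum fun i hi => ?_
        have hi := Finset.mem_range.1 hi
        rw [zsmul_eq_mul, abs_mul, zero_add, smul_eq_mul, mul_one]
        push_cast
        rw [abs_mul, abs_pow, abs_neg, abs_one, one_pow, one_mul, Nat.abs_cast]
        gcongr
        exact h i (by omega)
    _ = 2 ^ m * B := by
        rw [← Finset.sum_mul, ← Nat.cast_sum, Nat.sum_range_choose]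
        push_cast
        rfl

/-- Newton interpolation at all of {0, …, k} has no error, and differences of a 0-1 function are
integers, so the denominator 1 suffices. -/
theorem exists_isThresholdApprox_exact (r k : ℕ) {α : ℝ} (hα : 0 ≤ α) :
    ∃ a, IsThresholdApprox r k k 1 a α := by
  let g : ℕ → ℤ := fun j => if r ≤ j then 1 else 0
  refine ⟨fun m => (fwdDiff 1)^[m] g 0, fun m hm => ?_, fun j hj => ?_⟩
  · have h1 := abs_fwdDiff_iter_le g m (B := 1) fun j _ => by
      simp only [g]
      split_ifs <;> simp
    have h2 : (2 : ℤ) ^ m ≤ 2 ^ (k + 2) := by gcongr <;> omega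
    push_cast
    linarith
  · have h1 := sum_range_choose_eq g k j (Or.inl hj)
    have h2 : (∑ m ∈ Finset.range (k + 1), (((fwdDiff 1)^[m] g 0 : ℤ) : ℝ) * j.choose m) =
        ((if r ≤ j then 1 else 0 : ℤ) : ℝ) := by
      change _ = ((g j : ℤ) : ℝ)
      rw [h1]
      push_cast
      rfl
    rw [h2]
    push_cast
    rw [one_mul, one_mul, sub_self, abs_zero]
    positivity

open Polynomial in
theorem exists_isThresholdApprox_of_polynomial {r k t : ℕ} (htk : t ≤ k) {α : ℝ} (hα : 0 < α)
    (hα1 : α ≤ 1) {P : ℝ[X]} (hP : P.natDegree ≤ t)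
    (h : ∀ j ≤ k, |P.eval (j : ℝ) - if j < r then 1 else 0| ≤ α / 4) :
    ∃ (N : ℕ) (a : ℕ → ℤ), 1 ≤ N ∧ (N : ℝ) ≤ 4 * ((t + 1) * (k + 1) ^ t) / α + 1 ∧
      IsThresholdApprox r k t N a α := by
  let g : ℕ → ℝ := fun j => 1 - P.eval (j : ℝ)
  have hiter : ∀ (m : ℕ) (Q : ℝ[X]) (j : ℕ),
      (fwdDiff 1)^[m] (fun j : ℕ => Q.eval (j : ℝ)) j = (fwdDiff 1)^[m] (fun x => Q.eval x) (j : ℝ) :=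
    fun m Q j => by
      rw [fwdDiff_iter_eq_sum_shift, fwdDiff_iter_eq_sum_shift]
      simp
  have hgQ : g = fun j : ℕ => (1 - P).eval (j : ℝ) := by
    funext j
    simp [g]
  have hdeg : (1 - P).natDegree ≤ t := (natDegree_sub_le _ _).trans (by simpa using hP)
  have hg0 : ∀ m, t < m → (fwdDiff 1)^[m] g 0 = 0 := fun m hm => by
    rw [hgQ, hiter, Polynomial.fwdDiff_iter_eq_zero_of_degree_lt (hdeg.trans_lt hm)]
    rfl
  have hgj : ∀ j ≤ k, |g j - if r ≤ j then 1 else 0| ≤ α / 4 := fun j hj => by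
    have := h j hj
    rw [abs_sub_comm] at this
    convert this using 2
    simp only [g]
    by_cases hjr : j < r
    · rw [if_pos hjr, if_neg (by omega)]; ring
    · rw [if_neg hjr, if_pos (by omega)]; ring
  -- Rounding each of the `t + 1` scaled coefficients costs at most `(k + 1) ^ t`. With `N ≥ D` the
  -- total is at most `N * (α / 4)`, the half of the error budget that the polynomial leaves.
  set D : ℝ := 4 * ((t + 1) * (k + 1) ^ t) / α with hD
  have hD0 : 0 < D := by positivity
  set N := ⌈D⌉₊ with hN
  have hN1 : 1 ≤ N := Nat.ceil_pos.2 hD0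
  have hND : D ≤ N := Nat.le_ceil D
  have hN1' : (1 : ℝ) ≤ N := by exact_mod_cast hN1
  let c : ℕ → ℝ := fun m => (fwdDiff 1)^[m] g 0
  have hround : ∀ m, |(⌊N * c m⌋ : ℝ) - N * c m| ≤ 1 := fun m => by
    rw [abs_le]
    constructor <;> linarith [Int.floor_le (N * c m), Int.lt_floor_add_one (N * c m)]
  refine ⟨N, fun m => ⌊N * c m⌋, hN1, (Nat.ceil_lt_add_one hD0.le).le, fun m hm => ?_,
    fun j hj => ?_⟩
  · have h1 : |c m| ≤ 2 ^ m * 2 := abs_fwdDiff_iter_le g m fun j hj => by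
      have h2 := hgj j (by omega)
      have h3 : |(if r ≤ j then 1 else 0 : ℝ)| ≤ 1 := by split_ifs <;> simp
      have h4 := abs_add_le (g j - if r ≤ j then 1 else 0) (if r ≤ j then 1 else 0)
      rw [sub_add_cancel] at h4
      linarith
    have h2 : |(⌊N * c m⌋ : ℝ)| ≤ 1 + N * (2 ^ m * 2) := by
      have h3 := abs_add_le ((⌊N * c m⌋ : ℝ) - N * c m) (N * c m)
      rw [sub_add_cancel, abs_mul, Nat.abs_cast] at h3
      have : (N : ℝ) * |c m| ≤ N * (2 ^ m * 2) := by gcongr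
      linarith [hround m]
    have h3 : (1 : ℝ) + N * (2 ^ m * 2) ≤ N * 2 ^ (t + 2) := by
      have h4 : (2 : ℝ) ^ m ≤ 2 ^ t := by gcongr; norm_num
      have h5 : (1 : ℝ) ≤ 2 ^ t := one_le_pow₀ (by norm_num)
      have h6 : (N : ℝ) * (2 ^ m * 2) ≤ N * (2 ^ t * 2) := by gcongr
      rw [pow_add]
      nlinarith
    exact_mod_cast h2.trans h3
  · have h1 := sum_range_choose_eq g t j (Or.inr hg0)
    have h2 : |(∑ m ∈ Finset.range (t + 1), (⌊N * c m⌋ : ℝ) * j.choose m) - N * g j| ≤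
        (t + 1) * (k + 1) ^ t := by
      rw [h1, Finset.mul_sum, ← Finset.sum_sub_distrib]
      refine (Finset.abs_sum_le_sum_abs _ _).trans
        ((Finset.sum_le_card_nsmul _ _ ((k + 1 : ℝ) ^ t) fun m hm => ?_).trans (by simp))
      have hm := Finset.mem_range.1 hm
      rw [← mul_assoc, ← sub_mul, abs_mul, Nat.abs_cast]
      calc |(⌊N * c m⌋ : ℝ) - N * c m| * (j.choose m : ℝ) ≤ 1 * (j.choose m : ℝ) := by
            gcongr
            exact hround m
        _ ≤ (j : ℝ) ^ m := by
            rw [one_mul]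
            exact_mod_cast Nat.choose_le_pow j m
        _ ≤ (k + 1 : ℝ) ^ m := by
            have : (j : ℝ) ≤ k := by exact_mod_cast hj
            gcongr
            linarith
        _ ≤ (k + 1 : ℝ) ^ t := by
            gcongr
            · linarith [Nat.cast_nonneg (α := ℝ) k]
            · omega
    have h3 : ((t : ℝ) + 1) * (k + 1) ^ t ≤ N * (α / 4) := by
      have : ((t : ℝ) + 1) * (k + 1) ^ t = D * (α / 4) := by
        rw [hD]
        field_simp
      rw [this]
      gcongr
    have h4 : |(N : ℝ) * g j - N * if r ≤ j then 1 else 0| ≤ N * (α / 4) := by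
      rw [← mul_sub, abs_mul, Nat.abs_cast]
      gcongr
      exact hgj j hj
    have h5 := abs_add_le ((∑ m ∈ Finset.range (t + 1), (⌊N * c m⌋ : ℝ) * j.choose m) - N * g j)
      ((N : ℝ) * g j - N * if r ≤ j then 1 else 0)
    rw [sub_add_sub_cancel] at h5
    refine h5.trans ?_
    linarith

/-- As √(2kl) · √(l/(2k)) = l, the choice of `s` makes the damping exponent at least l(2 log k + 4).
This beats the interpolation loss log r + l log k + log 2 and leaves room for log(4/α), since
log(1/α) ≤ l. -/
theorem exists_isThresholdApprox {r k l s : ℕ} (hr : 1 ≤ r) (hrk : r ≤ k) {α : ℝ} (hα : 0 < α)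
    (hα1 : α ≤ 1) (hl : 2 * r * Real.log (1 / α) ≤ l) (hrl : 2 * r ≤ l)
    (hs : √(2 * k * l) * (2 * Real.log k + 4) ≤ s) (hk : l + s ≤ k) :
    ∃ (N : ℕ) (a : ℕ → ℤ), 1 ≤ N ∧ (N : ℝ) ≤ 4 * (((l + s : ℕ) + 1) * (k + 1) ^ (l + s)) / α + 1 ∧
      IsThresholdApprox r k (l + s) N a α := by
  obtain ⟨P, hP, h1, h2⟩ := exists_indicator_polynomial (k := k) s hrl (by omega) (by omega)
  refine exists_isThresholdApprox_of_polynomial hk hα hα1 hP fun j hj => ?_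
  rcases Nat.lt_or_ge l j with hlj | hlj
  · have hk0 : (0 : ℝ) < k := by exact_mod_cast (by omega : 0 < k)
    have hl0 : (0 : ℝ) < l := by exact_mod_cast (by omega : 0 < l)
    have hr0 : (0 : ℝ) < r := by exact_mod_cast hr
    have hl1 : (2 : ℝ) ≤ l := by exact_mod_cast (by omega : 2 ≤ l)
    have hlogk : 0 ≤ Real.log k := Real.log_nonneg (by exact_mod_cast (by omega : 1 ≤ k))
    rw [if_neg (by omega), sub_zero]
    refine (h2 j hlj hj).trans ?_
    have h3 : (l : ℝ) * (2 * Real.log k + 4) ≤ s * √(l / (2 * k)) := by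
      have h4 : √(2 * k * l) * √(l / (2 * k)) = l := by
        rw [← Real.sqrt_mul (by positivity)]
        rw [show 2 * k * l * (l / (2 * k)) = (l : ℝ) ^ 2 by field_simp]
        exact Real.sqrt_sq hl0.le
      calc (l : ℝ) * (2 * Real.log k + 4)
          = √(2 * k * l) * (2 * Real.log k + 4) * √(l / (2 * k)) := by
            conv_lhs => rw [← h4]
            ring
        _ ≤ s * √(l / (2 * k)) := by gcongr
    have h4 : r * (k ^ l * (2 * Real.exp (-(s * √(l / (2 * k)))))) =
        Real.exp (Real.log r + l * Real.log k + Real.log 2 - s * √(l / (2 * k))) := by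
      rw [sub_eq_add_neg, Real.exp_add, Real.exp_add, Real.exp_add, Real.exp_log hr0,
        Real.exp_log (by norm_num), ← Real.log_pow, Real.exp_log (by positivity)]
      ring
    have h5 : α / 4 = Real.exp (-Real.log (1 / α) - Real.log 4) := by
      rw [one_div, Real.log_inv, neg_neg, Real.exp_sub, Real.exp_log hα,
        Real.exp_log (by norm_num)]
    rw [h4, h5, Real.exp_le_exp]
    have h6 : Real.log r ≤ Real.log k := Real.log_le_log hr0 (by exact_mod_cast hrk)
    have h7 : Real.log 4 = 2 * Real.log 2 := by
      rw [show (4 : ℝ) = 2 ^ 2 by norm_num, Real.log_pow]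
      norm_num
    have h8 := Real.log_two_lt_d9
    have h9 : Real.log (1 / α) ≤ l := by
      have h10 : 0 ≤ Real.log (1 / α) := Real.log_nonneg (by rw [le_div_iff₀ hα]; linarith)
      have h11 : (1 : ℝ) ≤ r := by exact_mod_cast hr
      nlinarith
    nlinarith
  · rw [h1 j hlj, sub_self, abs_zero]
    positivity

/-! ## The output law -/

theorem toOuterMeasure_outputLaw (p : Program) (inp : List ℤ) (T : ℕ) (S : Set (List ℤ)) :
    (p.outputLaw inp T).toOuterMeasure S =
      (Nat.card {ω : Fin T → Bool // (p.exec inp (coins ω) T).out ∈ S} : ENNReal) / 2 ^ T := by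
  classical
  rw [Program.outputLaw, PMF.toOuterMeasure_map_apply, PMF.toOuterMeasure_uniformOfFintype_apply,
    Nat.card_eq_fintype_card, Fintype.card_fun, Fintype.card_bool, Fintype.card_fin]
  push_cast
  rfl

theorem toOuterMeasure_le_of_forall_le {R : Type} {p q : PMF R} {c : ENNReal}
    (h : ∀ z, p.toOuterMeasure {z} ≤ c * q.toOuterMeasure {z}) (S : Set R) :
    p.toOuterMeasure S ≤ c * q.toOuterMeasure S := by
  rw [PMF.toOuterMeasure_apply, PMF.toOuterMeasure_apply, ← ENNReal.tsum_mul_left]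
  refine ENNReal.tsum_le_tsum fun z => ?_
  by_cases hz : z ∈ S
  · simpa [hz, PMF.toOuterMeasure_apply_singleton] using h z
  · simp [hz]

/-! ## Expressions for the noise -/

namespace Expr

def dblIter : ℕ → Expr → Expr
  | 0, e => e
  | κ + 1, e => dbl (dblIter κ e)

/-- The digits in the cells `u, u + 1, …`, as many as there are initial ones in the `J` cells
`f, f + 1, …`. -/
def leadDigits : ℕ → ℕ → ℕ → Expr
  | 0, _, _ => zero
  | J + 1, f, u => guard (cell f) (add (cell u) (dbl (leadDigits J (f + 1) (u + 1))))

/-- As `leadDigits`, with `L` additional digits. -/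
def digits (J f : ℕ) : ℕ → ℕ → Expr
  | 0, u => leadDigits J f u
  | L + 1, u => add (cell u) (dbl (digits J f L (u + 1)))

/-- The noisy value of `y`, for the coins in the cells `s, s + 1, …`. -/
def addNoise (L J s : ℕ) (y : Expr) : Expr :=
  -- The value is suppressed by subtracting a guarded copy of it, which avoids a negated condition.
  sub (add (sub y (guards ((List.range J).map (s + ·)) y)) (digits J s L (s + J)))
    (digits J s L (s + J + (L + J)))

section
variable {m : ℕ → ℤ}

theorem eval_dblIter (κ : ℕ) (e : Expr) : (dblIter κ e).eval m = 2 ^ κ * e.eval m := by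
  induction κ with
  | zero => simp [dblIter]
  | succ κ ih => rw [dblIter, eval, ih, pow_succ]; ring

theorem Ok.dblIter {b : ℕ} (κ : ℕ) {e : Expr} (he : e.Ok m b) : (dblIter κ e).Ok m b := by
  induction κ with
  | zero => exact he
  | succ κ ih => exact ih

theorem size_dblIter (κ : ℕ) (e : Expr) : (dblIter κ e).size = e.size + κ := by
  induction κ with
  | zero => rfl
  | succ κ ih => rw [dblIter, size, ih]; ring

theorem eval_leadDigits (hm : m 0 = 0) {J f u : ℕ} {φ ψ : ℕ → Bool}
    (hφ : ∀ i < J, m (f + i) = if φ i then 1 else 0)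
    (hψ : ∀ i < J, m (u + i) = if ψ i then 1 else 0) :
    (leadDigits J f u).eval m = binVal (lead J φ) ψ := by
  induction J generalizing f u φ ψ with
  | zero => simpa [leadDigits, zero, eval, lead, binVal_zero] using hm
  | succ J ih =>
    have h1 := hφ 0 (by omega)
    have h2 := hψ 0 (by omega)
    have h3 := ih (f := f + 1) (u := u + 1) (φ := fun i => φ (i + 1)) (ψ := fun i => ψ (i + 1))
      (fun i hi => by rw [← hφ (i + 1) (by omega), add_assoc, add_comm 1 i])
      (fun i hi => by rw [← hψ (i + 1) (by omega), add_assoc, add_comm 1 i])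
    rw [add_zero] at h1 h2
    rw [leadDigits, eval, eval, eval, eval, eval, h1, h2, h3, lead]
    by_cases h : φ 0 = true
    · simp [h, binVal_succ]
    · simp [h, binVal_zero]

theorem eval_digits (hm : m 0 = 0) {L J f u : ℕ} {φ ψ : ℕ → Bool}
    (hφ : ∀ i < J, m (f + i) = if φ i then 1 else 0)
    (hψ : ∀ i < L + J, m (u + i) = if ψ i then 1 else 0) :
    (digits J f L u).eval m = binVal (L + lead J φ) ψ := by
  induction L generalizing u ψ with
  | zero =>
    rw [zero_add] at hψ ⊢
    exact eval_leadDigits hm hφ hψ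
  | succ L ih =>
    have h2 := hψ 0 (by omega)
    have h3 := ih (u := u + 1) (ψ := fun i => ψ (i + 1))
      (fun i hi => by rw [← hψ (i + 1) (by omega), add_assoc, add_comm 1 i])
    rw [add_zero] at h2
    rw [digits, eval, eval, eval, h2, h3, add_right_comm, binVal_succ]

theorem Ok.leadDigits {b J f u : ℕ} (hf : 2 ≤ f) (hfb : f + J ≤ b) (hu : 2 ≤ u) (hub : u + J ≤ b)
    (h : ∀ i < J, m (f + i) ≤ 1) : (leadDigits J f u).Ok m b := by
  induction J generalizing f u with
  | zero => exact ⟨by omega, by omega⟩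
  | succ J ih =>
    refine ⟨⟨⟨by omega, by omega⟩, h 0 (by omega)⟩, ⟨by omega, by omega⟩,
      ih (by omega) (by omega) (by omega) (by omega) fun i hi => ?_⟩
    have := h (i + 1) (by omega)
    rwa [add_assoc, add_comm 1 i]

theorem Ok.digits {b L J f u : ℕ} (hf : 2 ≤ f) (hfb : f + J ≤ b) (hu : 2 ≤ u)
    (hub : u + (L + J) ≤ b) (h : ∀ i < J, m (f + i) ≤ 1) : (digits J f L u).Ok m b := by
  induction L generalizing u with
  | zero => exact Ok.leadDigits hf hfb hu (by omega) h
  | succ L ih => exact ⟨⟨by omega, by omega⟩, ih (by omega) (by omega)⟩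

theorem size_digits (L J f u : ℕ) : (digits J f L u).size = 1 + 6 * J + 3 * L := by
  have h1 : ∀ f u, (leadDigits J f u).size = 1 + 6 * J := by
    induction J with
    | zero => intro f u; rfl
    | succ J ih =>
      intro f u
      rw [leadDigits, size, size, size, size, size, ih]
      ring
  induction L generalizing u with
  | zero => simp [digits, h1]
  | succ L ih =>
    rw [digits, size, size, size, ih]
    ring

theorem eval_addNoise (hm : m 0 = 0) {L J s : ℕ} {ω : ℕ → Bool}
    (hω : ∀ i < J + (L + J) + (L + J), m (s + i) = if ω i then 1 else 0) (y : Expr) :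
    (addNoise L J s y).eval m = noisy L J ω (y.eval m) := by
  classical
  have h1 : ∀ i < J, m (s + i) = if ω i then 1 else 0 := fun i hi => hω i (by omega)
  have h2 := eval_digits hm (L := L) (u := s + J) (ψ := fun i => ω (J + i)) h1 fun i hi => by
    rw [add_assoc, hω (J + i) (by omega)]
  have h3 := eval_digits hm (L := L) (u := s + J + (L + J)) (ψ := fun i => ω (J + (L + J) + i)) h1
    fun i hi => by
      rw [← hω (J + (L + J) + i) (by omega)]
      congr 1
      ring
  have h4 : (∀ i ∈ (List.range J).map (s + ·), m i = 1) ↔ lead J ω = J := by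
    rw [lead_eq_iff]
    simp only [List.mem_map, List.mem_range, forall_exists_index, and_imp,
      forall_apply_eq_imp_iff₂]
    refine forall₂_congr fun i hi => ?_
    rw [h1 i hi]
    simp
  rw [addNoise, eval, eval, eval, h2, h3, eval_guards, noisy]
  by_cases h : lead J ω = J
  · rw [if_pos (h4.2 h), if_pos h, sub_self]
  · rw [if_neg fun h' => h (h4.1 h'), if_neg h, sub_zero]

theorem Ok.addNoise {b L J s : ℕ} (hs : 2 ≤ s) (hb : s + (J + (L + J) + (L + J)) ≤ b)
    (h : ∀ i < J, m (s + i) ≤ 1) {y : Expr} (hy : y.Ok m b) : (addNoise L J s y).Ok m b := by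
  refine ⟨⟨⟨hy, Ok.guards (fun i hi => ?_) hy⟩, Ok.digits hs (by omega) (by omega) (by omega) h⟩,
    Ok.digits hs (by omega) (by omega) (by omega) h⟩
  simp only [List.mem_map, List.mem_range] at hi
  obtain ⟨i, hi, rfl⟩ := hi
  exact ⟨by omega, by omega, h i hi⟩

theorem size_addNoise (L J s : ℕ) (y : Expr) :
    (addNoise L J s y).size = 2 * y.size + 15 * J + 6 * L + 5 := by
  simp only [addNoise, size, size_guards, size_digits, List.length_map, List.length_range]
  ring

end

end Expr

/-! ## The sanitizer -/

/-- The number of rows of `D` in which all attributes in `A` are `1`. -/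
def marginal {n d : ℕ} (D : Database n d) (A : Finset (Fin d)) : ℤ :=
  ∑ i, if ∀ j ∈ A, D i j = true then 1 else 0

theorem marginal_nonneg {n d : ℕ} (D : Database n d) (A : Finset (Fin d)) : 0 ≤ marginal D A :=
  Finset.sum_nonneg fun i _ => by split_ifs <;> norm_num

theorem marginal_le {n d : ℕ} (D : Database n d) (A : Finset (Fin d)) : marginal D A ≤ n := by
  refine (Finset.sum_le_card_nsmul _ _ 1 fun i _ => ?_).trans (by simp)
  split_ifs <;> norm_num

theorem abs_marginal_sub_le {n d : ℕ} {D D' : Database n d} (h : Adjacent D D')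
    (A : Finset (Fin d)) : |marginal D A - marginal D' A| ≤ 1 := by
  obtain ⟨i, hi⟩ := h
  rw [marginal, marginal, ← Finset.sum_sub_distrib,
    Finset.sum_eq_single_of_mem i (Finset.mem_univ i) fun j _ hj => by rw [hi j hj, sub_self]]
  split_ifs <;> simp

/-- The sets of at most `t` attributes. -/
def smallSets (d t : ℕ) : Finset (Finset (Fin d)) := Finset.univ.filter fun A => A.card ≤ t

/-- The number of sets of at most `t` attributes. -/
def numSets (d t : ℕ) : ℕ := (smallSets d t).card

/-- An enumeration of the sets of at most `t` attributes. -/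
noncomputable def smallSet (d t : ℕ) (τ : Fin (numSets d t)) : Finset (Fin d) :=
  ((smallSets d t).equivFin.symm τ).1

theorem card_smallSet_le {d t : ℕ} (τ : Fin (numSets d t)) : (smallSet d t τ).card ≤ t :=
  (Finset.mem_filter.1 ((smallSets d t).equivFin.symm τ).2).2

theorem sum_smallSet {d t : ℕ} {R : Type} [AddCommMonoid R] (φ : Finset (Fin d) → R) :
    ∑ τ, φ (smallSet d t τ) = ∑ A ∈ smallSets d t, φ A := by
  rw [← Finset.sum_coe_sort (smallSets d t) φ]
  exact (smallSets d t).equivFin.symm.sum_comp fun A => φ A.1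

theorem numSets_le (d t : ℕ) : numSets d t ≤ (t + 1) * (d + 1) ^ t := by
  have h : smallSets d t ⊆ (Finset.range (t + 1)).biUnion fun m =>
      (Finset.univ : Finset (Fin d)).powersetCard m := fun A hA => by
    simp only [Finset.mem_biUnion, Finset.mem_range, Finset.mem_powersetCard, Finset.subset_univ,
      true_and, exists_eq_right']
    exact Nat.lt_succ_of_le (Finset.mem_filter.1 hA).2
  refine (Finset.card_le_card h).trans (Finset.card_biUnion_le.trans ?_)
  refine (Finset.sum_le_card_nsmul _ _ ((d + 1) ^ t) fun m hm => ?_).trans (by simp)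
  rw [Finset.card_powersetCard, Finset.card_univ, Fintype.card_fin]
  calc d.choose m ≤ d ^ m := Nat.choose_le_pow _ _
    _ ≤ (d + 1) ^ m := Nat.pow_le_pow_left (by omega) _
    _ ≤ (d + 1) ^ t := Nat.pow_le_pow_right (by omega) (by have := Finset.mem_range.1 hm; omega)

/-- The expression for the number of rows in which all attributes in `A` are `1`. -/
noncomputable def marginalExpr (n : ℕ) {d : ℕ} (A : Finset (Fin d)) : Expr :=
  Expr.sum (List.ofFn fun i : Fin n =>
    Expr.guards (A.toList.map fun j : Fin d => 2 + ((i : ℕ) * d + (j : ℕ))) Expr.one)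

/-- The expression for the noisy number of rows in which the attributes in the set with index `τ`
are all `1`, scaled by `2 ^ κ`. -/
noncomputable def sanitizerExpr (n d t κ L J : ℕ) (τ : Fin (numSets d t)) : Expr :=
  Expr.addNoise L J (2 + n * d + τ * blockLength L J)
    (Expr.dblIter κ (marginalExpr n (smallSet d t τ)))

/-- The sanitizer releases noisy numbers of rows for all sets of at most `t` attributes. -/
noncomputable def sanitizer (n d t κ L J : ℕ) : Program :=
  exprProgram (n * d) (numSets d t * blockLength L J) (List.ofFn (sanitizerExpr n d t κ L J))

/-- The number released for the set with index `τ`. -/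
noncomputable def release {n d : ℕ} (t κ L J : ℕ) (D : Database n d) (coin : ℕ → Bool)
    (τ : Fin (numSets d t)) : ℤ :=
  noisy L J (block L J coin τ) (2 ^ κ * marginal D (smallSet d t τ))

theorem position_lt {n d : ℕ} (i : Fin n) (j : Fin d) : (i : ℕ) * d + j < n * d := by
  have h1 : ((i : ℕ) + 1) * d ≤ n * d := Nat.mul_le_mul_right _ i.2
  have := j.2
  linarith

theorem exprMem_encodeDatabase {n d : ℕ} (D : Database n d) (coin : ℕ → Bool) (i : Fin n)
    (j : Fin d) : exprMem (n * d) (encodeDatabase D) coin (2 + (i * d + j)) =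
      if D i j = true then 1 else 0 := by
  have h := position_lt i j
  have h1 : ¬ 2 + ((i : ℕ) * d + j) < 2 := by omega
  have h2 : (⟨i * d + j, h⟩ : Fin (n * d)) = finProdFinEquiv (i, j) := by
    ext
    simp only [finProdFinEquiv_apply_val]
    ring
  rw [exprMem, if_neg h1, if_pos (by omega), Nat.add_sub_cancel_left, encodeDatabase,
    List.getD_eq_getElem?_getD, List.getElem?_ofFn, dif_pos h, Option.getD_some, h2,
    Equiv.symm_apply_apply]

theorem exprMem_coin (N : ℕ) (inp : List ℤ) (coin : ℕ → Bool) (i : ℕ) :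
    exprMem N inp coin (2 + N + i) = if coin i then 1 else 0 := by
  have h1 : ¬ 2 + N + i < 2 := by omega
  have h2 : ¬ 2 + N + i < 2 + N := by omega
  rw [exprMem, if_neg h1, if_neg h2, Nat.add_sub_cancel_left]

theorem eval_marginalExpr {n d : ℕ} (D : Database n d) (coin : ℕ → Bool) (A : Finset (Fin d)) :
    (marginalExpr n A).eval (exprMem (n * d) (encodeDatabase D) coin) = marginal D A := by
  classical
  rw [marginalExpr, Expr.eval_sum (by simp [exprMem]), List.map_ofFn, List.sum_ofFn, marginal]
  refine Finset.sum_congr rfl fun i _ => ?_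
  rw [Function.comp_apply, Expr.eval_guards, Expr.eval]
  refine if_congr ?_ rfl rfl
  simp only [List.mem_map, Finset.mem_toList, forall_exists_index, and_imp,
    forall_apply_eq_imp_iff₂, exprMem_encodeDatabase, ite_eq_left_iff, zero_ne_one, imp_false,
    not_not]

theorem marginalExpr_ok {n d b : ℕ} (D : Database n d) (coin : ℕ → Bool) (A : Finset (Fin d))
    (hb : 2 + n * d ≤ b) :
    (marginalExpr n A).Ok (exprMem (n * d) (encodeDatabase D) coin) b := by
  refine Expr.Ok.sum (by omega) fun e he => ?_
  obtain ⟨i, rfl⟩ := (List.mem_ofFn' _ _).1 he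
  refine Expr.Ok.guards (fun c hc => ?_) trivial
  obtain ⟨j, -, rfl⟩ := List.mem_map.1 hc
  have := position_lt i j
  refine ⟨by omega, by omega, ?_⟩
  rw [exprMem_encodeDatabase]
  split_ifs <;> norm_num

theorem size_marginalExpr_le (n : ℕ) {d : ℕ} (A : Finset (Fin d)) :
    (marginalExpr n A).size ≤ 1 + n * (3 * A.card + 2) := by
  refine (Expr.size_sum_le (3 * A.card + 1) fun e he => ?_).trans (by rw [List.length_ofFn])
  obtain ⟨i, rfl⟩ := (List.mem_ofFn' _ _).1 he
  rw [Expr.size_guards, List.length_map, Finset.length_toList, Expr.size, add_comm]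

theorem eval_sanitizerExpr {n d : ℕ} (t κ L J : ℕ) (D : Database n d) (coin : ℕ → Bool)
    (τ : Fin (numSets d t)) :
    (sanitizerExpr n d t κ L J τ).eval (exprMem (n * d) (encodeDatabase D) coin) =
      release t κ L J D coin τ := by
  rw [sanitizerExpr, Expr.eval_addNoise (by simp [exprMem]) (ω := block L J coin τ),
    Expr.eval_dblIter, eval_marginalExpr, release]
  intro i _
  rw [add_assoc, exprMem_coin, block]

theorem sanitizerExpr_ok {n d : ℕ} (t κ L J : ℕ) (D : Database n d) (coin : ℕ → Bool)
    (τ : Fin (numSets d t)) :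
    (sanitizerExpr n d t κ L J τ).Ok (exprMem (n * d) (encodeDatabase D) coin)
      (2 + n * d + numSets d t * blockLength L J) := by
  have h1 : ((τ : ℕ) + 1) * blockLength L J ≤ numSets d t * blockLength L J :=
    Nat.mul_le_mul_right _ τ.2
  refine Expr.Ok.addNoise (by omega) ?_ (fun i _ => ?_)
    (Expr.Ok.dblIter κ (marginalExpr_ok D coin _ (by omega)))
  · rw [add_mul, one_mul] at h1
    have : blockLength L J = J + (L + J) + (L + J) := rfl
    omega
  · rw [add_assoc, exprMem_coin]
    split_ifs <;> norm_num

theorem out_sanitizer {n d : ℕ} (t κ L J : ℕ) (D : Database n d) (coin : ℕ → Bool) :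
    ((sanitizer n d t κ L J).exec (encodeDatabase D) coin (sanitizer n d t κ L J).length).out =
      List.ofFn (release t κ L J D coin) := by
  rw [sanitizer, out_exprProgram, List.map_ofFn]
  · congr 1
    funext τ
    exact eval_sanitizerExpr t κ L J D coin τ
  · intro e he
    obtain ⟨τ, rfl⟩ := (List.mem_ofFn' _ _).1 he
    exact sanitizerExpr_ok t κ L J D coin τ

theorem length_sanitizer_le (n d t κ L J : ℕ) :
    (sanitizer n d t κ L J).length ≤
      3 * (n * d) + numSets d t * (2 * n * (3 * t + 2) + 2 * κ + 18 * J + 8 * L + 8) := by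
  have h : ∀ e ∈ (List.ofFn (sanitizerExpr n d t κ L J)).map fun e => e.size + 1,
      e ≤ 2 * n * (3 * t + 2) + 2 * κ + 15 * J + 6 * L + 8 := fun e he => by
    simp only [List.mem_map, List.mem_ofFn'] at he
    obtain ⟨_, ⟨τ, rfl⟩, rfl⟩ := he
    have h1 := size_marginalExpr_le n (smallSet d t τ)
    have h2 : n * (3 * (smallSet d t τ).card + 2) ≤ n * (3 * t + 2) :=
      Nat.mul_le_mul_left _ (by have := card_smallSet_le τ; omega)
    rw [sanitizerExpr, Expr.size_addNoise, Expr.size_dblIter]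
    linarith
  have h2 := List.sum_le_card_nsmul _ _ h
  rw [List.length_map, List.length_ofFn, smul_eq_mul] at h2
  rw [sanitizer, length_exprProgram, blockLength]
  linarith

theorem numSets_mul_blockLength_le (n d t κ L J : ℕ) :
    numSets d t * blockLength L J ≤ (sanitizer n d t κ L J).length := by
  rw [sanitizer, length_exprProgram]
  omega

/-- Changing a row moves each scaled marginal by at most `2 ^ κ`, and there are `numSets d t` of
them, so the losses add up to `ε` by `hL`. The bound on `J` puts all scaled marginals in the range
where the noise analysis holds. -/
theorem isDP_sanitizer {n d t κ L J : ℕ} {ε : ℝ} (hJ : κ + n + 2 ≤ J)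
    (hL : 8 * (2 ^ κ * numSets d t) ≤ ε * 2 ^ L) :
    IsDP ε (summary (sanitizer n d t κ L J) n d (sanitizer n d t κ L J).length) := by
  intro D D' hD
  refine toOuterMeasure_le_of_forall_le fun z => ?_
  rw [summary, summary, toOuterMeasure_outputLaw, toOuterMeasure_outputLaw]
  simp_rw [out_sanitizer, Set.mem_singleton_iff]
  by_cases hz : ∃ v : Fin (numSets d t) → ℤ, z = List.ofFn v
  · obtain ⟨v, rfl⟩ := hz
    simp_rw [List.ofFn_inj, funext_iff]
    have hbound : ∀ (D : Database n d) (τ : Fin (numSets d t)),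
        0 ≤ 2 ^ κ * marginal D (smallSet d t τ) ∧
        2 ^ κ * marginal D (smallSet d t τ) ≤ 2 ^ (L + (J - 2)) := fun D τ => by
      have h1 := marginal_nonneg D (smallSet d t τ)
      have h2 := marginal_le D (smallSet d t τ)
      refine ⟨by positivity, ?_⟩
      have h3 : (n : ℤ) ≤ 2 ^ n := by exact_mod_cast Nat.lt_two_pow_self.le
      calc 2 ^ κ * marginal D (smallSet d t τ) ≤ 2 ^ κ * 2 ^ n := by
            gcongr
            exact h2.trans h3
        _ = 2 ^ (κ + n) := (pow_add _ _ _).symm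
        _ ≤ 2 ^ (L + (J - 2)) := pow_le_pow_right₀ (by norm_num) (by omega)
    have h := card_noisy_family_le (numSets_mul_blockLength_le n d t κ L J) (K := 2 ^ κ)
      (by omega) (by push_cast; exact hL) (fun τ => (hbound D τ).1) (fun τ => (hbound D τ).2)
      (fun τ => (hbound D' τ).1) (fun τ => (hbound D' τ).2) (fun τ => by
        rw [← mul_sub, abs_mul, abs_pow, abs_two]
        have := abs_marginal_sub_le hD (smallSet d t τ)
        push_cast
        nlinarith [pow_pos (two_pos (α := ℤ)) κ]) v
    rw [← mul_div_assoc]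
    refine ENNReal.div_le_div_right ?_ _
    have h' := ENNReal.ofReal_le_ofReal h
    rw [ENNReal.ofReal_mul (Real.exp_pos ε).le, ENNReal.ofReal_natCast, ENNReal.ofReal_natCast] at h'
    exact h'
  · have : IsEmpty {ω : Fin (sanitizer n d t κ L J).length → Bool //
        List.ofFn (release t κ L J D (coins ω)) = z} := ⟨fun ω => hz ⟨_, ω.2.symm⟩⟩
    rw [Nat.card_of_isEmpty]
    simp

/-! ## The evaluator -/

/-- The expression for the numerator of the answer. -/
noncomputable def numeratorExpr (d t : ℕ) (a : ℕ → ℤ) : Expr :=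
  Expr.sum (List.ofFn fun τ : Fin (numSets d t) =>
    Expr.mulInt (a (smallSet d t τ).card)
      (Expr.guards ((smallSet d t τ).toList.map fun j : Fin d => 2 + (j : ℕ)) (Expr.cell (2 + (d + τ)))))

/-- The expression for the denominator of the answer. -/
def denominatorExpr (n κ N : ℕ) : Expr := Expr.dblIter κ (Expr.mulNat (N * n) Expr.one)

/-- The evaluator combines the released numbers for the subsets of the query. -/
noncomputable def evaluator (n d t κ N : ℕ) (a : ℕ → ℤ) : Program :=
  exprProgram (d + numSets d t) 0 [numeratorExpr d t a, denominatorExpr n κ N]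

section
variable {d k : ℕ} (S : QueryIndex k d) (z : List ℤ) (coin : ℕ → Bool)

theorem exprMem_encodeQuery_left (M : ℕ) (j : Fin d) :
    exprMem (d + M) (encodeQuery S z) coin (2 + j) = if j ∈ S.1 then 1 else 0 := by
  have h1 : ¬ 2 + (j : ℕ) < 2 := by omega
  have h2 : 2 + (j : ℕ) < 2 + (d + M) := by have := j.2; omega
  rw [exprMem, if_neg h1, if_pos h2, Nat.add_sub_cancel_left, encodeQuery,
    List.getD_eq_getElem?_getD, List.getElem?_append_left (by simp), List.getElem?_ofFn,
    dif_pos j.2, Option.getD_some]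

theorem exprMem_encodeQuery_right {M : ℕ} (v : Fin M → ℤ) (τ : Fin M) :
    exprMem (d + M) (encodeQuery S (List.ofFn v)) coin (2 + (d + τ)) = v τ := by
  have h1 : ¬ 2 + (d + (τ : ℕ)) < 2 := by omega
  have h2 : 2 + (d + (τ : ℕ)) < 2 + (d + M) := by have := τ.2; omega
  rw [exprMem, if_neg h1, if_pos h2, Nat.add_sub_cancel_left, encodeQuery,
    List.getD_eq_getElem?_getD, List.getElem?_append_right (by simp), List.length_ofFn,
    Nat.add_sub_cancel_left, List.getElem?_ofFn, dif_pos τ.2, Option.getD_some]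

theorem out_evaluator (n : ℕ) {t : ℕ} (κ N : ℕ) (a : ℕ → ℤ) (v : Fin (numSets d t) → ℤ) :
    ((evaluator n d t κ N a).exec (encodeQuery S (List.ofFn v)) coin
      (evaluator n d t κ N a).length).out =
      [∑ τ, a (smallSet d t τ).card * (if smallSet d t τ ⊆ S.1 then v τ else 0),
        2 ^ κ * (N * n : ℕ)] := by
  classical
  have h0 : exprMem (d + numSets d t) (encodeQuery S (List.ofFn v)) coin 0 = 0 := by simp [exprMem]
  rw [evaluator, out_exprProgram]
  · have h1 : (numeratorExpr d t a).eval
        (exprMem (d + numSets d t) (encodeQuery S (List.ofFn v)) coin) =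
        ∑ τ, a (smallSet d t τ).card * (if smallSet d t τ ⊆ S.1 then v τ else 0) := by
      rw [numeratorExpr, Expr.eval_sum h0, List.map_ofFn, List.sum_ofFn]
      refine Finset.sum_congr rfl fun τ _ => ?_
      rw [Function.comp_apply, Expr.eval_mulInt h0, Expr.eval_guards, Expr.eval,
        exprMem_encodeQuery_right]
      congr 1
      refine if_congr ?_ rfl rfl
      simp only [List.mem_map, Finset.mem_toList, forall_exists_index, and_imp,
        forall_apply_eq_imp_iff₂, exprMem_encodeQuery_left, ite_eq_left_iff, zero_ne_one,
        imp_false, not_not]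
      rfl
    have h2 : (denominatorExpr n κ N).eval
        (exprMem (d + numSets d t) (encodeQuery S (List.ofFn v)) coin) = 2 ^ κ * (N * n : ℕ) := by
      rw [denominatorExpr, Expr.eval_dblIter, Expr.eval_mulNat h0, Expr.eval, mul_one]
    rw [List.map_cons, List.map_cons, List.map_nil, h1, h2]
  · intro e he
    simp only [List.mem_cons, List.not_mem_nil, or_false] at he
    rcases he with rfl | rfl
    · refine Expr.Ok.sum (by omega) fun e he => ?_
      obtain ⟨τ, rfl⟩ := (List.mem_ofFn' _ _).1 he
      refine Expr.Ok.mulInt (by omega) _ (Expr.Ok.guards (fun c hc => ?_) ?_)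
      · obtain ⟨j, -, rfl⟩ := List.mem_map.1 hc
        refine ⟨by omega, by have := j.2; omega, ?_⟩
        rw [exprMem_encodeQuery_left]
        split_ifs <;> norm_num
      · exact ⟨by omega, by have := τ.2; omega⟩
    · exact Expr.Ok.dblIter κ (Expr.Ok.mulNat (by omega) _ trivial)

end

theorem length_evaluator_le {n d t κ N q p : ℕ} {a : ℕ → ℤ} (ha : ∀ m ≤ t, (a m).natAbs < 2 ^ q)
    (hp : N * n < 2 ^ p) :
    (evaluator n d t κ N a).length ≤
      3 * (d + numSets d t) + numSets d t * (4 + q * (3 * t + 3)) + 4 + κ + 3 * p := by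
  have h1 : (numeratorExpr d t a).size ≤ 1 + numSets d t * ((3 + q * (3 * t + 3)) + 1) := by
    refine (Expr.size_sum_le (3 + q * (3 * t + 3)) fun e he => ?_).trans (by rw [List.length_ofFn])
    obtain ⟨τ, rfl⟩ := (List.mem_ofFn' _ _).1 he
    have hτ := card_smallSet_le τ
    refine (Expr.size_mulInt_le _ q (ha _ hτ) _).trans ?_
    rw [Expr.size_guards, List.length_map, Finset.length_toList, Expr.size]
    exact Nat.add_le_add_left (Nat.mul_le_mul_left _ (by omega)) _
  have h2 : (denominatorExpr n κ N).size ≤ 1 + p * (1 + 2) + κ := by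
    rw [denominatorExpr, Expr.size_dblIter]
    exact Nat.add_le_add_right (Expr.size_mulNat_le _ p hp Expr.one) _
  rw [evaluator, length_exprProgram]
  simp only [List.map_cons, List.map_nil, List.sum_cons, List.sum_nil]
  linarith

/-! ## Accuracy -/

/-- `A` has `A.card.choose m` subsets of size `m`. This is why the binomial basis is used. -/
theorem sum_subset_smallSets {d t : ℕ} (a : ℕ → ℤ) (A : Finset (Fin d)) :
    ∑ B ∈ smallSets d t, a B.card * (if B ⊆ A then 1 else 0) =
      ∑ m ∈ Finset.range (t + 1), a m * A.card.choose m := by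
  have h1 : ∑ B ∈ smallSets d t, a B.card * (if B ⊆ A then 1 else 0) =
      ∑ B ∈ A.powerset, if B.card < t + 1 then a B.card else 0 := by
    simp only [mul_ite, mul_one, mul_zero]
    rw [← Finset.sum_filter, ← Finset.sum_filter]
    refine Finset.sum_congr ?_ fun _ _ => rfl
    ext B
    simp only [smallSets, Finset.mem_filter, Finset.mem_univ, true_and, Finset.mem_powerset,
      Nat.lt_succ_iff]
    exact and_comm
  rw [h1, Finset.sum_powerset_apply_card fun m => if m < t + 1 then a m else 0]
  have h2 : ∀ m, A.card.choose m • (if m < t + 1 then a m else 0) =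
      if m < t + 1 then a m * A.card.choose m else 0 := fun m => by
    rw [nsmul_eq_mul, mul_comm, ite_mul, zero_mul]
  simp_rw [h2]
  rw [← Finset.sum_filter]
  have h3 : (Finset.range (A.card + 1)).filter (fun m => m < t + 1) ⊆ Finset.range (t + 1) :=
    fun m hm => Finset.mem_range.2 (Finset.mem_filter.1 hm).2
  refine Finset.sum_subset h3 fun m hm hm' => ?_
  have : A.card < m := by
    by_contra h
    exact hm' (Finset.mem_filter.2 ⟨Finset.mem_range.2 (by omega), Finset.mem_range.1 hm⟩)
  rw [Nat.choose_eq_zero_of_lt this, Nat.cast_zero, mul_zero]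

/-- The attributes in `S` that are `1` in the row `x`. -/
def activeSet {d : ℕ} (S : Finset (Fin d)) (x : Fin d → Bool) : Finset (Fin d) :=
  S.filter fun j => x j = true

/-- The sums over rows and over sets are exchanged: a set lies in the active set of a row exactly if
it lies in `S` and the row satisfies its conjunction. -/
theorem sum_marginal {n d t : ℕ} (a : ℕ → ℤ) (D : Database n d) (S : Finset (Fin d)) :
    ∑ τ, a (smallSet d t τ).card *
        (if smallSet d t τ ⊆ S then marginal D (smallSet d t τ) else 0) =
      ∑ i, ∑ m ∈ Finset.range (t + 1), a m * (activeSet S (D i)).card.choose m := by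
  rw [sum_smallSet fun A => a A.card * (if A ⊆ S then marginal D A else 0)]
  simp_rw [← sum_subset_smallSets]
  rw [Finset.sum_comm]
  refine Finset.sum_congr rfl fun A _ => ?_
  rw [← Finset.mul_sum]
  congr 1
  have h : ∀ i, (A ⊆ activeSet S (D i)) ↔ A ⊆ S ∧ ∀ j ∈ A, D i j = true := fun i => by
    simp only [activeSet, Finset.subset_iff, Finset.mem_filter]
    exact forall₂_and
  split_ifs with hA
  · rw [marginal]
    refine Finset.sum_congr rfl fun i _ => if_congr ?_ rfl rfl
    rw [h, and_iff_right hA]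
  · refine (Finset.sum_eq_zero fun i _ => if_neg fun h' => hA ((h i).1 h').1).symm

/-- Half of `α` pays for the polynomial approximation in each row. The other half pays for the
noise, `Q` per marginal amplified by a coefficient of size at most `N * 2 ^ (t + 2)`. -/
theorem abs_estimate_sub_answer_le {n d k r t N κ Q : ℕ} {a : ℕ → ℤ} {α : ℝ} (hn : 1 ≤ n)
    (hN : 1 ≤ N) (ha : IsThresholdApprox r k t N a α)
    (herr : (numSets d t : ℝ) * 2 ^ (t + 2) * Q ≤ n * 2 ^ κ * (α / 2)) (D : Database n d)
    (S : QueryIndex k d) (v : Fin (numSets d t) → ℤ)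
    (hv : ∀ τ, |v τ - 2 ^ κ * marginal D (smallSet d t τ)| ≤ Q) :
    |((∑ τ, a (smallSet d t τ).card * (if smallSet d t τ ⊆ S.1 then v τ else 0) : ℤ) : ℝ) /
      ((2 ^ κ * (N * n : ℕ) : ℤ) : ℝ) - answer (rOfK r S) D| ≤ α := by
  classical
  have hn0 : (0 : ℝ) < n := by exact_mod_cast hn
  have hN0 : (0 : ℝ) < N := by exact_mod_cast hN
  set est : ℤ := ∑ τ, a (smallSet d t τ).card * (if smallSet d t τ ⊆ S.1 then v τ else 0) with hest
  set ex : ℤ := ∑ i, ∑ m ∈ Finset.range (t + 1), a m * (activeSet S.1 (D i)).card.choose m with hex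
  set cnt : ℝ := ∑ i, if rOfK r S (D i) then (1 : ℝ) else 0 with hcnt
  have h1 : |est - 2 ^ κ * ex| ≤ numSets d t * (N * 2 ^ (t + 2) * Q) := by
    rw [hest, hex, ← sum_marginal, Finset.mul_sum, ← Finset.sum_sub_distrib]
    refine (Finset.abs_sum_le_sum_abs _ _).trans ((Finset.sum_le_card_nsmul _ _
      (N * 2 ^ (t + 2) * Q : ℤ) fun τ _ => ?_).trans (by simp))
    have hτ := ha.abs_le _ (card_smallSet_le τ)
    rw [mul_left_comm, ← mul_sub, abs_mul]
    refine mul_le_mul hτ ?_ (abs_nonneg _) (by positivity)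
    split_ifs
    · exact hv τ
    · simp
  have h2 : |(ex : ℝ) - N * cnt| ≤ n * (N * (α / 2)) := by
    rw [hex, hcnt, Finset.mul_sum]
    push_cast
    rw [← Finset.sum_sub_distrib]
    refine (Finset.abs_sum_le_sum_abs _ _).trans ((Finset.sum_le_card_nsmul _ _
      (N * (α / 2) : ℝ) fun i _ => ?_).trans (by simp))
    have h := ha.abs_sub_le (activeSet S.1 (D i)).card
      ((Finset.card_le_card (Finset.filter_subset _ _)).trans S.2)
    have hq : (if rOfK r S (D i) then (1 : ℝ) else 0) =
        if r ≤ (activeSet S.1 (D i)).card then 1 else 0 := if_congr Iff.rfl rfl rfl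
    rw [hq]
    exact h
  have h1' : |(est : ℝ) - 2 ^ κ * ex| ≤ numSets d t * (N * 2 ^ (t + 2) * Q) := by
    exact_mod_cast h1
  have h3 : |(est : ℝ) - 2 ^ κ * N * cnt| ≤ 2 ^ κ * N * n * α := by
    have h4 := abs_add_le ((est : ℝ) - 2 ^ κ * ex) (2 ^ κ * (ex - N * cnt))
    rw [abs_mul, abs_of_pos (by positivity : (0 : ℝ) < 2 ^ κ)] at h4
    have h5 : (est : ℝ) - 2 ^ κ * N * cnt = est - 2 ^ κ * ex + 2 ^ κ * (ex - N * cnt) := by ring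
    rw [h5]
    have h6 : (2 : ℝ) ^ κ * |ex - N * cnt| ≤ 2 ^ κ * (n * (N * (α / 2))) := by gcongr
    have h7 : (N : ℝ) * (numSets d t * 2 ^ (t + 2) * Q) ≤ N * (n * 2 ^ κ * (α / 2)) := by gcongr
    linarith
  have h4 : answer (rOfK r S) D = cnt / n := by
    rw [answer, hcnt]
  have h5 : (est : ℝ) / ((2 ^ κ * (N * n : ℕ) : ℤ) : ℝ) - answer (rOfK r S) D =
      (est - 2 ^ κ * N * cnt) / (2 ^ κ * N * n) := by
    rw [h4]
    push_cast
    field_simp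
  rw [h5, abs_div, abs_of_pos (by positivity : (0 : ℝ) < 2 ^ κ * N * n), div_le_iff₀ (by positivity)]
  linarith

/-- If every block has a zero among its first `j₀` coins, each release is off by at most `2 ^ (L +
j₀)`. This one event, of probability at least `1 - β` by `hβ`, serves all queries at once. -/
theorem isAccurate_sanitizer {n d k r t N κ L J j₀ : ℕ} {a : ℕ → ℤ} {α β : ℝ} (hn : 1 ≤ n)
    (hN : 1 ≤ N) (ha : IsThresholdApprox r k t N a α) (hj₀ : j₀ ≤ J)
    (hβ : numSets d t ≤ β * 2 ^ j₀)
    (herr : (numSets d t : ℝ) * 2 ^ (t + 2) * 2 ^ (L + j₀) ≤ n * 2 ^ κ * (α / 2)) :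
    IsAccurate α β (summary (sanitizer n d t κ L J) n d (sanitizer n d t κ L J).length)
      (evaluate (evaluator n d t κ N a) (k := k) (evaluator n d t κ N a).length) (rOfK r) := by
  intro D
  rw [summary, toOuterMeasure_outputLaw]
  have h1 := card_forall_exists_false (numSets_mul_blockLength_le n d t κ L J) hj₀
  have h2 : Nat.card {ω : Fin (sanitizer n d t κ L J).length → Bool //
      ∀ i < numSets d t, ∃ m < j₀, block L J (coins ω) i m = false} ≤
      Nat.card {ω : Fin (sanitizer n d t κ L J).length → Bool // ((sanitizer n d t κ L J).exec (encodeDatabase D) (coins ω)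
        (sanitizer n d t κ L J).length).out
        ∈ {z | ∀ S : QueryIndex k d, |evaluate (evaluator n d t κ N a)
          (evaluator n d t κ N a).length z S - answer (rOfK r S) D| ≤ α}} := by
    refine Nat.card_le_card_of_injective (fun ω => ⟨ω.1, ?_⟩) fun ω ω' h =>
      Subtype.ext (congrArg (fun x => x.1) h)
    intro S
    rw [out_sanitizer, evaluate, out_evaluator, decodeAnswer]
    refine abs_estimate_sub_answer_le (Q := 2 ^ (L + j₀)) hn hN ha (by push_cast; exact herr) D S _
      fun τ => ?_
    obtain ⟨m, hm, hf⟩ := ω.2 τ τ.2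
    have h3 := abs_noisy_sub_le (L := L) (hm.trans_le hj₀) hf (2 ^ κ * marginal D (smallSet d t τ))
    refine h3.trans ?_
    push_cast
    gcongr
    norm_num
  have h3 : (1 - β) * 2 ^ (sanitizer n d t κ L J).length ≤ (Nat.card {ω : Fin (sanitizer n d t κ L J).length → Bool //
      ((sanitizer n d t κ L J).exec (encodeDatabase D) (coins ω)
        (sanitizer n d t κ L J).length).out
        ∈ {z | ∀ S : QueryIndex k d, |evaluate (evaluator n d t κ N a)
          (evaluator n d t κ N a).length z S - answer (rOfK r S) D| ≤ α}} : ℝ) := by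
    refine le_trans ?_ (h1.trans (by exact_mod_cast h2))
    have h4 : (numSets d t : ℝ) * 2 ^ (sanitizer n d t κ L J).length / 2 ^ j₀ ≤ β * 2 ^ (sanitizer n d t κ L J).length := by
      rw [div_le_iff₀ (by positivity)]
      calc (numSets d t : ℝ) * 2 ^ (sanitizer n d t κ L J).length ≤ β * 2 ^ j₀ * 2 ^ (sanitizer n d t κ L J).length := by gcongr
        _ = β * 2 ^ (sanitizer n d t κ L J).length * 2 ^ j₀ := by ring
    linarith
  rw [ENNReal.le_div_iff_mul_le (by simp) (by simp)]
  have h4 := ENNReal.ofReal_le_ofReal h3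
  rw [ENNReal.ofReal_mul' (by positivity), ENNReal.ofReal_natCast, ENNReal.ofReal_pow (by norm_num),
    ENNReal.ofReal_ofNat] at h4
  exact h4

/-! ## The bounds -/

theorem exists_two_pow (y : ℝ) : ∃ j : ℕ, y ≤ 2 ^ j ∧ (2 : ℝ) ^ j ≤ max 1 (2 * y) := by
  rcases le_total y 1 with h | h
  · exact ⟨0, by simpa using h, by simp⟩
  · obtain ⟨j, h1, h2⟩ := exists_nat_pow_near h (one_lt_two (α := ℝ))
    exact ⟨j + 1, h2.le, le_max_of_le_right (by rw [pow_succ]; linarith)⟩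

section
variable {r k d : ℕ} {α : ℝ}

theorem log_inv_gt (hα : 0 < α) (hα2 : α < 1 / 2) : 69 / 100 < Real.log (1 / α) := by
  have h1 : Real.log 2 ≤ Real.log (1 / α) :=
    Real.log_le_log (by norm_num) (by rw [le_div_iff₀ hα]; linarith)
  linarith [Real.log_two_gt_d9]

theorem baseExp_sq (hα : 0 < α) (hα2 : α < 1 / 2) :
    baseExp r k α ^ 2 = r * k * Real.log (1 / α) := by
  have := log_inv_gt hα hα2
  exact Real.sq_sqrt (by positivity)

theorem baseExp_ge (hr : 1 ≤ r) (hrk : r ≤ k) (hα : 0 < α) (hα2 : α < 1 / 2) :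
    4 / 5 ≤ baseExp r k α := by
  have h1 := log_inv_gt hα hα2
  have h2 : (1 : ℝ) ≤ r * k := by exact_mod_cast Nat.mul_pos hr (hr.trans hrk)
  exact Real.le_sqrt_of_sq_le (by nlinarith)

theorem one_le_log_baseExp (hr : 1 ≤ r) (hrk : r ≤ k) (hα : 0 < α) (hα2 : α < 1 / 2) :
    1 ≤ Real.log (baseExp r k α + 2) := by
  have h1 := baseExp_ge hr hrk hα hα2
  rw [Real.le_log_iff_exp_le (by linarith)]
  linarith [Real.exp_one_lt_d9]

theorem exists_isThresholdApprox_of_degree_le (hr : 1 ≤ r) (hrk : r ≤ k) (hd : 2 ≤ d)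
    (hα : 0 < α) (hα2 : α < 1 / 2) :
    ∃ (t N : ℕ) (a : ℕ → ℤ), 1 ≤ N ∧ IsThresholdApprox r k t N a α ∧
      (t : ℝ) ≤ 40 * (baseExp r k α * Real.log (baseExp r k α + 2)) ∧
      (N = 1 ∨ (1 / α ≤ (d : ℝ) ^ (baseExp r k α + 1) ∧
        (N : ℝ) ≤ 4 * ((t + 1) * (k + 1) ^ t) / α + 1)) := by
  have hlam := log_inv_gt hα hα2
  have hsq := baseExp_sq (r := r) (k := k) hα hα2
  have hx := baseExp_ge hr hrk hα hα2
  have hlog := one_le_log_baseExp hr hrk hα hα2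
  set x := baseExp r k α
  set lam := Real.log (1 / α)
  have hxY : x ≤ x * Real.log (x + 2) := le_mul_of_one_le_right (by linarith) hlog
  have hr1 : (1 : ℝ) ≤ r := by exact_mod_cast hr
  have hk1 : (1 : ℝ) ≤ k := by exact_mod_cast hr.trans hrk
  by_cases hcase : 1 / α ≤ (d : ℝ) ^ (x + 1)
  swap
  -- For such a small `α`, log(1/α) exceeds x/2, so kx/2 ≤ rk log(1/α) = x². Hence k ≤ 2x and exact
  -- interpolation is affordable.
  · obtain ⟨a, ha⟩ := exists_isThresholdApprox_exact r k hα.le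
    refine ⟨k, 1, a, le_rfl, ha, ?_, Or.inl rfl⟩
    have h1 : (x + 1) * Real.log d < lam := by
      rw [← Real.log_rpow (by positivity)]
      exact Real.log_lt_log (by positivity) (not_le.1 hcase)
    have h2 : Real.log 2 ≤ Real.log d := Real.log_le_log (by norm_num) (by exact_mod_cast hd)
    have h3 := Real.log_two_gt_d9
    have h4 : x * (1 / 2) ≤ lam := by nlinarith
    have h5 : k * (x * (1 / 2)) ≤ x ^ 2 := by
      rw [hsq]
      calc (k : ℝ) * (x * (1 / 2)) ≤ k * lam := by gcongr
        _ ≤ r * (k * lam) := le_mul_of_one_le_left (by positivity) hr1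
        _ = r * k * lam := by ring
    have h6 : (k : ℝ) * (1 / 2) ≤ x := by
      refine le_of_mul_le_mul_right ?_ (by linarith : 0 < x)
      nlinarith
    linarith
  set Λ := ⌈lam⌉₊
  have hΛ1 : lam ≤ Λ := Nat.le_ceil lam
  have hΛ2 : (Λ : ℝ) ≤ lam + 1 := (Nat.ceil_lt_add_one (by linarith)).le
  have hΛ0 : 1 ≤ Λ := Nat.ceil_pos.2 (by linarith)
  set l := 2 * r * Λ with hl
  have hkl : (k : ℝ) * l ≤ 5 * x ^ 2 := by
    rw [hsq, hl]
    push_cast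
    have : (Λ : ℝ) ≤ 5 / 2 * lam := by linarith
    calc (k : ℝ) * (2 * r * Λ) ≤ k * (2 * r * (5 / 2 * lam)) := by gcongr
      _ = 5 * (r * k * lam) := by ring
  have hsqrt1 : √((k : ℝ) * l) ≤ 23 / 10 * x := Real.sqrt_le_iff.2 ⟨by linarith, by nlinarith⟩
  have hsqrt2 : √(2 * k * l) ≤ 32 / 10 * x := Real.sqrt_le_iff.2 ⟨by linarith, by nlinarith⟩
  -- Since `k` is at most a constant times x², the factor log k in the degree is logarithmic in x.
  have hlogk : Real.log k ≤ 3 * Real.log (x + 2) := by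
    have h1 : (k : ℝ) ≤ (x + 2) ^ 3 := by
      have h2 : (k : ℝ) * (69 / 100) ≤ x ^ 2 := by
        rw [hsq]
        calc (k : ℝ) * (69 / 100) ≤ k * lam := by gcongr
          _ ≤ r * (k * lam) := le_mul_of_one_le_left (by positivity) hr1
          _ = r * k * lam := by ring
      nlinarith [sq_nonneg x, mul_pos (by linarith : 0 < x) (by linarith : 0 < x)]
    calc Real.log k ≤ Real.log ((x + 2) ^ 3) := Real.log_le_log (by linarith) h1
      _ = 3 * Real.log (x + 2) := by
        rw [Real.log_pow]
        norm_num
  have hlogk0 : 0 ≤ Real.log k := Real.log_nonneg hk1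
  set s := ⌈√(2 * k * l) * (2 * Real.log k + 4)⌉₊
  have hs1 : √(2 * k * l) * (2 * Real.log k + 4) ≤ s := Nat.le_ceil _
  have hs2 : (s : ℝ) ≤ √(2 * k * l) * (2 * Real.log k + 4) + 1 :=
    (Nat.ceil_lt_add_one (by positivity)).le
  have hs3 : (s : ℝ) ≤ 32 * (x * Real.log (x + 2)) + 1 := by
    have : √(2 * k * l) * (2 * Real.log k + 4) ≤ 32 / 10 * x * (10 * Real.log (x + 2)) := by
      gcongr
      linarith
    linarith
  -- For `l ≤ k` the bound follows from l² ≤ kl ≤ 5x².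
  have hl1 : l ≤ k → (l : ℝ) ≤ 23 / 10 * x := fun h => by
    refine le_trans (Real.le_sqrt_of_sq_le ?_) hsqrt1
    have : (l : ℝ) ≤ k := by exact_mod_cast h
    nlinarith [Nat.cast_nonneg (α := ℝ) l]
  by_cases hls : l + s ≤ k
  · obtain ⟨N, a, hN1, hN, ha⟩ := exists_isThresholdApprox (l := l) (s := s) hr hrk hα (by linarith)
      (by rw [hl]; push_cast; gcongr) (Nat.le_mul_of_pos_right _ hΛ0) hs1 hls
    refine ⟨l + s, N, a, hN1, ha, ?_, Or.inr ⟨hcase, hN⟩⟩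
    have := hl1 (by omega)
    push_cast
    linarith
  -- Now `k < l + s`, so degree `k` satisfies the required bound. If `k ≤ l`, it follows directly
  -- from k² ≤ kl.
  · obtain ⟨a, ha⟩ := exists_isThresholdApprox_exact r k hα.le
    refine ⟨k, 1, a, le_rfl, ha, ?_, Or.inl rfl⟩
    rcases le_total k l with h | h
    · have h1 : (k : ℝ) ≤ 23 / 10 * x := by
        refine le_trans (Real.le_sqrt_of_sq_le ?_) hsqrt1
        have : (k : ℝ) ≤ l := by exact_mod_cast h
        nlinarith
      linarith
    · have h1 := hl1 h
      have h2 : (k : ℝ) ≤ l + s := by exact_mod_cast (by omega : k ≤ l + s)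
      linarith

end

theorem one_le_numSets (d t : ℕ) : 1 ≤ numSets d t :=
  Finset.card_pos.2 ⟨∅, Finset.mem_filter.2 ⟨Finset.mem_univ _, by simp⟩⟩

/-! ### Choice of the noise parameters and program lengths -/

/-- The scaling `2 ^ κ`, the width `2 ^ L` and the number `j₀` of levels of the noise. -/
theorem exists_noise_parameters {M n t w g : ℕ} {α β ε : ℝ} (hn : 1 ≤ n) (hM : 1 ≤ M)
    (hα : 0 < α) (hβ : 0 < β) (hε : 0 < ε) (hw : 1 / α ≤ 2 ^ w) (hg : 1 + 2 / β ≤ 2 ^ g)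
    (hεn : 1 / ε ≤ n) (hsize : (M : ℝ) ^ 3 * 2 ^ (t + 8) * 2 ^ g ≤ n * α * ε) :
    ∃ j₀ κ L : ℕ, j₀ ≤ g + M ∧ κ ≤ M + (t + 4) + j₀ + w + 1 ∧ L ≤ κ + M + n + 4 ∧
      (M : ℝ) ≤ β * 2 ^ j₀ ∧ 8 * (2 ^ κ * M) ≤ ε * 2 ^ L ∧
      (M : ℝ) * 2 ^ (t + 2) * 2 ^ (L + j₀) ≤ n * 2 ^ κ * (α / 2) := by
  have hM1 : (1 : ℝ) ≤ M := by exact_mod_cast hM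
  have hn1 : (1 : ℝ) ≤ n := by exact_mod_cast hn
  have htwo : ∀ m : ℕ, (m : ℝ) ≤ 2 ^ m := fun m => by exact_mod_cast Nat.lt_two_pow_self.le
  have hlog : ∀ {p q : ℕ}, (2 : ℝ) ^ p ≤ 2 ^ q → p ≤ q := fun h =>
    (pow_le_pow_iff_right₀ (by norm_num)).1 h
  obtain ⟨j₀, hj1, hj2⟩ := exists_two_pow (M / β)
  have hj3 : (2 : ℝ) ^ j₀ ≤ 2 ^ g * M := by
    refine hj2.trans (max_le ?_ ?_)
    · exact one_le_mul_of_one_le_of_one_le (one_le_pow₀ (by norm_num)) hM1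
    · calc 2 * (M / β) = 2 / β * M := by ring
        _ ≤ 2 ^ g * M := by gcongr; linarith
  have hj4 : j₀ ≤ g + M := hlog <| by
    rw [pow_add]
    exact hj3.trans (by gcongr; exact htwo M)
  -- The noise is integral, so its width cannot go below 1 however large `ε` is. Scaling the
  -- marginals by `2 ^ κ` makes the error from this unit width at most `α / 4`.
  obtain ⟨κ, hκ1, hκ2⟩ := exists_two_pow (M * 2 ^ (t + 4) * 2 ^ j₀ * (1 / α))
  have hκ3 : κ ≤ M + (t + 4) + j₀ + w + 1 := hlog <| by
    refine hκ2.trans (max_le (one_le_pow₀ (by norm_num)) ?_)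
    calc 2 * (M * 2 ^ (t + 4) * 2 ^ j₀ * (1 / α))
        ≤ 2 * (2 ^ M * 2 ^ (t + 4) * 2 ^ j₀ * 2 ^ w) := by
          gcongr
          exact htwo M
      _ = 2 ^ (M + (t + 4) + j₀ + w + 1) := by ring
  obtain ⟨L, hL1, hL2⟩ := exists_two_pow (8 * (2 ^ κ * M) / ε)
  have hL3 : (2 : ℝ) ^ L ≤ 1 + 16 * (2 ^ κ * M) / ε := by
    have h0 : 0 ≤ 16 * (2 ^ κ * M) / ε := by positivity
    refine hL2.trans (max_le (by linarith) ?_)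
    rw [show 2 * (8 * (2 ^ κ * (M : ℝ)) / ε) = 16 * (2 ^ κ * M) / ε by ring]
    linarith
  have hL4 : L ≤ κ + M + n + 4 := hlog <| by
    refine hL2.trans (max_le (one_le_pow₀ (by norm_num)) ?_)
    calc 2 * (8 * (2 ^ κ * (M : ℝ)) / ε) = 2 ^ κ * M * (1 / ε) * 2 ^ 4 := by ring
      _ ≤ 2 ^ κ * 2 ^ M * 2 ^ n * 2 ^ 4 := by
        gcongr
        · exact htwo M
        · exact hεn.trans (htwo n)
      _ = 2 ^ (κ + M + n + 4) := by ring
  refine ⟨j₀, κ, L, hj4, hκ3, hL4, ?_, ?_, ?_⟩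
  · rwa [div_le_iff₀ hβ, mul_comm _ β] at hj1
  · rwa [div_le_iff₀ hε, mul_comm _ ε] at hL1
  have h2 : (M : ℝ) * 2 ^ (t + 2) * 2 ^ j₀ ≤ n * 2 ^ κ * (α / 4) := by
    rw [mul_one_div, div_le_iff₀ hα] at hκ1
    have h3 : 2 ^ κ * α ≤ n * (2 ^ κ * α) := le_mul_of_one_le_left (by positivity) hn1
    calc (M : ℝ) * 2 ^ (t + 2) * 2 ^ j₀ = M * 2 ^ (t + 4) * 2 ^ j₀ / 4 := by ring
      _ ≤ n * 2 ^ κ * (α / 4) := by linarith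
  have h4 : (M : ℝ) ^ 2 * 2 ^ (t + 8) * 2 ^ j₀ ≤ n * α * ε := by
    refine le_trans ?_ hsize
    calc (M : ℝ) ^ 2 * 2 ^ (t + 8) * 2 ^ j₀ ≤ (M : ℝ) ^ 2 * 2 ^ (t + 8) * (2 ^ g * M) := by gcongr
      _ = (M : ℝ) ^ 3 * 2 ^ (t + 8) * 2 ^ g := by ring
  have h3 : (M : ℝ) * 2 ^ (t + 2) * 2 ^ j₀ * (16 * (2 ^ κ * M) / ε) ≤ n * 2 ^ κ * (α / 4) := by
    rw [← mul_div_assoc, div_le_iff₀ hε]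
    calc (M : ℝ) * 2 ^ (t + 2) * 2 ^ j₀ * (16 * (2 ^ κ * M))
        = 2 ^ κ / 4 * ((M : ℝ) ^ 2 * 2 ^ (t + 8) * 2 ^ j₀) := by
          rw [pow_add _ t 8, pow_add _ t 2]
          ring
      _ ≤ 2 ^ κ / 4 * (n * α * ε) := by gcongr
      _ = n * 2 ^ κ * (α / 4) * ε := by ring
  calc (M : ℝ) * 2 ^ (t + 2) * 2 ^ (L + j₀) = M * 2 ^ (t + 2) * 2 ^ j₀ * 2 ^ L := by
        rw [pow_add _ L]
        ring
    _ ≤ M * 2 ^ (t + 2) * 2 ^ j₀ * (1 + 16 * (2 ^ κ * M) / ε) := by gcongr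
    _ ≤ n * 2 ^ κ * (α / 2) := by linarith

theorem length_sanitizer_le_of_le {n d t κ L J : ℕ} {E : ℝ} (hn : 1 ≤ n) (hE : 1 ≤ E)
    (hd : d ≤ E) (ht : t ≤ E) (hM : numSets d t ≤ E) (hκ : κ ≤ 10 * E) (hL : L ≤ 16 * (n * E))
    (hJ : J ≤ 15 * (n * E)) : ((sanitizer n d t κ L J).length : ℝ) ≤ 440 * (n * E ^ 2) := by
  have h : ((sanitizer n d t κ L J).length : ℝ) ≤
      3 * (n * d) + numSets d t * (2 * n * (3 * t + 2) + 2 * κ + 18 * J + 8 * L + 8) := by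
    exact_mod_cast length_sanitizer_le n d t κ L J
  have hn1 : (1 : ℝ) ≤ n := by exact_mod_cast hn
  have hnE : E ≤ n * E := le_mul_of_one_le_left (by linarith) hn1
  have hnt : (n : ℝ) * t ≤ n * E := by gcongr
  have hnn : (n : ℝ) ≤ n * E := le_mul_of_one_le_right (by linarith) hE
  have h1 : 2 * (n : ℝ) * (3 * t + 2) + 2 * κ + 18 * J + 8 * L + 8 ≤ 436 * (n * E) := by linarith
  have h2 : (n : ℝ) * d ≤ n * E := by gcongr
  have h3 : n * E ≤ n * E ^ 2 := by
    gcongr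
    exact le_self_pow₀ hE two_ne_zero
  calc ((sanitizer n d t κ L J).length : ℝ) ≤ 3 * (n * d) +
        numSets d t * (2 * n * (3 * t + 2) + 2 * κ + 18 * J + 8 * L + 8) := h
    _ ≤ 3 * (n * E) + E * (436 * (n * E)) := by gcongr
    _ = 3 * (n * E) + 436 * (n * E ^ 2) := by ring
    _ ≤ 440 * (n * E ^ 2) := by linarith [mul_nonneg (Nat.cast_nonneg (α := ℝ) n) (sq_nonneg E)]

theorem length_evaluator_le_of_le {n d t κ N : ℕ} {a : ℕ → ℤ} {E : ℝ} (hn : 1 ≤ n) (hE : 1 ≤ E)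
    (ha : ∀ m ≤ t, |a m| ≤ N * 2 ^ (t + 2)) (hd : d ≤ E) (ht : t ≤ E) (hM : numSets d t ≤ E)
    (hN : N ≤ E) (hκ : κ ≤ 10 * E) :
    ((evaluator n d t κ N a).length : ℝ) ≤ 60 * (n * E ^ 3) := by
  -- The crude bit length `N + (t + 2)`, with `N` in place of its logarithm, is enough as only a
  -- polynomial bound in `E` is needed.
  have hq : ∀ m ≤ t, (a m).natAbs < 2 ^ (N + (t + 2)) := fun m hm => by
    have h1 := ha m hm
    have h2 : (a m).natAbs ≤ N * 2 ^ (t + 2) := by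
      rw [Int.abs_eq_natAbs] at h1
      exact_mod_cast h1
    rw [pow_add]
    exact h2.trans_lt (Nat.mul_lt_mul_of_pos_right Nat.lt_two_pow_self (by positivity))
  have h : ((evaluator n d t κ N a).length : ℝ) ≤ 3 * (d + numSets d t) +
      numSets d t * (4 + (N + (t + 2)) * (3 * t + 3)) + 4 + κ + 3 * (N * n) := by
    exact_mod_cast length_evaluator_le (n := n) (d := d) (κ := κ) hq
      (Nat.lt_two_pow_self (n := N * n))
  have hn1 : (1 : ℝ) ≤ n := by exact_mod_cast hn
  have h1 : ((N : ℝ) + (t + 2)) ≤ 4 * E := by linarith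
  have h2 : (3 * (t : ℝ) + 3) ≤ 6 * E := by linarith
  have h3 : (N : ℝ) * n ≤ n * E := by rw [mul_comm]; gcongr
  have h4 : E ^ 2 ≤ E ^ 3 := pow_le_pow_right₀ hE (by norm_num)
  have h5 : E ≤ E ^ 3 := le_self_pow₀ hE (by norm_num)
  have h6 : E ^ 3 ≤ n * E ^ 3 := le_mul_of_one_le_left (by positivity) hn1
  have h7 : n * E ≤ n * E ^ 3 := by gcongr
  calc ((evaluator n d t κ N a).length : ℝ) ≤ 3 * (d + numSets d t) +
        numSets d t * (4 + (N + (t + 2)) * (3 * t + 3)) + 4 + κ + 3 * (N * n) := h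
    _ ≤ 3 * (E + E) + E * (4 + 4 * E * (6 * E)) + 4 + 10 * E + 3 * (n * E) := by gcongr
    _ = 20 * E + 24 * E ^ 3 + 4 + 3 * (n * E) := by ring
    _ ≤ 60 * (n * E ^ 3) := by linarith

/-- The sanitizer and the evaluator, with explicit bounds on their lengths in terms of `E`. -/
theorem exists_programs {n d k r t N w g : ℕ} {a : ℕ → ℤ} {α β ε E : ℝ} (hn : 1 ≤ n) (hN : 1 ≤ N)
    (hα : 0 < α) (hβ : 0 < β) (hε : 0 < ε) (ha : IsThresholdApprox r k t N a α)
    (hw : 1 / α ≤ 2 ^ w) (hg : 1 + 2 / β ≤ 2 ^ g) (hεn : 1 / ε ≤ n)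
    (hsize : (numSets d t : ℝ) ^ 3 * 2 ^ (t + 8) * 2 ^ g ≤ n * α * ε)
    (hE : 1 ≤ E) (hEd : d ≤ E) (hEt : t ≤ E) (hEM : numSets d t ≤ E) (hEN : N ≤ E) (hEw : w ≤ E)
    (hEg : g ≤ E) :
    ∃ (san ev : Program) (T₁ T₂ : ℕ), RunsInTime san ev n d k T₁ T₂ (1000 * n * E ^ 3) ∧
      IsDP ε (summary san n d T₁) ∧
      IsAccurate α β (summary san n d T₁) (evaluate ev (k := k) T₂) (rOfK r) := by
  obtain ⟨j₀, κ, L, hj, hκ, hL, hM, hLε, herr⟩ :=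
    exists_noise_parameters hn (one_le_numSets d t) hα hβ hε hw hg hεn hsize
  -- In the number of levels, `κ + n + 2` is what privacy needs and `j₀` what accuracy needs.
  refine ⟨sanitizer n d t κ L (κ + n + 2 + j₀), evaluator n d t κ N a,
    (sanitizer n d t κ L (κ + n + 2 + j₀)).length, (evaluator n d t κ N a).length,
    ⟨fun D coin => haltsWithin_length (isStraight_exprProgram _ _ _),
      fun D z _ S => haltsWithin_length (isStraight_exprProgram _ _ _), ?_⟩,
    isDP_sanitizer (by omega) hLε, isAccurate_sanitizer hn hN ha (by omega) hM herr⟩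
  have hn1 : (1 : ℝ) ≤ n := by exact_mod_cast hn
  have hj' : (j₀ : ℝ) ≤ g + numSets d t := by exact_mod_cast hj
  have hκ' : (κ : ℝ) ≤ numSets d t + (t + 4) + j₀ + w + 1 := by exact_mod_cast hκ
  have hL' : (L : ℝ) ≤ κ + numSets d t + n + 4 := by exact_mod_cast hL
  have hnE : E ≤ n * E := le_mul_of_one_le_left (by linarith) hn1
  have hnE' : (n : ℝ) ≤ n * E := le_mul_of_one_le_right (by linarith) hE
  have hκE : (κ : ℝ) ≤ 10 * E := by linarith
  have h1 := length_sanitizer_le_of_le (L := L) (J := κ + n + 2 + j₀) hn hE hEd hEt hEM hκE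
    (by linarith) (by push_cast; linarith)
  have h2 := length_evaluator_le_of_le hn hE ha.abs_le hEd hEt hEM hEN hκE
  have h3 : n * E ^ 2 ≤ n * E ^ 3 := by
    gcongr
    norm_num
  push_cast
  linarith

/-! ## Trivial cases -/

theorem summary_nil (n d : ℕ) (D D' : Database n d) : summary [] n d 0 D = summary [] n d 0 D' := rfl

theorem isDP_nil {n d : ℕ} {ε : ℝ} (hε : 0 ≤ ε) : IsDP ε (summary [] n d 0) := by
  intro D D' _ S
  rw [summary_nil n d D D']
  refine le_mul_of_one_le_left zero_le ?_
  rw [ENNReal.one_le_ofReal]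
  exact Real.one_le_exp hε

theorem isAccurate_nil {n d k : ℕ} {α β y : ℝ} (hβ : 0 ≤ β) {ev : Program} {T : ℕ}
    {q : QueryIndex k d → (Fin d → Bool) → Prop} (hev : ∀ S : QueryIndex k d, evaluate ev T [] S = y)
    (hy : ∀ (D : Database n d) S, |y - answer (q S) D| ≤ α) :
    IsAccurate α β (summary [] n d 0) (evaluate ev (k := k) T) q := by
  intro D
  have h1 : (summary [] n d 0 D).toOuterMeasure
      {z | ∀ S : QueryIndex k d, |evaluate ev T z S - answer (q S) D| ≤ α} = 1 := by
    rw [PMF.toOuterMeasure_apply_eq_one_iff]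
    intro z hz
    have : z = [] := by
      rw [summary, Program.outputLaw, PMF.mem_support_map_iff] at hz
      obtain ⟨ω, -, rfl⟩ := hz
      rfl
    subst this
    intro S
    rw [hev]
    exact hy D S
  rw [h1, ← ENNReal.ofReal_one]
  exact ENNReal.ofReal_le_ofReal (by linarith)

theorem runsInTime_nil {ev : Program} (hev : ∀ I ∈ ev, I.IsStraight) (n d k : ℕ) {B : ℝ}
    (hB : 2 * (ev.length : ℝ) ≤ B) : RunsInTime [] ev n d k 0 ev.length B := by
  refine ⟨fun D coin => Nat.zero_le _, fun D z _ S => haltsWithin_length hev, ?_⟩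
  rw [List.length_nil]
  push_cast
  linarith

/-- A program that gives the answer `1`. -/
def answerOne : Program := [.one 2, .write 2, .write 2]

/-- A program that gives the answer `1 / 2`. -/
def answerHalf : Program := [.one 2, .write 2, .add 2 2 2, .write 2]

theorem evaluate_answerOne {k d : ℕ} (S : QueryIndex k d) : evaluate answerOne 3 [] S = 1 := by
  have h : (answerOne.exec (encodeQuery S []) (fun _ => false) answerOne.length).out = [1, 1] := by
    rw [exec_eq_runList (by simp [answerOne, Instr.IsStraight])]
    simp [answerOne, Instr.run, Config.put, Config.start]
  change decodeAnswer (answerOne.exec (encodeQuery S []) (fun _ => false) answerOne.length).out = 1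
  rw [h]
  simp [decodeAnswer]

theorem evaluate_answerHalf {k d : ℕ} (S : QueryIndex k d) :
    evaluate answerHalf 4 [] S = 1 / 2 := by
  have h : (answerHalf.exec (encodeQuery S []) (fun _ => false) answerHalf.length).out =
      [1, 2] := by
    rw [exec_eq_runList (by simp [answerHalf, Instr.IsStraight])]
    simp [answerHalf, Instr.run, Config.put, Config.start]
  change decodeAnswer (answerHalf.exec (encodeQuery S []) (fun _ => false) answerHalf.length).out =
    1 / 2
  rw [h]
  simp [decodeAnswer]

theorem answer_nonneg {X : Type} {n : ℕ} (q : X → Prop) (D : Fin n → X) : 0 ≤ answer q D := by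
  refine div_nonneg (Finset.sum_nonneg fun i _ => ?_) (Nat.cast_nonneg n)
  split_ifs <;> norm_num

theorem answer_le_one {X : Type} {n : ℕ} (q : X → Prop) (D : Fin n → X) : answer q D ≤ 1 := by
  refine div_le_one_of_le₀ ((Finset.sum_le_card_nsmul _ _ 1 fun i _ => ?_).trans (by simp))
    (Nat.cast_nonneg n)
  split_ifs <;> norm_num

theorem answer_eq_one {X : Type} {n : ℕ} (hn : 1 ≤ n) {q : X → Prop} (hq : ∀ x, q x)
    (D : Fin n → X) : answer q D = 1 := by
  have : (n : ℝ) ≠ 0 := by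
    have : n ≠ 0 := by omega
    exact_mod_cast this
  simp [answer, hq, this]

/-! ## The theorem -/

theorem baseExp_nonneg (r k : ℕ) (α : ℝ) : 0 ≤ baseExp r k α := Real.sqrt_nonneg _

/-- With one logarithmic factor and an integer constant, the bound is a natural power of a base that
does not depend on `C`, so every later estimate compares exponents. -/
theorem growth_natCast (C r k d : ℕ) (α : ℝ) :
    growth C 1 r k d α =
      ((d : ℝ) ^ (baseExp r k α * Real.log (baseExp r k α + 2))) ^ C := by
  rw [growth, softO, pow_one, ← Real.rpow_natCast, ← Real.rpow_mul (Nat.cast_nonneg d)]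
  congr 1
  ring

theorem one_le_rpow_baseExp {d : ℕ} (hd : 2 ≤ d) (r k : ℕ) (α : ℝ) :
    1 ≤ (d : ℝ) ^ (baseExp r k α * Real.log (baseExp r k α + 2)) := by
  have h1 := baseExp_nonneg r k α
  have h2 : 0 ≤ Real.log (baseExp r k α + 2) := Real.log_nonneg (by linarith)
  exact Real.one_le_rpow (by exact_mod_cast (by omega : 1 ≤ d)) (by positivity)

/-! ### Comparison of all quantities with powers of H -/

theorem numSets_le_pow {d t : ℕ} {H : ℝ} (hd : 2 ≤ d) (hH : (d : ℝ) ^ t ≤ H ^ 40) :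
    2 ^ t ≤ H ^ 40 ∧ (t + 1 : ℝ) ≤ H ^ 40 ∧ ((d : ℝ) + 1) ^ t ≤ H ^ 80 ∧
      (numSets d t : ℝ) ≤ H ^ 120 := by
  have hd2 : (2 : ℝ) ≤ d := by exact_mod_cast hd
  have h1 : (2 : ℝ) ^ t ≤ H ^ 40 := (pow_le_pow_left₀ (by norm_num) hd2 t).trans hH
  have h2 : (t : ℝ) + 1 ≤ 2 ^ t := by exact_mod_cast Nat.lt_two_pow_self (n := t)
  have h3 : ((d : ℝ) + 1) ^ t ≤ H ^ 80 := by
    calc ((d : ℝ) + 1) ^ t ≤ (d ^ 2) ^ t := by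
          gcongr
          nlinarith
      _ = (d ^ t) ^ 2 := pow_right_comm _ _ _
      _ ≤ (H ^ 40) ^ 2 := by gcongr
      _ = H ^ 80 := by rw [← pow_mul]
  refine ⟨h1, h2.trans h1, h3, ?_⟩
  have h4 : (numSets d t : ℝ) ≤ (t + 1) * (d + 1) ^ t := by exact_mod_cast numSets_le d t
  calc (numSets d t : ℝ) ≤ (t + 1) * (d + 1) ^ t := h4
    _ ≤ H ^ 40 * H ^ 80 := mul_le_mul (h2.trans h1) h3 (by positivity) (by positivity)
    _ = H ^ 120 := by rw [← pow_add]

theorem eight_le_pow {H : ℝ} (hH2 : 2 ≤ H ^ 2) : 8 ≤ H ^ 6 := by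
  calc (8 : ℝ) = 2 ^ 3 := by norm_num
    _ ≤ (H ^ 2) ^ 3 := by gcongr
    _ = H ^ 6 := by rw [← pow_mul]

theorem denominator_le_pow {N d k t : ℕ} {H α : ℝ} (hkd : k ≤ d) (hH1 : 1 ≤ H) (hH2 : 2 ≤ H ^ 2)
    (ht : (t + 1 : ℝ) ≤ H ^ 40) (hdt : ((d : ℝ) + 1) ^ t ≤ H ^ 80) (hα : 0 < α)
    (hHα : 1 / α ≤ H ^ 3) (hN : (N : ℝ) ≤ 4 * ((t + 1) * (k + 1) ^ t) / α + 1) :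
    (N : ℝ) ≤ H ^ 130 := by
  have hkd' : (k : ℝ) ≤ d := by exact_mod_cast hkd
  have h1 : ((k : ℝ) + 1) ^ t ≤ H ^ 80 := le_trans (by gcongr) hdt
  have h2 : ((t : ℝ) + 1) * (k + 1) ^ t ≤ H ^ 40 * H ^ 80 :=
    mul_le_mul ht h1 (by positivity) (by positivity)
  have h3 : (1 : ℝ) ≤ H ^ 123 := one_le_pow₀ hH1
  calc (N : ℝ) ≤ 4 * ((t + 1) * (k + 1) ^ t) / α + 1 := hN
    _ = 4 * ((t + 1) * (k + 1) ^ t * (1 / α)) + 1 := by ring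
    _ ≤ 4 * (H ^ 40 * H ^ 80 * H ^ 3) + 1 := by
        have := mul_le_mul h2 hHα (by positivity) (by positivity)
        linarith
    _ = 4 * H ^ 123 + 1 := by rw [← pow_add, ← pow_add]
    _ ≤ 8 * H ^ 123 := by linarith
    _ ≤ H ^ 6 * H ^ 123 := mul_le_mul_of_nonneg_right (eight_le_pow hH2) (by positivity)
    _ = H ^ 129 := by rw [← pow_add]
    _ ≤ H ^ 130 := pow_le_pow_right₀ hH1 (by norm_num)

theorem size_le_pow {M t g : ℕ} {H : ℝ} (hH1 : 1 ≤ H) (hH2 : 2 ≤ H ^ 2) (ht : 2 ^ t ≤ H ^ 40)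
    (hM : (M : ℝ) ≤ H ^ 120) : (M : ℝ) ^ 3 * 2 ^ (t + 8) * 2 ^ g ≤ H ^ (416 + 2 * g) := by
  have h1 : (M : ℝ) ^ 3 ≤ H ^ 360 := by
    calc (M : ℝ) ^ 3 ≤ (H ^ 120) ^ 3 := by gcongr
      _ = H ^ 360 := by rw [← pow_mul]
  have h2 : (2 : ℝ) ^ (t + 8) ≤ H ^ 56 := by
    calc (2 : ℝ) ^ (t + 8) = 2 ^ t * 2 ^ 8 := pow_add _ _ _
      _ ≤ H ^ 40 * (H ^ 2) ^ 8 := by gcongr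
      _ = H ^ 56 := by rw [← pow_mul, ← pow_add]
  have h3 : (2 : ℝ) ^ g ≤ H ^ (2 * g) := by
    rw [pow_mul]
    gcongr
  calc (M : ℝ) ^ 3 * 2 ^ (t + 8) * 2 ^ g ≤ H ^ 360 * H ^ 56 * H ^ (2 * g) := by gcongr
    _ = H ^ (416 + 2 * g) := by rw [← pow_add, ← pow_add]

/-- Privacy and accuracy together need `n * α * ε` to be large. In the first case of `minSize` the
missing `1 / α` is at most `H ^ 3` and is taken out of `H ^ C`; in the second it is part of the
required size. -/
theorem le_mul_of_minSize_le {n d k r C : ℕ} {α ε H : ℝ} (hα : 0 < α) (hα1 : α ≤ 1) (hε : 0 < ε)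
    (hH1 : 1 ≤ H) (hHα : 1 / α ≤ (d : ℝ) ^ (baseExp r k α + 1) → 1 / α ≤ H ^ 3)
    (hC : growth C 1 r k d α = H ^ C) (h : minSize C 1 r k d α ε ≤ n) :
    H ^ C ≤ H ^ 3 * (n * α * ε) ∧ 1 / ε ≤ n := by
  have h1 : (1 : ℝ) ≤ H ^ C := one_le_pow₀ hH1
  have h2 : (1 : ℝ) ≤ H ^ 3 := one_le_pow₀ hH1
  rw [minSize, hC] at h
  split_ifs at h with hcase
  · have h3 := hHα hcase
    rw [div_le_iff₀ hα] at h3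
    rw [div_le_iff₀ hε] at h
    refine ⟨?_, ?_⟩
    · calc H ^ C ≤ n * ε * 1 := by linarith
        _ ≤ n * ε * (H ^ 3 * α) := by gcongr
        _ = H ^ 3 * (n * α * ε) := by ring
    · rw [div_le_iff₀ hε]
      linarith
  · rw [div_le_iff₀ (by positivity), ← mul_assoc] at h
    refine ⟨h.trans (le_mul_of_one_le_left (by positivity) h2), ?_⟩
    rw [div_le_iff₀ hε]
    have : n * α * ε ≤ n * 1 * ε := by gcongr
    linarith

theorem exists_programs_of_minSize_le {n d k r g C : ℕ} {α β ε : ℝ} (hn : 1 ≤ n) (hr : 1 ≤ r)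
    (hrk : r ≤ k) (hkd : k ≤ d) (hd : 2 ≤ d) (hα : 0 < α) (hα2 : α < 1 / 2) (hβ : 0 < β)
    (hε : 0 < ε) (hg : 1 + 2 / β ≤ 2 ^ g) (hC : 2000 + 10 * g ≤ C)
    (hmin : minSize C 1 r k d α ε ≤ n) :
    ∃ (san ev : Program) (T₁ T₂ : ℕ),
      RunsInTime san ev n d k T₁ T₂ (C * n * growth C 1 r k d α) ∧
      IsDP ε (summary san n d T₁) ∧
      IsAccurate α β (summary san n d T₁) (evaluate ev (k := k) T₂) (rOfK r) := by
  have hsq := baseExp_sq (r := r) (k := k) hα hα2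
  have hx := baseExp_ge hr hrk hα hα2
  have hlog := one_le_log_baseExp hr hrk hα hα2
  have hlam := log_inv_gt hα hα2
  obtain ⟨t, N, a, hN1, ha, ht, hN⟩ := exists_isThresholdApprox_of_degree_le hr hrk hd hα hα2
  have hgrowth := growth_natCast C r k d α
  have hH1 := one_le_rpow_baseExp hd r k α
  have hmin' := le_mul_of_minSize_le (n := n) (d := d) (k := k) (r := r) (C := C) hα (by linarith)
    hε hH1
  rw [hgrowth]
  generalize baseExp r k α = x at *
  generalize hY : x * Real.log (x + 2) = Y at *
  generalize hH : (d : ℝ) ^ Y = H at *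
  have hxY : x ≤ Y := hY ▸ le_mul_of_one_le_right (by linarith) hlog
  have hd2 : (2 : ℝ) ≤ d := by exact_mod_cast hd
  have hlogd : 69 / 100 ≤ Real.log d := by
    have h1 : Real.log 2 ≤ Real.log d := Real.log_le_log (by norm_num) hd2
    linarith [Real.log_two_gt_d9]
  have hHY : 1 + 69 / 100 * Y ≤ H := by
    rw [← hH, Real.rpow_def_of_pos (by linarith)]
    have := Real.add_one_le_exp (Real.log d * Y)
    nlinarith
  have hHpow : ∀ (y : ℝ) (p : ℕ), y ≤ p * Y → (d : ℝ) ^ y ≤ H ^ p := fun y p hy => by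
    rw [← hH, ← Real.rpow_natCast, ← Real.rpow_mul (by linarith)]
    exact Real.rpow_le_rpow_of_exponent_le (by linarith) (by linarith)
  have hH2 : 2 ≤ H ^ 2 := by nlinarith
  have hHd : (d : ℝ) ≤ H ^ 2 := by
    have := hHpow 1 2 (by push_cast; linarith)
    rwa [Real.rpow_one] at this
  have hHdt : (d : ℝ) ^ t ≤ H ^ 40 := by
    have := hHpow t 40 (by push_cast; linarith)
    rwa [Real.rpow_natCast] at this
  obtain ⟨hH2t, hHt, hHd1t, hHM⟩ := numSets_le_pow hd hHdt
  have hHα : 1 / α ≤ (d : ℝ) ^ (x + 1) → 1 / α ≤ H ^ 3 := fun h =>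
    h.trans (hHpow _ 3 (by push_cast; linarith))
  have hHN : (N : ℝ) ≤ H ^ 130 := by
    rcases hN with rfl | ⟨h1, h2⟩
    · rw [Nat.cast_one]
      exact one_le_pow₀ hH1
    · exact denominator_le_pow hkd hH1 hH2 hHt hHd1t hα (hHα h1) h2
  -- From log(1/α) ≤ x² and log 2 ≥ 1/2. The exponent bounds the number of bits that the scaling
  -- needs for `α`, so even a tiny `α` enters the length only through x².
  have hw1 : 1 / α ≤ 2 ^ ⌈2 * x ^ 2⌉₊ := by
    have h1 : Real.log (1 / α) ≤ x ^ 2 := by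
      rw [hsq]
      have : (1 : ℝ) ≤ r * k := by exact_mod_cast Nat.mul_pos hr (hr.trans hrk)
      exact le_mul_of_one_le_left (by linarith) this
    have h2 : 2 * x ^ 2 ≤ ⌈2 * x ^ 2⌉₊ := Nat.le_ceil _
    rw [← Real.log_le_log_iff (by positivity) (by positivity), Real.log_pow]
    nlinarith [Real.log_two_gt_d9]
  have hHw : (⌈2 * x ^ 2⌉₊ : ℝ) ≤ H ^ 8 := by
    have h1 : (⌈2 * x ^ 2⌉₊ : ℝ) ≤ 2 * x ^ 2 + 1 := (Nat.ceil_lt_add_one (by positivity)).le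
    have h2 : x ≤ 3 / 2 * H := by linarith
    have h3 : x ^ 2 ≤ (3 / 2 * H) ^ 2 := by gcongr
    calc (⌈2 * x ^ 2⌉₊ : ℝ) ≤ 8 * H ^ 2 := by nlinarith
      _ ≤ H ^ 6 * H ^ 2 := mul_le_mul_of_nonneg_right (eight_le_pow hH2) (by positivity)
      _ = H ^ 8 := by rw [← pow_add]
  obtain ⟨hmin1, hmin2⟩ := hmin' hHα hgrowth hmin
  have hsize : (numSets d t : ℝ) ^ 3 * 2 ^ (t + 8) * 2 ^ g ≤ n * α * ε := by
    refine le_of_mul_le_mul_left ?_ (by positivity : 0 < H ^ 3)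
    refine le_trans ?_ hmin1
    calc H ^ 3 * ((numSets d t : ℝ) ^ 3 * 2 ^ (t + 8) * 2 ^ g) ≤ H ^ 3 * H ^ (416 + 2 * g) :=
          mul_le_mul_of_nonneg_left (size_le_pow hH1 hH2 hH2t hHM) (by positivity)
      _ = H ^ (3 + (416 + 2 * g)) := (pow_add _ _ _).symm
      _ ≤ H ^ C := pow_le_pow_right₀ hH1 (by omega)
  -- The exponent 130 is the one for `N`, the largest of the fixed ones, and `2 * g` accounts for
  -- `g`. Its triple, from the cube in the length bound, is below `C`.
  have hE : ∀ {y : ℝ} (p : ℕ), p ≤ 130 + 2 * g → y ≤ H ^ p → y ≤ H ^ (130 + 2 * g) :=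
    fun p hp hy => hy.trans (pow_le_pow_right₀ hH1 hp)
  have hHg : (g : ℝ) ≤ H ^ (2 * g) := by
    have h1 : (g : ℝ) ≤ 2 ^ g := by exact_mod_cast Nat.lt_two_pow_self.le
    rw [pow_mul]
    exact h1.trans (pow_le_pow_left₀ (by norm_num) hH2 g)
  obtain ⟨san, ev, T₁, T₂, ⟨h1, h2, h3⟩, h4, h5⟩ := exists_programs (E := H ^ (130 + 2 * g)) hn hN1
    hα hβ hε ha hw1 hg hmin2 hsize (one_le_pow₀ hH1) (hE 2 (by omega) hHd)
    (hE 40 (by omega) (by linarith)) (hE 120 (by omega) hHM) (hE 130 (by omega) hHN)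
    (hE 8 (by omega) hHw) (hE (2 * g) (by omega) hHg)
  refine ⟨san, ev, T₁, T₂, ⟨h1, h2, h3.trans ?_⟩, h4, h5⟩
  have h6 : (1000 : ℝ) ≤ C := by exact_mod_cast (by omega)
  have h7 : H ^ ((130 + 2 * g) * 3) ≤ H ^ C := pow_le_pow_right₀ hH1 (by omega)
  rw [← pow_mul]
  gcongr

end RofK

theorem theorem2 (β : ℝ) (hβ : 0 < β) :
    ∃ (C : ℝ) (c : ℕ), 0 < C ∧
      ∀ (r k d n : ℕ), r ≤ k → k ≤ d → 2 ≤ d →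
        ∀ (α ε : ℝ), 0 < α → α ≤ 1 → 0 < ε →
          ∃ (san ev : RofK.Program) (T₁ T₂ : ℕ),
            RofK.RunsInTime san ev n d k T₁ T₂ (C * n * RofK.growth C c r k d α) ∧
            RofK.IsDP ε (RofK.summary san n d T₁) ∧
            (RofK.minSize C c r k d α ε ≤ n →
              RofK.IsAccurate α β (RofK.summary san n d T₁)
                (RofK.evaluate ev (k := k) T₂) (RofK.rOfK r)) := by
  obtain ⟨g, hg, -⟩ := RofK.exists_two_pow (1 + 2 / β)
  refine ⟨(2000 + 10 * g : ℕ), 1, by positivity, fun r k d n hrk hkd hd α ε hα hα1 hε => ?_⟩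
  have hG : 1 ≤ RofK.growth ((2000 + 10 * g : ℕ) : ℝ) 1 r k d α := by
    rw [RofK.growth_natCast]
    exact one_le_pow₀ (RofK.one_le_rpow_baseExp hd r k α)
  by_cases hmin : RofK.minSize ((2000 + 10 * g : ℕ) : ℝ) 1 r k d α ε ≤ n
  swap
  -- With too few rows no accuracy is demanded and empty programs do. This includes `n = 0`, where
  -- the time budget is 0 and nothing else would fit.
  · exact ⟨[], [], 0, 0, RofK.runsInTime_nil (by simp) n d k (by
      have : 0 < RofK.growth ((2000 + 10 * g : ℕ) : ℝ) 1 r k d α := by linarith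
      simp only [List.length_nil, Nat.cast_zero, mul_zero]
      positivity), RofK.isDP_nil hε.le, fun h => absurd h hmin⟩
  have hn : 1 ≤ n := by
    have h1 : 0 < RofK.minSize ((2000 + 10 * g : ℕ) : ℝ) 1 r k d α ε := by
      have : 0 < RofK.growth ((2000 + 10 * g : ℕ) : ℝ) 1 r k d α := by linarith
      rw [RofK.minSize]
      split_ifs <;> positivity
    exact_mod_cast h1.trans_le hmin
  have hB : (8 : ℝ) ≤ (2000 + 10 * g : ℕ) * n *
      RofK.growth ((2000 + 10 * g : ℕ) : ℝ) 1 r k d α := by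
    have h1 : (8 : ℝ) ≤ (2000 + 10 * g : ℕ) := by exact_mod_cast (by omega)
    have h2 : (1 : ℝ) ≤ n := by exact_mod_cast hn
    calc (8 : ℝ) = 8 * 1 * 1 := by norm_num
      _ ≤ _ := by gcongr
  -- For `α` near 1, and below for `r = 0`, x can vanish and the budget degenerates to a constant
  -- times `n`; a constant answer then suffices. Otherwise x is at least 4/5.
  rcases le_or_gt (1 / 2) α with hα2 | hα2
  · refine ⟨[], RofK.answerHalf, 0, 4, RofK.runsInTime_nil ?_ n d k ?_, RofK.isDP_nil hε.le,
      fun _ => RofK.isAccurate_nil hβ.le RofK.evaluate_answerHalf fun D S => ?_⟩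
    · simp [RofK.answerHalf, RofK.Instr.IsStraight]
    · refine le_trans ?_ hB
      simp only [RofK.answerHalf, List.length_cons, List.length_nil]
      norm_num
    · have h1 := RofK.answer_nonneg (RofK.rOfK r S) D
      have h2 := RofK.answer_le_one (RofK.rOfK r S) D
      rw [abs_le]
      constructor <;> linarith
  rcases Nat.eq_zero_or_pos r with rfl | hr
  · refine ⟨[], RofK.answerOne, 0, 3, RofK.runsInTime_nil ?_ n d k ?_, RofK.isDP_nil hε.le,
      fun _ => RofK.isAccurate_nil hβ.le RofK.evaluate_answerOne fun D S => ?_⟩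
    · simp [RofK.answerOne, RofK.Instr.IsStraight]
    · refine le_trans ?_ hB
      simp only [RofK.answerOne, List.length_cons, List.length_nil]
      norm_num
    · rw [RofK.answer_eq_one hn (q := RofK.rOfK 0 S) fun x => Nat.zero_le _, sub_self, abs_zero]
      exact hα.le
  · obtain ⟨san, ev, T₁, T₂, h1, h2, h3⟩ :=
      RofK.exists_programs_of_minSize_le hn hr hrk hkd hd hα hα2 hβ hε hg le_rfl hmin
    exact ⟨san, ev, T₁, T₂, h1, h2, fun _ => h3⟩
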